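/- For $\nu\in\mathbb C$, $p\in\mathbb Z$ and $z\in\mathbb C\smallsetminus\{0\}$ put $$J_{\nu,p}(z)=J_{\nu+p}(z)\,J_{\nu-p}(\bar z),\qquad \boldsymbol J_{\nu,p}(z)=\frac{2\pi^2}{\sin(\pi\nu)}\bigl(J_{-\nu,-p}(z)-J_{\nu,p}(z)\bigr),$$ where $J_\nu(z)=\sum_{n\ge 0}\frac{(-1)^n(z/2)^{\nu+2n}}{n!\,\Gamma(\nu+n+1)}$ is the Bessel function of the first kind, complex conjugate values of the logarithm are used for $z$ and $\bar z$ (so that $J_{\nu,p}(z)$ is single-valued in $z$), and $\boldsymbol J_{\nu,p}(z)$ is defined by its limit in $\nu$ when $\nu$ is an integer. Let $K,P>0$ and $h(\kappa,p)=\exp\bigl(-(\kappa/K)^2-(p/P)^2\bigr)$ for $(\kappa,p)\in\mathbb R\times\mathbb Z$, and let $\mathrm d\mu$ be the product of Lebesgue measure on $\mathbb R$ and counting measure on $\mathbb Z$. For $z\in\mathbb C\smallsetminus\{0\}$ define $$H(z)=\iint_{\mathbb R\times\mathbb Z}h(\kappa,p)\,\boldsymbol J_{i\kappa,p}(z)\,(\kappa^2+p^2)\,\mathrm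 d\mu(\kappa,p).$$ Define $$\mathrm{trh}(r,\omega)=\cosh r\cos\omega+i\sinh r\sin\omega,\qquad k(r)=\sqrt\pi\,K\,e^{-(Kr)^2},\qquad \theta(\omega)=\sqrt\pi\,P\sum_{q\in\mathbb Z}e^{-(P(\omega+\pi q))^2}.$$ Then the series defining $\theta$ converges for every real $\omega$, $\theta$ is twice continuously differentiable, and for every $z\in\mathbb C\smallsetminus\{0\}$ the integral defining $H(z)$ and the integral below converge absolutely, and $$H(z)=-\iint_{\mathbb R\times\mathbb R/\pi\mathbb Z}\cos\bigl(2\,\mathrm{Re}(z\,\mathrm{trh}(r,\omega))\bigr)\bigl(k''(r)\,\theta(\omega)+k(r)\,\theta''(\omega)\bigr)\,\mathrm dr\,\mathrm d\omega,$$ where $\mathrm dr\,\mathrm d\omega$ is Lebesgue measure, $\mathbb R/\pi\mathbb Z$ having total length $\pi$ (the integrand is $\pi$-periodic in $\omega$). -/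

import Mathlib

open MeasureTheory

namespace BesselRepn

noncomputable section

/-! ### Bessel functions -/

/-- The Bessel function of the first kind of order `ν` on the Riemann surface of the logarithm:
the variable is `z = exp ℓ`, and `(z / 2) ^ (ν + 2 n)` means `exp ((ν + 2 n) (ℓ - log 2))`.
(At a pole of `Gamma` the Mathlib value of `Gamma` is `0`, so the quotient is `0` there, which is
the correct value of the reciprocal of `Gamma`.) -/
def besselJLog (ν ℓ : ℂ) : ℂ :=
  ∑' n : ℕ, (-1) ^ n * Complex.exp ((ν + 2 * n) * (ℓ - Real.log 2)) /
    ((n.factorial : ℂ) * Complex.Gamma (ν + n + 1))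

/-- The principal branch of the Bessel function of the first kind of order `ν`. -/
def besselJ (ν z : ℂ) : ℂ :=
  ∑' n : ℕ, (-1) ^ n * (z / 2) ^ (ν + 2 * n) /
    ((n.factorial : ℂ) * Complex.Gamma (ν + n + 1))

/-- The function `J_{ν + p}(z) J_{ν - p}(z̄)` for `z ≠ 0`. The two factors are taken
with complex conjugate logarithms of `z` and `z̄`, so that the product is a single-valued function
of `z`, equal to `|z/2|^(2ν) (z/|z|)^(2p)` times a power series in `z` and `z̄`. -/
def besselJ₂ (ν : ℂ) (p : ℤ) (z : ℂ) : ℂ :=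
  besselJLog (ν + p) (Complex.log z) *
    besselJLog (ν - p) ((starRingEnd ℂ) (Complex.log z))

/-- The quotient `2 π² / sin (π ν) * (J_{-ν,-p}(z) - J_{ν,p}(z))`. -/
def boldJQuot (ν : ℂ) (p : ℤ) (z : ℂ) : ℂ :=
  2 * (Real.pi : ℂ) ^ 2 / Complex.sin (Real.pi * ν) * (besselJ₂ (-ν) (-p) z - besselJ₂ ν p z)

open Classical in
/-- The complex Bessel function `𝑱_{ν,p}(z)`: the quotient above, with its removable
singularities in `ν` (the integers) removed. -/
def boldJ (ν : ℂ) (p : ℤ) (z : ℂ) : ℂ :=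
  if Complex.sin (Real.pi * ν) = 0 then
    Filter.limUnder (nhdsWithin ν {ν}ᶜ) (fun s => boldJQuot s p z)
  else boldJQuot ν p z

theorem besselJLog_log (ν : ℂ) {z : ℂ} (hz : z ≠ 0) :
    besselJLog ν (Complex.log z) = besselJ ν z := by
  unfold besselJLog besselJ
  have h2 : Complex.log (z / 2) = Complex.log z - Real.log 2 := by
    have h := Complex.log_ofReal_mul (r := (2 : ℝ)⁻¹) (by norm_num) hz
    rw [Real.log_inv] at h
    rw [div_eq_inv_mul]
    push_cast at h
    rw [h]
    ring
  have h3 : z / 2 ≠ 0 := div_ne_zero hz two_ne_zero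
  refine tsum_congr fun n => ?_
  rw [Complex.cpow_def_of_ne_zero h3, h2, mul_comm (Complex.log z - Real.log 2)]

/-- Off the negative real axis, `besselJ₂` is the product of the principal branches. -/
theorem besselJ₂_eq (ν : ℂ) (p : ℤ) {z : ℂ} (hz : z ∈ Complex.slitPlane) :
    besselJ₂ ν p z = besselJ (ν + p) z * besselJ (ν - p) ((starRingEnd ℂ) z) := by
  have h0 : z ≠ 0 := Complex.slitPlane_ne_zero hz
  have h1 : (starRingEnd ℂ) z ≠ 0 := by simpa using h0
  rw [besselJ₂, ← Complex.log_conj z (Complex.mem_slitPlane_iff_arg.mp hz).1,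
    besselJLog_log _ h0, besselJLog_log _ h1]

/-! ### The Bessel integral -/

/-- The usual measure on `ℝ × ℤ`: Lebesgue measure times counting measure. -/
def measA : Measure (ℝ × ℤ) := (volume : Measure ℝ).prod Measure.count

/-- The Gaussian weight `exp (-(κ/K)² - (p/P)²)`. -/
def weight (K P κ : ℝ) (p : ℤ) : ℝ := Real.exp (-(κ / K) ^ 2 - ((p : ℝ) / P) ^ 2)

/-- The integrand `h(κ,p) 𝑱_{iκ,p}(z) (κ² + p²)`. -/
def besselIntegrand (K P : ℝ) (z : ℂ) (x : ℝ × ℤ) : ℂ :=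
  (weight K P x.1 x.2 : ℂ) * boldJ (Complex.I * x.1) x.2 z * ((x.1 : ℂ) ^ 2 + (x.2 : ℂ) ^ 2)

/-- The Bessel integral of the Gaussian weight. -/
def besselIntegral (K P : ℝ) (z : ℂ) : ℂ := ∫ x, besselIntegrand K P z x ∂measA

/-! ### The dual side -/

/-- The trigonometric-hyperbolic function `cosh r cos ω + i sinh r sin ω`. -/
def trh (r ω : ℝ) : ℂ :=
  (Real.cosh r * Real.cos ω : ℝ) + Complex.I * (Real.sinh r * Real.sin ω : ℝ)

/-- The Gaussian `√π K exp (-(K r)²)`. -/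
def gaussK (K r : ℝ) : ℝ := √Real.pi * K * Real.exp (-(K * r) ^ 2)

/-- The periodized Gaussian `√π P ∑_q exp (-(P (ω + π q))²)`, the sum being over all integers. -/
def thetaP (P ω : ℝ) : ℝ :=
  √Real.pi * P * ∑' q : ℤ, Real.exp (-(P * (ω + Real.pi * q)) ^ 2)

/-- The function `cos (2 Re (z trh (r, ω))) (k''(r) θ(ω) + k(r) θ''(ω))` of real `r` and `ω`. -/
def dualFun (K P : ℝ) (z : ℂ) (r ω : ℝ) : ℝ :=
  Real.cos (2 * (z * trh r ω).re) *
    (deriv (deriv (gaussK K)) r * thetaP P ω + gaussK K r * deriv (deriv (thetaP P)) ω)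

theorem thetaP_periodic (P : ℝ) : Function.Periodic (thetaP P) Real.pi := by
  intro ω
  unfold thetaP
  congr 1
  rw [← (Equiv.addRight (1 : ℤ)).tsum_eq
    (fun q : ℤ => Real.exp (-(P * (ω + Real.pi * q)) ^ 2))]
  refine tsum_congr fun q => ?_
  simp only [Equiv.coe_addRight]
  push_cast
  ring_nf

theorem deriv_periodic {f : ℝ → ℝ} {c : ℝ} (hf : Function.Periodic f c) :
    Function.Periodic (deriv f) c := by
  intro x
  rw [← deriv_comp_add_const f c x]
  congr 1
  exact funext hf

theorem dualFun_periodic (K P : ℝ) (z : ℂ) (r : ℝ) :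
    Function.Periodic (dualFun K P z r) Real.pi := by
  intro ω
  have h : trh r (ω + Real.pi) = -trh r ω := by
    unfold trh
    rw [Real.cos_add_pi, Real.sin_add_pi]
    push_cast
    ring
  have h1 : 2 * (z * trh r (ω + Real.pi)).re = -(2 * (z * trh r ω).re) := by
    rw [h, mul_neg, Complex.neg_re]
    ring
  unfold dualFun
  rw [h1, Real.cos_neg, thetaP_periodic P ω, deriv_periodic (deriv_periodic (thetaP_periodic P)) ω]

/-- The length of the circle `ℝ / πℤ` is positive, so that it carries its Lebesgue measure, of
total mass `π`. -/
instance factPiPos : Fact (0 < Real.pi) := ⟨Real.pi_pos⟩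

/-- The `π`-periodic integrand of the dual side as a function on `ℝ × ℝ/πℤ`. -/
def dualIntegrand (K P : ℝ) (z : ℂ) (x : ℝ × AddCircle Real.pi) : ℝ :=
  (dualFun_periodic K P z x.1).lift x.2

end

end BesselRepn

open MeasureTheory Filter Topology Set

namespace BesselRepn

/-! Write `B_p(w)` for `angInt p w`, the integral of `cos (Re (e^(iω) w)) e^(2ipω)` over `[0, π]`.
Everything rests on an integral representation: for real `κ ≠ 0`, `𝑱_{iκ,p}(z) = 4 ∫ e^(2iκr) B_p(z
e^r + z̄ e^(-r)) dr` (`boldJ_eq_hypInt`). Since `Re (e^(iω) (z e^r + z̄ e^(-r))) = 2 Re (z trh(r,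
ω))`, this exhibits `𝑱` as an iterated Fourier integral of `cos (2 Re (z trh))` in `(r, ω)`.
Integrating against `h(κ,p) (κ² + p²)` puts the Fourier transform of that density under the
integral. It is `-(k'' θ + k θ'') / 4`: the Gaussian transforms to `k`, its sum over the integers to
`θ` by Poisson summation, and the factors `κ²`, `p²` become second derivatives.

The integrand on `(κ, p, r, ω)` has no decay in `r`, so Fubini is applied twice. The `ω`-integral is
taken first: `B_p(w) = O((1 + |p|) |w|^(-1/3))`, and `|z e^r + z̄ e^(-r)|` grows like `e^|r|`, which
permits exchanging `r` with `(κ, p)`. Then, for fixed `r`, the compact `ω`-integral is exchanged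
with `(κ, p)`.

The representation is proved by Laplace transformation. Replace `z` by `√x z` and multiply by `x^p`;
both sides become functions of `x > 0`. The products of Bessel functions transform by Weber's second
exponential integral (`laplace_besselPsi_mul`), while `B_p` transforms to an exponential, so that
the `r`-integral becomes a Macdonald-type integral with a polynomial factor `(1 + A e^(-t))^(2p)`
(`integral_hypPt_eq`). Both are generated by the same contiguity relations from the case without the
factor (`kIntPow_eq`), which is the formula for `K_M` by `I_{-M} - I_M` (`kInt_eq_kSer`).
Injectivity of the Laplace transform (`eq_zero_of_laplace_eq_zero`) at `x = 1` concludes. -/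

/-- The reciprocal of `Gamma` is bounded along arithmetic progressions of step one. -/
theorem exists_norm_inv_Gamma_le (μ : ℂ) :
    ∃ C : ℝ, 0 ≤ C ∧ ∀ k : ℕ, ‖(Complex.Gamma (k + 1 + μ))⁻¹‖ ≤ C := by
  obtain ⟨N, hN⟩ := exists_nat_ge ‖μ‖
  -- Beyond `‖μ‖` the factor `k + 1 + μ` in the functional equation has norm at least one, so the
  -- reciprocals decrease; finitely many remain.
  have hdec : ∀ k : ℕ, N ≤ k → ‖(Complex.Gamma (k + 1 + μ))⁻¹‖ ≤
      ‖(Complex.Gamma (N + 1 + μ))⁻¹‖ := by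
    intro k hk
    induction k, hk using Nat.le_induction with
    | base => exact le_rfl
    | succ k hk ih =>
      refine le_trans ?_ ih
      have h := Complex.one_div_Gamma_eq_self_mul_one_div_Gamma_add_one ((k : ℂ) + 1 + μ)
      rw [h, norm_mul]
      have h1 : (1 : ℝ) ≤ ‖(k : ℂ) + 1 + μ‖ := by
        have h2 : ‖(k : ℂ) + 1‖ = k + 1 := by
          have : (k : ℂ) + 1 = ((k + 1 : ℕ) : ℂ) := by push_cast; ring
          rw [this, Complex.norm_natCast]; push_cast; ring
        have h3 := norm_sub_le_norm_add ((k : ℂ) + 1) μ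
        have h4 : (N : ℝ) ≤ k := by exact_mod_cast hk
        linarith
      have h5 : ((k + 1 : ℕ) : ℂ) + 1 + μ = (k : ℂ) + 1 + μ + 1 := by push_cast; ring
      rw [h5]
      exact le_mul_of_one_le_left (norm_nonneg _) h1
  refine ⟨∑ i ∈ Finset.range (N + 1), ‖(Complex.Gamma (i + 1 + μ))⁻¹‖,
    Finset.sum_nonneg fun i _ => norm_nonneg _, fun k => ?_⟩
  have hle : ∀ j : ℕ, j ≤ N → ‖(Complex.Gamma (j + 1 + μ))⁻¹‖ ≤
      ∑ i ∈ Finset.range (N + 1), ‖(Complex.Gamma (i + 1 + μ))⁻¹‖ := fun j hj =>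
    Finset.single_le_sum (f := fun i : ℕ => ‖(Complex.Gamma (i + 1 + μ))⁻¹‖)
      (fun i _ => norm_nonneg _) (Finset.mem_range.mpr (by omega))
  rcases le_total k N with h | h
  · exact hle k h
  · exact (hdec k h).trans (hle N le_rfl)

/-! ### The normalised modified Bessel series `y^(-μ/2) I_μ(2√y)` -/

/-- The entire function `∑ y ^ k / (k! Γ(k + 1 + μ))`. -/
noncomputable def besselPsi (μ y : ℂ) : ℂ :=
  ∑' k : ℕ, y ^ k / ((k.factorial : ℂ) * Complex.Gamma (k + 1 + μ))

theorem norm_besselPsi_term_le {μ : ℂ} {C : ℝ}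
    (hC : ∀ k : ℕ, ‖(Complex.Gamma (k + 1 + μ))⁻¹‖ ≤ C) (y : ℂ) (k : ℕ) :
    ‖y ^ k / ((k.factorial : ℂ) * Complex.Gamma (k + 1 + μ))‖ ≤
      C * (‖y‖ ^ k / k.factorial) := by
  rw [div_mul_eq_div_mul_one_div, one_div, norm_mul, norm_div, norm_pow, Complex.norm_natCast,
    mul_comm]
  exact mul_le_mul_of_nonneg_right (hC k) (by positivity)

theorem summable_besselPsi (μ y : ℂ) :
    Summable fun k : ℕ => y ^ k / ((k.factorial : ℂ) * Complex.Gamma (k + 1 + μ)) := by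
  obtain ⟨C, -, hC⟩ := exists_norm_inv_Gamma_le μ
  exact Summable.of_norm_bounded ((Real.summable_pow_div_factorial ‖y‖).mul_left C)
    (norm_besselPsi_term_le hC y)

theorem hasDerivAt_besselPsi (μ y : ℂ) :
    HasDerivAt (besselPsi μ) (besselPsi (μ + 1) y) y := by
  obtain ⟨C, hC0, hC⟩ := exists_norm_inv_Gamma_le μ
  set R : ℝ := ‖y‖ + 1
  have hshift : ∀ (x : ℂ) (k : ℕ), ((k + 1 : ℕ) : ℂ) * x ^ (k + 1 - 1) /
      (((k + 1).factorial : ℂ) * Complex.Gamma ((k + 1 : ℕ) + 1 + μ)) =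
      x ^ k / ((k.factorial : ℂ) * Complex.Gamma (k + 1 + (μ + 1))) := by
    intro x k
    have h1 : ((k + 1 : ℕ) : ℂ) ≠ 0 := by exact_mod_cast Nat.succ_ne_zero k
    rw [Nat.factorial_succ, Nat.cast_mul, mul_assoc, Nat.add_sub_cancel, mul_div_mul_left _ _ h1]
    congr 3
    push_cast
    ring
  have hu : Summable fun k : ℕ => (k : ℝ) * R ^ (k - 1) / k.factorial * C := by
    rw [← summable_nat_add_iff 1]
    refine ((Real.summable_pow_div_factorial R).mul_right C).congr fun k => ?_
    rw [Nat.factorial_succ, Nat.add_sub_cancel]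
    have h1 : ((k + 1 : ℕ) : ℝ) ≠ 0 := by exact_mod_cast Nat.succ_ne_zero k
    rw [Nat.cast_mul, mul_div_mul_left _ _ h1]
  have h := hasDerivAt_tsum_of_isPreconnected (𝕜 := ℂ) hu Metric.isOpen_ball
    (convex_ball (0 : ℂ) R).isPreconnected
    (g := fun (k : ℕ) (x : ℂ) => x ^ k / ((k.factorial : ℂ) * Complex.Gamma (k + 1 + μ)))
    (g' := fun (k : ℕ) (x : ℂ) => k * x ^ (k - 1) /
      ((k.factorial : ℂ) * Complex.Gamma (k + 1 + μ)))
    (y₀ := y) (y := y) (fun k x _ => (hasDerivAt_pow k x).div_const _) ?_ (by simp [R])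
    (summable_besselPsi μ y) (by simp [R])
  · have hs : Summable fun k : ℕ => (k : ℂ) * y ^ (k - 1) /
        ((k.factorial : ℂ) * Complex.Gamma (k + 1 + μ)) := by
      rw [← summable_nat_add_iff 1]
      exact (summable_besselPsi (μ + 1) y).congr fun k => (hshift y k).symm
    rw [hs.tsum_eq_zero_add] at h
    simp only [hshift, Nat.cast_zero, zero_mul, zero_div, zero_add] at h
    exact h
  · intro k x hx
    rw [div_mul_eq_div_mul_one_div, one_div, norm_mul, norm_div, norm_mul, norm_pow,
      Complex.norm_natCast, Complex.norm_natCast]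
    refine mul_le_mul ?_ (hC k) (norm_nonneg _) (by positivity)
    have : ‖x‖ ≤ R := by simpa using (Metric.mem_ball.mp hx).le
    gcongr

/-- Split `1/Γ(k + μ) = (k + μ)/Γ(k + 1 + μ)`: the part with `μ` reproduces the series, and the part
with `k` cancels against `k!` and shifts the summation by one. -/
theorem besselPsi_recurrence (μ y : ℂ) :
    besselPsi (μ - 1) y = μ * besselPsi μ y + y * besselPsi (μ + 1) y := by
  have hμ := summable_besselPsi μ y
  have hμ' := (summable_besselPsi (μ + 1) y).mul_left y
  have hk : ∀ k : ℕ, y * (y ^ k / ((k.factorial : ℂ) * Complex.Gamma (k + 1 + (μ + 1)))) =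
      ((k + 1 : ℕ) : ℂ) * y ^ (k + 1) /
        (((k + 1).factorial : ℂ) * Complex.Gamma ((k + 1 : ℕ) + 1 + μ)) := by
    intro k
    have h1 : ((k + 1 : ℕ) : ℂ) ≠ 0 := by exact_mod_cast Nat.succ_ne_zero k
    rw [Nat.factorial_succ, Nat.cast_mul, mul_assoc, mul_div_mul_left _ _ h1, pow_succ,
      mul_comm, div_mul_eq_mul_div]
    congr 3
    push_cast
    ring
  have hs : Summable fun k : ℕ => (k : ℂ) * y ^ k /
      ((k.factorial : ℂ) * Complex.Gamma (k + 1 + μ)) := by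
    rw [← summable_nat_add_iff 1]
    exact hμ'.congr hk
  have hy : y * besselPsi (μ + 1) y =
      ∑' k : ℕ, (k : ℂ) * y ^ k / ((k.factorial : ℂ) * Complex.Gamma (k + 1 + μ)) := by
    rw [hs.tsum_eq_zero_add, besselPsi, ← tsum_mul_left, tsum_congr hk]
    simp
  rw [hy, besselPsi, besselPsi, ← tsum_mul_left, ← (hμ.mul_left μ).tsum_add hs]
  refine tsum_congr fun k => ?_
  have h := Complex.one_div_Gamma_eq_self_mul_one_div_Gamma_add_one ((k : ℂ) + μ)
  have e1 : (k : ℂ) + 1 + (μ - 1) = k + μ := by ring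
  have e2 : (k : ℂ) + 1 + μ = k + μ + 1 := by ring
  rw [e1, e2, div_mul_eq_div_mul_one_div, div_mul_eq_div_mul_one_div, div_mul_eq_div_mul_one_div,
    one_div, one_div, h]
  ring

theorem continuous_besselPsi (μ : ℂ) : Continuous (besselPsi μ) :=
  continuous_iff_continuousAt.mpr fun y => (hasDerivAt_besselPsi μ y).continuousAt

theorem besselPsi_zero (μ : ℂ) : besselPsi μ 0 = (Complex.Gamma (1 + μ))⁻¹ := by
  rw [besselPsi, tsum_eq_single 0]
  · simp
  · intro k hk
    simp [hk]

/-! ### The integral `∫ exp (M t - e ^ t - y e ^ (-t)) dt` -/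

/-- The integral `∫ exp (M t - e ^ t - y e ^ (-t)) dt`, which is `2 y ^ (M / 2) K_M(2 √y)`. -/
noncomputable def kInt (M : ℂ) (y : ℝ) : ℂ :=
  ∫ t : ℝ, Complex.exp (M * t - Real.exp t - y * Real.exp (-t))

theorem norm_kInt_integrand (M : ℂ) (y t : ℝ) :
    ‖Complex.exp (M * t - Real.exp t - y * Real.exp (-t))‖ =
      Real.exp (M.re * t - Real.exp t - y * Real.exp (-t)) := by
  rw [Complex.norm_exp]
  congr 1
  simp [-Complex.ofReal_exp]

theorem continuous_kInt_integrand (M : ℂ) (y : ℝ) :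
    Continuous fun t : ℝ => Complex.exp (M * t - Real.exp t - y * Real.exp (-t)) := by
  fun_prop

/-- Gives a Gaussian majorant of the integrand of `kInt` uniform in `y ≥ m`, which serves both
integrability and differentiation under the integral. -/
theorem sq_le_exp_add_exp_neg {m y : ℝ} (hm0 : 0 ≤ m) (hm1 : m ≤ 1) (hmy : m ≤ y) (t : ℝ) :
    m * (t ^ 2 / 2) ≤ Real.exp t + y * Real.exp (-t) := by
  have hy : 0 ≤ y := hm0.trans hmy
  rcases le_total 0 t with h | h
  · have h1 := Real.quadratic_le_exp_of_nonneg h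
    have h2 : m * (t ^ 2 / 2) ≤ 1 * (t ^ 2 / 2) := by gcongr
    have h3 : 0 ≤ y * Real.exp (-t) := by positivity
    linarith
  · have h1 := Real.quadratic_le_exp_of_nonneg (neg_nonneg.mpr h)
    have h2 : m * (t ^ 2 / 2) ≤ y * Real.exp (-t) := by
      gcongr
      nlinarith
    have := Real.exp_pos t
    linarith

theorem integrable_exp_mul_sub_sq {m : ℝ} (hm : 0 < m) (σ : ℝ) :
    Integrable fun t : ℝ => Real.exp (σ * t - m * (t ^ 2 / 2)) := by
  have h := (integrable_cexp_quadratic' (b := ((-(m / 2) : ℝ) : ℂ))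
    (by simpa using hm) (σ : ℂ) 0).norm
  refine h.congr (ae_of_all _ fun t => ?_)
  simp only
  rw [Complex.norm_exp]
  congr 1
  simp [← Complex.ofReal_pow]
  ring

theorem norm_kInt_integrand_le (M : ℂ) {m y : ℝ} (hm0 : 0 ≤ m) (hm1 : m ≤ 1) (hmy : m ≤ y)
    (t : ℝ) : ‖Complex.exp (M * t - Real.exp t - y * Real.exp (-t))‖ ≤
      Real.exp (M.re * t - m * (t ^ 2 / 2)) := by
  rw [norm_kInt_integrand]
  have := sq_le_exp_add_exp_neg hm0 hm1 hmy t
  exact Real.exp_le_exp.mpr (by linarith)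

theorem integrable_kInt (M : ℂ) {y : ℝ} (hy : 0 < y) :
    Integrable fun t : ℝ => Complex.exp (M * t - Real.exp t - y * Real.exp (-t)) :=
  (integrable_exp_mul_sub_sq (lt_min one_pos hy) M.re).mono'
    (continuous_kInt_integrand M y).aestronglyMeasurable
    (ae_of_all _ (norm_kInt_integrand_le M (lt_min one_pos hy).le (min_le_left _ _)
      (min_le_right _ _)))

/-- The `t`-derivative of the integrand is a combination of the integrands for `M`, `M + 1` and `M -
1`, and its integral over the line is zero. -/
theorem kInt_add_one (M : ℂ) {y : ℝ} (hy : 0 < y) :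
    kInt (M + 1) y = M * kInt M y + y * kInt (M - 1) y := by
  set F : ℂ → ℝ → ℂ := fun M t => Complex.exp (M * t - Real.exp t - y * Real.exp (-t)) with hF
  have hd : ∀ t : ℝ, HasDerivAt (F M) (M * F M t - F (M + 1) t + y * F (M - 1) t) t := by
    intro t
    have h1 : HasDerivAt (fun t : ℝ => M * t - Real.exp t - y * Real.exp (-t) : ℝ → ℂ)
        (M * 1 - Real.exp t - y * ((-Real.exp (-t) : ℝ) : ℂ)) t := by
      have ha : HasDerivAt (fun t : ℝ => (t : ℂ)) 1 t := (hasDerivAt_id t).ofReal_comp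
      have hb := (Real.hasDerivAt_exp t).ofReal_comp
      have hc : HasDerivAt (fun t : ℝ => Real.exp (-t)) (-Real.exp (-t)) t := by
        simpa using (hasDerivAt_neg t).exp
      exact ((ha.const_mul M).sub hb).sub (hc.ofReal_comp.const_mul _)
    refine h1.cexp.congr_deriv ?_
    have e1 : F (M + 1) t = F M t * Complex.exp t := by
      simp only [hF]; rw [← Complex.exp_add]; ring_nf
    have e2 : F (M - 1) t = F M t * Complex.exp (-t) := by
      simp only [hF]; rw [← Complex.exp_add]; ring_nf
    rw [e1, e2]
    simp only [hF]
    push_cast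
    ring
  have i0 : Integrable (F M) := integrable_kInt M hy
  have i1 : Integrable (F (M + 1)) := integrable_kInt (M + 1) hy
  have i2 : Integrable (F (M - 1)) := integrable_kInt (M - 1) hy
  have h := integral_eq_zero_of_hasDerivAt_of_integrable hd
    (((i0.const_mul M).sub i1).add (i2.const_mul y)) i0
  have h2 : ∫ t, (M * F M t - F (M + 1) t + y * F (M - 1) t) =
      M * kInt M y - kInt (M + 1) y + y * kInt (M - 1) y := by
    rw [integral_add (f := fun t => M * F M t - F (M + 1) t) ((i0.const_mul M).sub i1)
      (i2.const_mul y), integral_sub (i0.const_mul M) i1, integral_const_mul, integral_const_mul]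
    rfl
  rw [h2] at h
  linear_combination -h

theorem hasDerivAt_kInt (M : ℂ) {y : ℝ} (hy : 0 < y) :
    HasDerivAt (kInt M) (-kInt (M - 1) y) y := by
  -- A lower bound for all parameters in the neighbourhood `(y/2, ∞)`, capped at one, so that a
  -- single Gaussian dominates there.
  have hm : 0 < min 1 (y / 2) := lt_min one_pos (by linarith)
  have h := hasDerivAt_integral_of_dominated_loc_of_deriv_le (𝕜 := ℝ) (μ := volume)
    (F := fun (y : ℝ) (t : ℝ) => Complex.exp (M * t - Real.exp t - y * Real.exp (-t)))
    (F' := fun (y : ℝ) (t : ℝ) => -Complex.exp ((M - 1) * t - Real.exp t - y * Real.exp (-t)))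
    (bound := fun t => Real.exp ((M - 1).re * t - min 1 (y / 2) * (t ^ 2 / 2)))
    (x₀ := y) (s := Ioi (y / 2)) (Ioi_mem_nhds (by linarith))
    (Eventually.of_forall fun x => (continuous_kInt_integrand M x).aestronglyMeasurable)
    (integrable_kInt M hy) (continuous_kInt_integrand (M - 1) y).neg.aestronglyMeasurable
    (ae_of_all _ fun t x hx => ?_) (integrable_exp_mul_sub_sq hm _)
    (ae_of_all _ fun t x hx => ?_)
  · have h2 := h.2
    rw [integral_neg] at h2
    exact h2
  · rw [norm_neg]
    exact norm_kInt_integrand_le (M - 1) hm.le (min_le_left _ _)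
      ((min_le_right _ _).trans (le_of_lt hx)) t
  · have ha : HasDerivAt (fun t : ℝ => (t : ℂ)) 1 x := (hasDerivAt_id x).ofReal_comp
    have h1 := ((ha.mul_const ((Real.exp (-t) : ℝ) : ℂ)).const_sub
      (M * t - Real.exp t : ℂ)).cexp
    refine h1.congr_deriv ?_
    have e2 : Complex.exp ((M - 1) * t - Real.exp t - x * Real.exp (-t)) =
        Complex.exp (M * t - Real.exp t - x * Real.exp (-t)) * Complex.exp (-t) := by
      rw [← Complex.exp_add]; ring_nf
    rw [e2]
    push_cast
    ring

/-- The substitution `t ↦ log y - t` interchanges `e^t` and `y e^(-t)`. -/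
theorem kInt_neg (M : ℂ) {y : ℝ} (hy : 0 < y) :
    kInt (-M) y = (y : ℂ) ^ (-M) * kInt M y := by
  have h : kInt M y = ∫ t : ℝ, (y : ℂ) ^ M *
      Complex.exp (-M * t - Real.exp t - y * Real.exp (-t)) := by
    rw [kInt, ← integral_sub_left_eq_self _ volume (Real.log y)]
    refine integral_congr_ae (ae_of_all _ fun t => ?_)
    have hy' : (y : ℂ) ≠ 0 := by exact_mod_cast hy.ne'
    simp only
    rw [Complex.cpow_def_of_ne_zero hy', ← Complex.exp_add, ← Complex.ofReal_log hy.le]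
    congr 1
    rw [Real.exp_sub, Real.exp_log hy, neg_sub, Real.exp_sub, Real.exp_log hy, Real.exp_neg]
    have := (Real.exp_pos t).ne'
    push_cast
    have ht : Complex.exp t ≠ 0 := Complex.exp_ne_zero _
    field_simp
    ring
  rw [h, integral_const_mul, ← mul_assoc, ← Complex.cpow_add _ _ (by exact_mod_cast hy.ne')]
  simp [kInt]

theorem integrable_exp_kInt_zero {σ : ℝ} (hσ : 0 < σ) :
    Integrable fun t : ℝ => Real.exp (σ * t - Real.exp t) := by
  have h := (Real.GammaIntegral_convergent hσ)
  have himg : Real.exp '' univ = Ioi 0 := by rw [image_univ, Real.range_exp]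
  rw [← himg] at h
  have h2 := (integrableOn_image_iff_integrableOn_abs_deriv_smul MeasurableSet.univ
    (fun x _ => (Real.hasDerivAt_exp x).hasDerivWithinAt) Real.exp_injective.injOn _).mp h
  rw [integrableOn_univ] at h2
  refine h2.congr (ae_of_all _ fun t => ?_)
  simp only [smul_eq_mul]
  rw [abs_of_pos (Real.exp_pos t), ← Real.exp_mul, ← Real.exp_add, ← Real.exp_add]
  ring_nf

/-- Euler's integral after `x = e^t`. It fixes the boundary value at `y = 0` by which `kInt` is
identified with `kSer`. -/
theorem kInt_zero {M : ℂ} (hM : 0 < M.re) : kInt M 0 = Complex.Gamma M := by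
  rw [Complex.Gamma_eq_integral hM, Complex.GammaIntegral]
  have himg : Real.exp '' univ = Ioi 0 := by rw [image_univ, Real.range_exp]
  rw [← himg, integral_image_eq_integral_abs_deriv_smul MeasurableSet.univ
    (fun x _ => (Real.hasDerivAt_exp x).hasDerivWithinAt) Real.exp_injective.injOn,
    Measure.restrict_univ, kInt]
  refine integral_congr_ae (ae_of_all _ fun t => ?_)
  simp only
  have ht : ((Real.exp t : ℝ) : ℂ) ≠ 0 := by exact_mod_cast (Real.exp_pos t).ne'
  rw [abs_of_pos (Real.exp_pos t), Complex.cpow_def_of_ne_zero ht, ← Complex.ofReal_log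
    (Real.exp_pos t).le, Real.log_exp, Complex.real_smul]
  push_cast
  rw [← Complex.exp_add, ← Complex.exp_add]
  ring_nf

theorem tendsto_kInt {M : ℂ} (hM : 0 < M.re) :
    Tendsto (kInt M) (𝓝[>] 0) (𝓝 (Complex.Gamma M)) := by
  rw [← kInt_zero hM]
  refine tendsto_integral_filter_of_dominated_convergence
    (fun t => Real.exp (M.re * t - Real.exp t))
    (Eventually.of_forall fun y => (continuous_kInt_integrand M y).aestronglyMeasurable) ?_
    (integrable_exp_kInt_zero hM) (ae_of_all _ fun t => ?_)
  · filter_upwards [self_mem_nhdsWithin] with y hy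
    refine ae_of_all _ fun t => ?_
    rw [norm_kInt_integrand]
    have : 0 < y * Real.exp (-t) := mul_pos hy (Real.exp_pos _)
    exact Real.exp_le_exp.mpr (by linarith)
  · have : Continuous fun y : ℝ => Complex.exp (M * t - Real.exp t - y * Real.exp (-t)) := by
      fun_prop
    exact (this.tendsto 0).mono_left nhdsWithin_le_nhds

/-! ### The Macdonald integral as a combination of two series -/

/-- The combination of the two power series at the origin that equals `kInt M y`. -/
noncomputable def kSer (M : ℂ) (y : ℝ) : ℂ :=
  Real.pi / Complex.sin (Real.pi * M) *
    (besselPsi (-M) y - (y : ℂ) ^ M * besselPsi M y)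

theorem sin_pi_mul_add_one (M : ℂ) :
    Complex.sin (Real.pi * (M + 1)) = -Complex.sin (Real.pi * M) := by
  rw [mul_add, mul_one, Complex.sin_add_pi]

theorem sin_pi_mul_sub_one (M : ℂ) :
    Complex.sin (Real.pi * (M - 1)) = -Complex.sin (Real.pi * M) := by
  rw [mul_sub, mul_one, Complex.sin_sub_pi]

theorem kSer_add_one (M : ℂ) {y : ℝ} (hy : 0 < y) :
    kSer (M + 1) y = M * kSer M y + y * kSer (M - 1) y := by
  have hy' : (y : ℂ) ≠ 0 := by exact_mod_cast hy.ne'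
  have h1 := besselPsi_recurrence (-M) y
  have h2 := besselPsi_recurrence M y
  have e1 : -(M + 1) = -M - 1 := by ring
  have e2 : -(M - 1) = -M + 1 := by ring
  rw [kSer, kSer, kSer, sin_pi_mul_add_one, sin_pi_mul_sub_one, e1, e2, h1, h2,
    Complex.cpow_add _ _ hy', Complex.cpow_sub _ _ hy', Complex.cpow_one]
  field_simp
  ring

theorem kSer_neg (M : ℂ) {y : ℝ} (hy : 0 < y) :
    kSer (-M) y = (y : ℂ) ^ (-M) * kSer M y := by
  have hy' : (y : ℂ) ≠ 0 := by exact_mod_cast hy.ne'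
  have h3 : (y : ℂ) ^ M ≠ 0 := by simp [Complex.cpow_eq_zero_iff, hy']
  rw [kSer, kSer, mul_neg, Complex.sin_neg, neg_neg, Complex.cpow_neg]
  field_simp
  ring

theorem hasDerivAt_kSer (M : ℂ) {y : ℝ} (hy : 0 < y) :
    HasDerivAt (kSer M) (-kSer (M - 1) y) y := by
  have hy' : (y : ℂ) ≠ 0 := by exact_mod_cast hy.ne'
  have h1 := (hasDerivAt_besselPsi (-M) y).comp_ofReal
  have h2 := (hasDerivAt_besselPsi M y).comp_ofReal
  have h3 : HasDerivAt (fun y : ℝ => (y : ℂ) ^ M) (M * (y : ℂ) ^ (M - 1)) y := by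
    have := (hasDerivAt_id (y : ℂ)).cpow_const (c := M)
      (Complex.ofReal_mem_slitPlane.mpr hy)
    simpa using this.comp_ofReal
  refine ((h1.sub (h3.mul h2)).const_mul _).congr_deriv ?_
  have h4 := besselPsi_recurrence M y
  have e2 : -(M - 1) = -M + 1 := by ring
  rw [kSer, sin_pi_mul_sub_one, e2, h4, Complex.cpow_sub _ _ hy', Complex.cpow_one]
  field_simp

/-- To the right of the imaginary axis `y^M` vanishes at the origin, leaving `π / (sin(πM) Γ(1 -
M))`, which is `Γ(M)` by the reflection formula. -/
theorem tendsto_kSer {M : ℂ} (hM : 0 < M.re) (hs : Complex.sin (Real.pi * M) ≠ 0) :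
    Tendsto (kSer M) (𝓝[>] 0) (𝓝 (Complex.Gamma M)) := by
  have h1 : Complex.Gamma M * Complex.Gamma (1 - M) = Real.pi / Complex.sin (Real.pi * M) :=
    Complex.Gamma_mul_Gamma_one_sub M
  have hG : Complex.Gamma (1 - M) ≠ 0 := by
    intro h0
    rw [h0, mul_zero] at h1
    have h2 : (Real.pi : ℂ) ≠ 0 := by exact_mod_cast Real.pi_ne_zero
    exact div_ne_zero h2 hs h1.symm
  have hlim : Complex.Gamma M = Real.pi / Complex.sin (Real.pi * M) *
      (besselPsi (-M) (0 : ℝ) - ((0 : ℝ) : ℂ) ^ M * besselPsi M (0 : ℝ)) := by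
    have h0 : M ≠ 0 := by rintro rfl; simp at hM
    rw [Complex.ofReal_zero, Complex.zero_cpow h0, besselPsi_zero, ← h1, ← sub_eq_add_neg]
    field_simp
    simp
  rw [hlim]
  have hc : Continuous fun y : ℝ => (y : ℂ) ^ M :=
    Complex.continuous_ofReal_cpow_const hM
  have hc' : Continuous (kSer M) := by
    unfold kSer
    exact continuous_const.mul (((continuous_besselPsi _).comp Complex.continuous_ofReal).sub
      (hc.mul ((continuous_besselPsi _).comp Complex.continuous_ofReal)))
  exact (hc'.tendsto 0).mono_left nhdsWithin_le_nhds

/-- A family with the recurrence, the reflection and the derivatives of `kInt`, and with limit zero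
at the origin to the right of the imaginary axis, vanishes. -/
theorem eq_zero_of_recurrence {d : ℂ → ℝ → ℂ} {ν : ℂ} (hν : ν.re = 0) (hν0 : ν ≠ 0)
    (hadd : ∀ M y, 0 < y → d (M + 1) y = M * d M y + y * d (M - 1) y)
    (hneg : ∀ M y, 0 < y → d (-M) y = (y : ℂ) ^ (-M) * d M y)
    (hder : ∀ M y, 0 < y → HasDerivAt (d M) (-d (M - 1) y) y)
    (hl₁ : Tendsto (d (1 + ν)) (𝓝[>] 0) (𝓝 0)) (hl₂ : Tendsto (d (1 - ν)) (𝓝[>] 0) (𝓝 0))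
    {y : ℝ} (hy : 0 < y) : d (1 + ν) y = 0 ∧ d (1 - ν) y = 0 := by
  set f : ℝ → ℂ × ℂ := fun x => (d (1 + ν) x, d (1 - ν) x) with hf
  have hνn : 0 < ‖ν‖ := norm_pos_iff.mpr hν0
  -- Recurrence and reflection combine to `ν d_ν = d_{1+ν} - x^ν d_{1-ν}`, where `|x^ν| = 1` because
  -- `ν` is imaginary. Hence the pair `f` satisfies `‖f'‖ ≤ (2/‖ν‖) ‖f‖` with a constant that stays
  -- bounded at the singular point `0`.
  have hb : ∀ x, 0 < x → ‖d ν x‖ ≤ 2 / ‖ν‖ * ‖f x‖ := by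
    intro x hx
    have hx' : (x : ℂ) ≠ 0 := by exact_mod_cast hx.ne'
    have h1 := hadd ν x hx
    have h2 := hneg (1 - ν) x hx
    have e : -(1 - ν) = ν - 1 := by ring
    rw [e] at h2
    rw [h2, Complex.cpow_sub _ _ hx', Complex.cpow_one] at h1
    have h3 : ν * d ν x = d (1 + ν) x - (x : ℂ) ^ ν * d (1 - ν) x := by
      rw [add_comm 1 ν, h1]
      field_simp
      ring
    have hn : ‖(x : ℂ) ^ ν‖ = 1 := by
      rw [Complex.norm_cpow_eq_rpow_re_of_pos hx, hν, Real.rpow_zero]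
    have h4 : ‖ν‖ * ‖d ν x‖ ≤ 2 * ‖f x‖ := by
      rw [← norm_mul, h3]
      refine (norm_sub_le _ _).trans ?_
      rw [norm_mul, hn, one_mul, two_mul]
      exact add_le_add (norm_fst_le (f x)) (norm_snd_le (f x))
    rw [div_mul_eq_mul_div, le_div_iff₀ hνn]
    linarith
  have hfd : ∀ x, 0 < x → HasDerivAt f (-d ν x, -d (-ν) x) x := by
    intro x hx
    have h1 := hder (1 + ν) x hx
    have h2 := hder (1 - ν) x hx
    rw [add_sub_cancel_left] at h1
    have e : (1 - ν) - 1 = -ν := by ring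
    rw [e] at h2
    exact h1.prodMk h2
  have hfb : ∀ x, 0 < x → ‖(-d ν x, -d (-ν) x)‖ ≤ 2 / ‖ν‖ * ‖f x‖ + 0 := by
    intro x hx
    have hn : ‖(x : ℂ) ^ (-ν)‖ = 1 := by
      rw [Complex.norm_cpow_eq_rpow_re_of_pos hx, Complex.neg_re, hν, neg_zero, Real.rpow_zero]
    rw [add_zero, Prod.norm_def, hneg ν x hx]
    simp only [norm_neg, norm_mul, hn, one_mul, max_self]
    exact hb x hx
  -- Grönwall's inequality is used on `[a, y]`; its right-hand side tends to zero as `a → 0`, where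
  -- no differential equation is available.
  have hfl : Tendsto (fun a => ‖f a‖ * Real.exp (2 / ‖ν‖ * (y - a))) (𝓝[>] 0) (𝓝 0) := by
    have h1 : Tendsto (fun a => ‖f a‖) (𝓝[>] 0) (𝓝 0) := by
      have := (hl₁.prodMk_nhds hl₂).norm
      rwa [Prod.mk_zero_zero, norm_zero] at this
    have h2 : Tendsto (fun a => Real.exp (2 / ‖ν‖ * (y - a))) (𝓝[>] 0)
        (𝓝 (Real.exp (2 / ‖ν‖ * (y - 0)))) :=
      ((by fun_prop : Continuous fun a : ℝ => Real.exp (2 / ‖ν‖ * (y - a))).tendsto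
        0).mono_left nhdsWithin_le_nhds
    simpa using h1.mul h2
  have hle : ‖f y‖ ≤ 0 := by
    refine ge_of_tendsto hfl ?_
    filter_upwards [Ioo_mem_nhdsGT hy] with a ha
    have := norm_le_gronwallBound_of_norm_deriv_right_le (f := f)
      (f' := fun x => (-d ν x, -d (-ν) x)) (δ := ‖f a‖) (K := 2 / ‖ν‖) (ε := 0) (a := a) (b := y)
      (fun x hx => (hfd x (ha.1.trans_le hx.1)).continuousAt.continuousWithinAt)
      (fun x hx => (hfd x (ha.1.trans_le hx.1)).hasDerivWithinAt) le_rfl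
      (fun x hx => hfb x (ha.1.trans_le hx.1)) y ⟨ha.2.le, le_rfl⟩
    rwa [gronwallBound_ε0] at this
  have h0 : f y = 0 := norm_le_zero_iff.mp hle
  exact ⟨congrArg Prod.fst h0, congrArg Prod.snd h0⟩

theorem sin_pi_mul_add_int_ne_zero {ν : ℂ} (hν : ν.re = 0) (hν0 : ν ≠ 0) (n : ℤ) :
    Complex.sin (Real.pi * (ν + n)) ≠ 0 := by
  intro h
  rw [Complex.sin_eq_zero_iff] at h
  obtain ⟨k, hk⟩ := h
  have hpi : (Real.pi : ℂ) ≠ 0 := by exact_mod_cast Real.pi_ne_zero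
  rw [mul_comm (k : ℂ)] at hk
  have h1 := mul_left_cancel₀ hpi hk
  apply hν0
  apply Complex.ext
  · exact hν
  · simpa using congrArg Complex.im h1

/-- The difference obeys the recurrence, reflection and derivative rules of both sides, and at `1 ±
ν` the limits `Γ(1 ± ν)` cancel. Thus `eq_zero_of_recurrence` applies at `1 ± ν`, and the recurrence
carries the zero to every `ν + n`. -/
theorem kInt_eq_kSer {ν : ℂ} (hν : ν.re = 0) (hν0 : ν ≠ 0) (n : ℤ) {y : ℝ} (hy : 0 < y) :
    kInt (ν + n) y = kSer (ν + n) y := by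
  set d : ℂ → ℝ → ℂ := fun M x => kInt M x - kSer M x with hd
  have hadd : ∀ M x, 0 < x → d (M + 1) x = M * d M x + x * d (M - 1) x := by
    intro M x hx
    simp only [hd]
    rw [kInt_add_one M hx, kSer_add_one M hx]
    ring
  have hlim : ∀ M : ℂ, 0 < M.re → Complex.sin (Real.pi * M) ≠ 0 →
      Tendsto (d M) (𝓝[>] 0) (𝓝 0) := by
    intro M h1 h2
    simpa using (tendsto_kInt h1).sub (tendsto_kSer h1 h2)
  have hs := sin_pi_mul_add_int_ne_zero hν hν0 0
  have hs' := sin_pi_mul_add_int_ne_zero (ν := -ν) (by simp [hν]) (neg_ne_zero.mpr hν0) 0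
  simp only [Int.cast_zero, add_zero] at hs hs'
  have h0 := eq_zero_of_recurrence (d := d) hν hν0 hadd
    (fun M x hx => by
      simp only [hd]
      rw [kInt_neg M hx, kSer_neg M hx]
      ring)
    (fun M x hx => by
      refine ((hasDerivAt_kInt M hx).sub (hasDerivAt_kSer M hx)).congr_deriv ?_
      simp only [hd]
      ring)
    (hlim (1 + ν) (by simp [hν]) (by
      rw [add_comm, sin_pi_mul_add_one]; exact neg_ne_zero.mpr hs))
    (hlim (1 - ν) (by simp [hν]) (by
      rw [sub_eq_add_neg, add_comm, sin_pi_mul_add_one]; exact neg_ne_zero.mpr hs')) hy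
  have hy' : (y : ℂ) ≠ 0 := by exact_mod_cast hy.ne'
  have h1 : d (ν - 1) y = 0 := by
    have : d (-(1 - ν)) y = (y : ℂ) ^ (-(1 - ν)) * d (1 - ν) y := by
      simp only [hd]
      rw [kInt_neg _ hy, kSer_neg _ hy]
      ring
    rw [h0.2, mul_zero] at this
    rwa [neg_sub] at this
  have h2 : d ν y = 0 := by
    have := hadd ν y hy
    rw [add_comm, h0.1, h1, mul_zero, add_zero] at this
    exact (mul_eq_zero.mp this.symm).resolve_left hν0
  -- The recurrence has three terms, so the induction in both directions carries two consecutive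
  -- indices.
  have key : ∀ n : ℤ, d (ν + n) y = 0 ∧ d (ν + n + 1) y = 0 := by
    intro n
    induction n with
    | zero => simpa using ⟨h2, by rw [add_comm]; exact h0.1⟩
    | succ n ih =>
      have h3 := hadd (ν + n + 1) y hy
      push_cast at ih ⊢
      rw [ih.2, add_sub_cancel_right, ih.1] at h3
      rw [← add_assoc]
      exact ⟨ih.2, by simpa using h3⟩
    | pred n ih =>
      have h3 := hadd (ν + (-(n : ℤ) : ℤ)) y hy
      rw [ih.1, ih.2, mul_zero, zero_add] at h3
      have h4 := (mul_eq_zero.mp h3.symm).resolve_left hy'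
      push_cast at ih h4 ⊢
      rw [← add_sub_assoc, sub_add_cancel]
      exact ⟨h4, ih.1⟩
  exact sub_eq_zero.mp (key n).1

/-! ### Laguerre polynomials and the Weber double series -/

/-- The rising factorial `s (s + 1) ⋯ (s + n - 1)`. -/
noncomputable def rise (s : ℂ) (n : ℕ) : ℂ := ∏ j ∈ Finset.range n, (s + j)

theorem rise_zero (s : ℂ) : rise s 0 = 1 := by simp [rise]

theorem rise_succ (s : ℂ) (n : ℕ) : rise s (n + 1) = rise s n * (s + n) := by
  simp [rise, Finset.prod_range_succ]

theorem rise_succ_left (s : ℂ) (n : ℕ) : rise s (n + 1) = s * rise (s + 1) n := by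
  rw [rise, Finset.prod_range_succ', rise, mul_comm]
  congr 1
  · simp
  · refine Finset.prod_congr rfl fun j _ => ?_
    push_cast
    ring

theorem rise_add_one (s : ℂ) (n : ℕ) :
    rise (s + 1) (n + 1) = rise s (n + 1) + (n + 1) * rise (s + 1) n := by
  rw [rise_succ, rise_succ_left]
  ring

theorem inv_Gamma_eq_rise (s : ℂ) (n : ℕ) :
    (Complex.Gamma s)⁻¹ = rise s n * (Complex.Gamma (s + n))⁻¹ := by
  induction n with
  | zero => simp [rise_zero]
  | succ n ih =>
    have h := Complex.one_div_Gamma_eq_self_mul_one_div_Gamma_add_one (s + n)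
    rw [ih, h, rise_succ]
    push_cast
    ring_nf

/-- A Laguerre-type polynomial. -/
noncomputable def lag (N : ℕ) (μ B : ℂ) : ℂ :=
  ∑ k ∈ Finset.range (N + 1), (N.choose k : ℂ) * ((-B) ^ k * (Complex.Gamma (k + 1 + μ))⁻¹)

/-- Pascal's rule for the binomial coefficients; the shift `k ↦ k + 1` raises `μ` by one. -/
theorem lag_succ (N : ℕ) (μ B : ℂ) :
    lag (N + 1) μ B = lag N μ B - B * lag N (μ + 1) B := by
  have h1 : lag N μ B = ∑ k ∈ Finset.range (N + 1 + 1),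
      (N.choose k : ℂ) * ((-B) ^ k * (Complex.Gamma (k + 1 + μ))⁻¹) := by
    rw [Finset.sum_range_succ, Nat.choose_succ_self]
    simp [lag]
  have h2 : B * lag N (μ + 1) B = -∑ k ∈ Finset.range (N + 1),
      (N.choose k : ℂ) * ((-B) ^ (k + 1) * (Complex.Gamma ((k + 1 : ℕ) + 1 + μ))⁻¹) := by
    rw [lag, Finset.mul_sum, ← Finset.sum_neg_distrib]
    refine Finset.sum_congr rfl fun k _ => ?_
    have e : ((k + 1 : ℕ) : ℂ) + 1 + μ = k + 1 + (μ + 1) := by push_cast; ring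
    rw [e]
    ring
  rw [h2, h1, lag, Finset.sum_range_succ', Finset.sum_range_succ' _ (N + 1), sub_neg_eq_add,
    add_right_comm (∑ k ∈ Finset.range (N + 1), (N.choose (k + 1) : ℂ) * _), ← Finset.sum_add_distrib]
  congr 1
  · refine Finset.sum_congr rfl fun k _ => ?_
    rw [Nat.choose_succ_succ]
    push_cast
    ring
  · simp

/-- Kummer's transformation, in the case where the transformed hypergeometric series terminates. For
`N = 0` the rising factorial cancels the Gamma function and the exponential series remains; the step
combines `lag_succ` with `rise_add_one`, which are the same contiguity relation on the two sides. -/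
theorem hasSum_lag (N : ℕ) (μ B : ℂ) :
    HasSum (fun n : ℕ => (-B) ^ n * rise (μ + 1 + N) n /
      ((n.factorial : ℂ) * Complex.Gamma (n + 1 + μ))) (Complex.exp (-B) * lag N μ B) := by
  induction N generalizing μ with
  | zero =>
    have h := (NormedSpace.expSeries_div_hasSum_exp (-B)).mul_right (Complex.Gamma (1 + μ))⁻¹
    rw [← Complex.exp_eq_exp_ℂ] at h
    have e : Complex.exp (-B) * lag 0 μ B = Complex.exp (-B) * (Complex.Gamma (1 + μ))⁻¹ := by
      simp [lag]
    rw [e]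
    refine h.congr_fun fun n => ?_
    have h2 := inv_Gamma_eq_rise (1 + μ) n
    have e1 : μ + 1 + (0 : ℕ) = 1 + μ := by push_cast; ring
    have e2 : (n : ℂ) + 1 + μ = 1 + μ + n := by ring
    rw [h2, e1, e2]
    ring
  | succ N ih =>
    have h1 := ih μ
    have h2 := (ih (μ + 1)).mul_left (-B)
    have h3 : HasSum (fun n : ℕ => (-B) ^ n * (n * rise (μ + 1 + N + 1) (n - 1)) /
      ((n.factorial : ℂ) * Complex.Gamma (n + 1 + μ)))
        (-B * (Complex.exp (-B) * lag N (μ + 1) B)) := by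
      rw [← hasSum_nat_add_iff' 1]
      simp only [Finset.range_one, Finset.sum_singleton, Nat.cast_zero, zero_mul, mul_zero,
        zero_div, sub_zero]
      refine h2.congr_fun fun n => ?_
      have hn : ((n + 1 : ℕ) : ℂ) ≠ 0 := by exact_mod_cast Nat.succ_ne_zero n
      have e1 : μ + 1 + 1 + (N : ℂ) = μ + 1 + N + 1 := by ring
      have e2 : (n : ℂ) + 1 + (μ + 1) = (n + 1 : ℕ) + 1 + μ := by push_cast; ring
      rw [Nat.add_sub_cancel, e1, e2, Nat.factorial_succ, Nat.cast_mul, mul_assoc (_ : ℂ) (_ : ℂ)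
        (Complex.Gamma _), mul_left_comm, mul_div_mul_left _ _ hn, pow_succ]
      ring
    have h4 := h1.add h3
    have e : Complex.exp (-B) * lag N μ B + -B * (Complex.exp (-B) * lag N (μ + 1) B) =
        Complex.exp (-B) * lag (N + 1) μ B := by
      rw [lag_succ]
      ring
    rw [e] at h4
    refine h4.congr_fun fun n => ?_
    rw [← add_div, ← mul_add]
    congr 2
    cases n with
    | zero => simp [rise_zero]
    | succ n =>
      have := rise_add_one (μ + 1 + N) n
      push_cast
      rw [← add_assoc, this]

theorem exists_norm_lag_le (μ B : ℂ) :
    ∃ C : ℝ, ∀ N : ℕ, ‖lag N μ B‖ ≤ C * (1 + ‖B‖) ^ N := by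
  obtain ⟨C, hC0, hC⟩ := exists_norm_inv_Gamma_le μ
  refine ⟨C, fun N => ?_⟩
  rw [add_comm, add_pow, Finset.mul_sum]
  refine norm_sum_le_of_le _ fun k _ => ?_
  rw [norm_mul, norm_mul, norm_pow, norm_neg, Complex.norm_natCast, one_pow, mul_one]
  have : ‖B‖ ^ k * ‖(Complex.Gamma (k + 1 + μ))⁻¹‖ ≤ ‖B‖ ^ k * C := by
    gcongr
    exact hC k
  calc (N.choose k : ℝ) * (‖B‖ ^ k * ‖(Complex.Gamma (k + 1 + μ))⁻¹‖)
      ≤ (N.choose k : ℝ) * (‖B‖ ^ k * C) := by gcongr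
    _ = C * (‖B‖ ^ k * (N.choose k : ℝ)) := by ring

theorem summable_lag (μ : ℂ) (q : ℕ) (A B : ℂ) :
    Summable fun m : ℕ => (-A) ^ m / m.factorial * lag (m + q) μ B := by
  obtain ⟨C, hC⟩ := exists_norm_lag_le μ B
  refine Summable.of_norm_bounded (((Real.summable_pow_div_factorial
    (‖A‖ * (1 + ‖B‖))).mul_left (C * (1 + ‖B‖) ^ q))) fun m => ?_
  rw [norm_mul, norm_div, norm_pow, norm_neg, Complex.norm_natCast]
  calc ‖A‖ ^ m / m.factorial * ‖lag (m + q) μ B‖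
      ≤ ‖A‖ ^ m / m.factorial * (C * (1 + ‖B‖) ^ (m + q)) := by
        gcongr
        exact hC _
    _ = _ := by rw [mul_pow, pow_add]; ring

/-- `e ^ A ∑ (-A) ^ m / m! lag (m + q) μ B`, the sum of a double series up to an exponential
factor. -/
noncomputable def weberV (μ : ℂ) (q : ℕ) (A B : ℂ) : ℂ :=
  Complex.exp A * ∑' m : ℕ, (-A) ^ m / m.factorial * lag (m + q) μ B

theorem weberV_succ (μ : ℂ) (q : ℕ) (A B : ℂ) :
    weberV μ (q + 1) A B = weberV μ q A B - B * weberV (μ + 1) q A B := by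
  have h1 := summable_lag μ q A B
  have h2 := (summable_lag (μ + 1) q A B).mul_left B
  have h3 := h1.tsum_sub h2
  rw [tsum_mul_left] at h3
  rw [weberV, weberV, weberV, mul_left_comm, ← mul_sub, ← h3]
  congr 1
  refine tsum_congr fun m => ?_
  rw [← add_assoc, lag_succ]
  ring

/-- The generating function of the Laguerre polynomials: the Cauchy product of the series of
`besselPsi μ (A B)` and of `e^(-A)` has the terms `(-A)^m / m! · lag m μ B`. -/
theorem weberV_zero (μ A B : ℂ) : weberV μ 0 A B = besselPsi μ (A * B) := by
  have h1 : Summable fun n : ℕ => ‖(-A) ^ n / (n.factorial : ℂ)‖ := by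
    refine (Real.summable_pow_div_factorial ‖A‖).congr fun n => ?_
    rw [norm_div, norm_pow, norm_neg, Complex.norm_natCast]
  have h2 := (summable_besselPsi μ (A * B)).norm
  have h := tsum_mul_tsum_eq_tsum_sum_range_of_summable_norm h2 h1
  have h3 : ∑' n : ℕ, (-A) ^ n / (n.factorial : ℂ) = Complex.exp (-A) := by
    rw [Complex.exp_eq_exp_ℂ]
    exact (NormedSpace.expSeries_div_hasSum_exp (-A)).tsum_eq
  rw [h3] at h
  have h4 : besselPsi μ (A * B) = Complex.exp A * (besselPsi μ (A * B) * Complex.exp (-A)) := by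
    rw [mul_left_comm, ← Complex.exp_add, add_neg_cancel, Complex.exp_zero, mul_one]
  rw [h4, besselPsi, h, weberV]
  congr 1
  refine tsum_congr fun m => ?_
  rw [add_zero, lag, Finset.mul_sum]
  refine Finset.sum_congr rfl fun k hk => ?_
  have hk' : k ≤ m := Nat.lt_succ_iff.mp (Finset.mem_range.mp hk)
  rw [Nat.cast_choose ℂ hk']
  have e1 : (m.factorial : ℂ) ≠ 0 := by exact_mod_cast m.factorial_ne_zero
  have e2 : (k.factorial : ℂ) ≠ 0 := by exact_mod_cast k.factorial_ne_zero
  have e3 : ((m - k).factorial : ℂ) ≠ 0 := by exact_mod_cast (m - k).factorial_ne_zero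
  have e4 : (-A) ^ m = (-A) ^ (m - k) * (-A) ^ k := by rw [← pow_add, Nat.sub_add_cancel hk']
  have e5 : (A * B) ^ k = (-A) ^ k * (-B) ^ k := by rw [← mul_pow, neg_mul_neg]
  rw [e4, e5, div_mul_eq_div_mul_one_div _ _ (Complex.Gamma _), one_div]
  field_simp

/-! ### The Macdonald integral with a polynomial factor -/

/-- The integral `∫ exp (M t - e ^ t - y e ^ (-t)) (1 + A e ^ (-t)) ^ q dt`. -/
noncomputable def kIntPow (q : ℕ) (M A : ℂ) (y : ℝ) : ℂ :=
  ∫ t : ℝ, Complex.exp (M * t - Real.exp t - y * Real.exp (-t)) * (1 + A * Real.exp (-t)) ^ q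

theorem kIntPow_integrand_succ (q : ℕ) (M A : ℂ) (y t : ℝ) :
    Complex.exp (M * t - Real.exp t - y * Real.exp (-t)) * (1 + A * Real.exp (-t)) ^ (q + 1) =
      Complex.exp (M * t - Real.exp t - y * Real.exp (-t)) * (1 + A * Real.exp (-t)) ^ q +
      A * (Complex.exp ((M - 1) * t - Real.exp t - y * Real.exp (-t)) *
        (1 + A * Real.exp (-t)) ^ q) := by
  have e : Complex.exp ((M - 1) * t - Real.exp t - y * Real.exp (-t)) =
      Complex.exp (M * t - Real.exp t - y * Real.exp (-t)) * Real.exp (-t) := by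
    rw [Complex.ofReal_exp (-t), ← Complex.exp_add]
    push_cast
    ring_nf
  rw [e, pow_succ]
  ring

theorem integrable_kIntPow (q : ℕ) (M A : ℂ) {y : ℝ} (hy : 0 < y) :
    Integrable fun t : ℝ => Complex.exp (M * t - Real.exp t - y * Real.exp (-t)) *
      (1 + A * Real.exp (-t)) ^ q := by
  induction q generalizing M with
  | zero => simpa using integrable_kInt M hy
  | succ q ih =>
    simp only [kIntPow_integrand_succ]
    exact (ih M).add ((ih (M - 1)).const_mul A)

theorem kIntPow_succ (q : ℕ) (M A : ℂ) {y : ℝ} (hy : 0 < y) :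
    kIntPow (q + 1) M A y = kIntPow q M A y + A * kIntPow q (M - 1) A y := by
  unfold kIntPow
  simp only [kIntPow_integrand_succ]
  rw [integral_add (integrable_kIntPow q M A hy)
    ((integrable_kIntPow q (M - 1) A hy).const_mul A), integral_const_mul]

/-- Induction on `q` from `kInt_eq_kSer`. One more factor `1 + A e^(-t)` adds `A` times the integral
with `M - 1`. The sine changes sign under this shift, and what results is `weberV_succ` for both
series, the second after inserting `A = y / B`. -/
theorem kIntPow_eq {ν : ℂ} (hν : ν.re = 0) (hν0 : ν ≠ 0) (q : ℕ) (n : ℤ) {A B : ℂ} {y : ℝ}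
    (hy : 0 < y) (hAB : A * B = y) :
    kIntPow q (ν + n) A y = Real.pi / Complex.sin (Real.pi * (ν + n)) *
      (weberV (-(ν + n)) q B A -
        (-1) ^ q * (y : ℂ) ^ (ν + n) * (B ^ q)⁻¹ * weberV (ν + n - q) q A B) := by
  have hy' : (y : ℂ) ≠ 0 := by exact_mod_cast hy.ne'
  have hB : B ≠ 0 := by
    rintro rfl
    rw [mul_zero] at hAB
    exact hy' hAB.symm
  have hA : A = y / B := by rw [← hAB]; field_simp
  induction q generalizing n with
  | zero =>
    have h := kInt_eq_kSer hν hν0 n hy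
    have e : kIntPow 0 (ν + n) A y = kInt (ν + n) y := by simp [kIntPow, kInt]
    rw [e, h, kSer, weberV_zero, weberV_zero, mul_comm B A, hAB]
    simp
  | succ q ih =>
    have h1 := ih n
    have h2 := ih (n - 1)
    have e0 : ν + ((n - 1 : ℤ) : ℂ) = ν + n - 1 := by push_cast; ring
    rw [e0, sin_pi_mul_sub_one] at h2
    rw [kIntPow_succ _ _ _ hy, h1, h2, weberV_succ, weberV_succ]
    have e1 : -(ν + n - 1) = -(ν + n) + 1 := by ring
    have e2 : ν + n - ((q + 1 : ℕ) : ℂ) + 1 = ν + n - q := by push_cast; ring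
    have e3 : ν + n - 1 - q = ν + n - ((q + 1 : ℕ) : ℂ) := by push_cast; ring
    rw [e1, e2, e3, Complex.cpow_sub _ _ hy', Complex.cpow_one, hA]
    field_simp
    ring

/-! ### Termwise Laplace transforms and Weber's second exponential integral -/

theorem integrable_of_hasSum {α ι : Type*} [Countable ι] [MeasurableSpace α] {μ : Measure α}
    {F : ι → α → ℂ} {f : α → ℂ} (hf : AEStronglyMeasurable f μ) (hF : ∀ i, Integrable (F i) μ)
    (hs : Summable fun i => ∫ a, ‖F i a‖ ∂μ) (h : ∀ᵐ a ∂μ, HasSum (fun i => F i a) (f a)) :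
    Integrable f μ := by
  refine ⟨hf, ?_⟩
  have h1 : ∀ᵐ a ∂μ, ‖f a‖ₑ ≤ ∑' i, ‖F i a‖ₑ := by
    filter_upwards [h] with a ha
    rw [← ha.tsum_eq]
    exact enorm_tsum_le_tsum_enorm
  have h2 (i : ι) : ∫⁻ a, ‖F i a‖ₑ ∂μ = ENNReal.ofReal (∫ a, ‖F i a‖ ∂μ) := by
    rw [ofReal_integral_norm_eq_lintegral_enorm (hF i)]
  refine (lintegral_mono_ae h1).trans_lt ?_
  rw [lintegral_tsum fun i => (hF i).1.enorm]
  simp only [h2]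
  rw [← ENNReal.ofReal_tsum_of_nonneg (fun i => integral_nonneg fun a => norm_nonneg _) hs]
  exact ENNReal.ofReal_lt_top

theorem integrableOn_cpow_mul_exp {a : ℂ} (ha : 0 < a.re) {s : ℝ} (hs : 0 < s) :
    IntegrableOn (fun x : ℝ => (x : ℂ) ^ (a - 1) * Complex.exp (-(s * x))) (Ioi 0) := by
  have hm : AEStronglyMeasurable (fun x : ℝ => (x : ℂ) ^ (a - 1) * Complex.exp (-(s * x)))
      (volume.restrict (Ioi 0)) := by
    refine ContinuousOn.aestronglyMeasurable (fun x hx => ?_) measurableSet_Ioi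
    refine ContinuousAt.continuousWithinAt (ContinuousAt.mul ?_ (by fun_prop))
    exact Complex.continuousAt_ofReal_cpow_const _ _ (Or.inr (ne_of_gt hx))
  refine (integrable_norm_iff hm).mp ?_
  have h := integrableOn_rpow_mul_exp_neg_mul_rpow (p := 1) (s := a.re - 1) (b := s)
    (by linarith) one_pos hs
  refine h.congr_fun (fun x hx => ?_) measurableSet_Ioi
  simp only [norm_mul]
  rw [Complex.norm_cpow_eq_rpow_re_of_pos hx, Complex.norm_exp, Real.rpow_one]
  simp

theorem integral_norm_cpow_mul_exp {a : ℂ} (ha : 0 < a.re) {s : ℝ} (hs : 0 < s) :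
    ∫ x : ℝ in Ioi 0, ‖(x : ℂ) ^ (a - 1) * Complex.exp (-(s * x))‖ =
      (1 / s) ^ a.re * Real.Gamma a.re := by
  rw [← Real.integral_rpow_mul_exp_neg_mul_Ioi ha hs]
  refine setIntegral_congr_fun measurableSet_Ioi fun x hx => ?_
  simp only [norm_mul]
  rw [Complex.norm_cpow_eq_rpow_re_of_pos hx, Complex.norm_exp]
  simp

/-- Termwise Laplace transformation of a generalized power series. -/
theorem laplace_hasSum {ι : Type*} [Countable ι] {c e : ι → ℂ} (he : ∀ i, 0 < (e i).re)
    {s : ℝ} (hs : 0 < s) (hc : Summable fun i => ‖c i‖ * ((1 / s) ^ (e i).re *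
      Real.Gamma (e i).re)) {f : ℝ → ℂ} (hf : ContinuousOn f (Ioi 0))
    (h : ∀ x : ℝ, 0 < x → HasSum (fun i => c i * (x : ℂ) ^ (e i - 1)) (f x)) :
    IntegrableOn (fun x : ℝ => f x * Complex.exp (-(s * x))) (Ioi 0) ∧
    HasSum (fun i => c i * ((1 / s) ^ e i * Complex.Gamma (e i)))
      (∫ x : ℝ in Ioi 0, f x * Complex.exp (-(s * x))) := by
  set F : ι → ℝ → ℂ := fun i x => c i * ((x : ℂ) ^ (e i - 1) * Complex.exp (-(s * x))) with hF
  have hi : ∀ i, Integrable (F i) (volume.restrict (Ioi 0)) := fun i =>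
    (integrableOn_cpow_mul_exp (he i) hs).const_mul (c i)
  have hn : ∀ i, ∫ x : ℝ in Ioi 0, ‖F i x‖ =
      ‖c i‖ * ((1 / s) ^ (e i).re * Real.Gamma (e i).re) := by
    intro i
    rw [← integral_norm_cpow_mul_exp (he i) hs, ← integral_const_mul]
    refine integral_congr_ae (ae_of_all _ fun x => ?_)
    simp only [hF, norm_mul]
  have hsum : Summable fun i => ∫ x : ℝ in Ioi 0, ‖F i x‖ := by simpa only [hn] using hc
  have hx : ∀ x : ℝ, 0 < x → HasSum (fun i => F i x) (f x * Complex.exp (-(s * x))) := by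
    intro x hx
    refine ((h x hx).mul_right (Complex.exp (-(s * x)))).congr_fun fun i => ?_
    simp only [hF]
    ring
  have hae : ∀ᵐ x : ℝ ∂(volume.restrict (Ioi 0)),
      HasSum (fun i => F i x) (f x * Complex.exp (-(s * x))) :=
    (ae_restrict_iff' measurableSet_Ioi).mpr (ae_of_all _ hx)
  have hm : AEStronglyMeasurable (fun x : ℝ => f x * Complex.exp (-(s * x)))
      (volume.restrict (Ioi 0)) :=
    ContinuousOn.aestronglyMeasurable (hf.mul (by fun_prop)) measurableSet_Ioi
  refine ⟨integrable_of_hasSum hm hi hsum hae, ?_⟩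
  have h1 := hasSum_integral_of_summable_integral_norm hi hsum
  have h2 : ∫ x : ℝ in Ioi 0, ∑' i, F i x = ∫ x : ℝ in Ioi 0, f x * Complex.exp (-(s * x)) :=
    setIntegral_congr_fun measurableSet_Ioi fun x hx' => (hx x hx').tsum_eq
  rw [h2] at h1
  refine h1.congr_fun fun i => ?_
  rw [integral_const_mul, Complex.integral_cpow_mul_exp_neg_mul_Ioi (he i) hs]

theorem factorial_le_norm_rise {s : ℂ} (hs : 1 ≤ s.re) (n : ℕ) : (n.factorial : ℝ) ≤ ‖rise s n‖ := by
  induction n with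
  | zero => simp [rise_zero]
  | succ n ih =>
    rw [rise_succ, norm_mul, Nat.factorial_succ, Nat.cast_mul, mul_comm]
    refine mul_le_mul ih ?_ (by positivity) (norm_nonneg _)
    refine le_trans ?_ (Complex.re_le_norm _)
    simp only [Complex.add_re, Complex.natCast_re]
    push_cast
    linarith

theorem norm_inv_Gamma_le_factorial {s : ℂ} (hs : 1 ≤ s.re) (n : ℕ) :
    ‖(Complex.Gamma (s + n))⁻¹‖ ≤ ‖(Complex.Gamma s)⁻¹‖ / n.factorial := by
  rw [le_div_iff₀ (by positivity), inv_Gamma_eq_rise s n, norm_mul, mul_comm]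
  exact mul_le_mul_of_nonneg_right (factorial_le_norm_rise hs n) (norm_nonneg _)

theorem Gamma_add_natCast {s : ℂ} (hs : 0 < s.re) (n : ℕ) :
    Complex.Gamma (s + n) = rise s n * Complex.Gamma s := by
  have h := inv_Gamma_eq_rise s n
  have h1 : Complex.Gamma s ≠ 0 := Complex.Gamma_ne_zero_of_re_pos hs
  have h2 : Complex.Gamma (s + n) ≠ 0 := Complex.Gamma_ne_zero_of_re_pos (by
    simp only [Complex.add_re, Complex.natCast_re]; positivity)
  field_simp at h
  rw [h, mul_comm]

theorem factorial_div_le (a b : ℕ) :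
    ((a + b).factorial : ℝ) / (a.factorial * b.factorial) ≤ 2 ^ (a + b) := by
  have h := Nat.add_choose_mul_factorial_mul_factorial a b
  have h2 : ((a + b).choose b : ℝ) ≤ 2 ^ (a + b) := by
    exact_mod_cast Nat.choose_le_two_pow (a + b) b
  rw [div_le_iff₀ (by positivity), ← h]
  push_cast
  rw [mul_assoc]
  gcongr

/-- The Laplace transform of a product of two Bessel functions (Weber's second exponential
integral). -/
theorem laplace_besselPsi_mul {ν : ℂ} (hν : ν.re = 0) (p : ℕ) (α β : ℂ) {s : ℝ} (hs : 0 < s)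
    (hβ : 2 * ‖β‖ < s) :
    IntegrableOn (fun x : ℝ => (x : ℂ) ^ (ν + p) * besselPsi (ν + p) (-α * x) *
      besselPsi (ν - p) (-β * x) * Complex.exp (-(s * x))) (Ioi 0) ∧
    ∫ x : ℝ in Ioi 0, (x : ℂ) ^ (ν + p) * besselPsi (ν + p) (-α * x) *
      besselPsi (ν - p) (-β * x) * Complex.exp (-(s * x)) =
      (1 / (s : ℂ)) ^ (ν + p + 1) * (Complex.exp (-(α / s) - β / s) *
        weberV (ν - p) (2 * p) (α / s) (β / s)) := by
  have hs' : (s : ℂ) ≠ 0 := by exact_mod_cast hs.ne'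
  set c : ℕ × ℕ → ℂ := fun i =>
    (-α) ^ i.1 / ((i.1.factorial : ℂ) * Complex.Gamma (i.1 + 1 + (ν + p))) *
    ((-β) ^ i.2 / ((i.2.factorial : ℂ) * Complex.Gamma (i.2 + 1 + (ν - p)))) with hc
  set e : ℕ × ℕ → ℂ := fun i => (ν + p + 1) + i.1 + i.2 with he
  have hre : ∀ i, (e i).re = ((p + i.1 + i.2 : ℕ) : ℝ) + 1 := by
    intro i
    simp only [he, Complex.add_re, hν, Complex.natCast_re, Complex.one_re]
    push_cast
    ring
  have hsum : Summable fun i => ‖c i‖ * ((1 / s) ^ (e i).re * Real.Gamma (e i).re) := by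
    obtain ⟨C, hC0, hC⟩ := exists_norm_inv_Gamma_le (ν - p)
    set D := ‖(Complex.Gamma (1 + ν))⁻¹‖
    have h1 : Summable fun m : ℕ => (2 * ‖α‖ / s) ^ m / m.factorial :=
      Real.summable_pow_div_factorial _
    -- The hypothesis `2 ‖β‖ < s` enters here: the first Gamma factor decays like `1/(p + m)!`, the
    -- second is only bounded, and the binomial coefficient left by `Γ(p + m + n + 1)` costs `2^(p +
    -- m + n)`. So the sum over `n` is merely geometric.
    have h2 : Summable fun n : ℕ => (2 * ‖β‖ / s) ^ n :=
      summable_geometric_of_lt_one (by positivity) ((div_lt_one hs).mpr hβ)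
    have h3 := (h1.mul_of_nonneg h2 (fun m => by positivity) (fun n => by positivity)).mul_left
      (D * C * 2 ^ p * (1 / s) ^ (p + 1))
    refine Summable.of_nonneg_of_le (fun i => ?_) (fun i => ?_) h3
    · rw [hre, Real.Gamma_nat_eq_factorial]
      positivity
    · obtain ⟨m, n⟩ := i
      have e1 : (m : ℂ) + 1 + (ν + p) = 1 + ν + (p + m : ℕ) := by push_cast; ring
      have b1 := norm_inv_Gamma_le_factorial (s := 1 + ν) (by simp [hν]) (p + m)
      have b2 := hC n
      have b3 := factorial_div_le (p + m) n
      rw [hre, Real.Gamma_nat_eq_factorial]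
      simp only [hc]
      rw [div_mul_eq_div_mul_one_div, div_mul_eq_div_mul_one_div, one_div, one_div, e1, norm_mul,
        norm_mul, norm_mul, norm_div, norm_div, norm_pow, norm_pow, norm_neg, norm_neg,
        Complex.norm_natCast, Complex.norm_natCast]
      have e2 : (1 / s : ℝ) ^ (((p + m + n : ℕ) : ℝ) + 1) = (1 / s) ^ (p + m + n + 1) := by
        rw [← Real.rpow_natCast]; push_cast; rfl
      rw [e2]
      calc ‖α‖ ^ m / m.factorial * ‖(Complex.Gamma (1 + ν + (p + m : ℕ)))⁻¹‖ *
            (‖β‖ ^ n / n.factorial * ‖(Complex.Gamma (n + 1 + (ν - p)))⁻¹‖) *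
            ((1 / s) ^ (p + m + n + 1) * (p + m + n).factorial)
          ≤ ‖α‖ ^ m / m.factorial * (D / (p + m).factorial) * (‖β‖ ^ n / n.factorial * C) *
            ((1 / s) ^ (p + m + n + 1) * (p + m + n).factorial) := by gcongr
        _ = ‖α‖ ^ m / m.factorial * D * (‖β‖ ^ n * C) * (1 / s) ^ (p + m + n + 1) *
            ((p + m + n).factorial / ((p + m).factorial * n.factorial)) := by
            field_simp
        _ ≤ ‖α‖ ^ m / m.factorial * D * (‖β‖ ^ n * C) * (1 / s) ^ (p + m + n + 1) *
            2 ^ (p + m + n) := by gcongr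
        _ = _ := by
            simp only [pow_add, div_pow, mul_pow, one_pow]
            ring
  have hexp : ∀ x : ℝ, 0 < x → HasSum (fun i => c i * (x : ℂ) ^ (e i - 1))
      ((x : ℂ) ^ (ν + p) * besselPsi (ν + p) (-α * x) * besselPsi (ν - p) (-β * x)) := by
    intro x hx
    have hx' : (x : ℂ) ≠ 0 := by exact_mod_cast hx.ne'
    have h1 := (summable_besselPsi (ν + p) (-α * x)).norm
    have h2 := (summable_besselPsi (ν - p) (-β * x)).norm
    have h3 := (summable_mul_of_summable_norm h1 h2).hasSum
    rw [← tsum_mul_tsum_of_summable_norm h1 h2] at h3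
    have h4 := h3.mul_left ((x : ℂ) ^ (ν + p))
    rw [← mul_assoc] at h4
    refine h4.congr_fun fun i => ?_
    simp only [hc, he]
    have e1 : ν + p + 1 + i.1 + i.2 - 1 = ν + p + i.1 + i.2 := by ring
    rw [e1, Complex.cpow_add _ _ hx', Complex.cpow_add _ _ hx', Complex.cpow_natCast,
      Complex.cpow_natCast, mul_pow, mul_pow]
    ring
  have hcont : ContinuousOn (fun x : ℝ => (x : ℂ) ^ (ν + p) * besselPsi (ν + p) (-α * x) *
      besselPsi (ν - p) (-β * x)) (Ioi 0) := by
    have h1 : ContinuousOn (fun x : ℝ => (x : ℂ) ^ (ν + p)) (Ioi 0) := fun x hx =>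
      (Complex.continuousAt_ofReal_cpow_const _ _ (Or.inr (ne_of_gt hx))).continuousWithinAt
    have h2 : ∀ μ γ : ℂ, Continuous fun x : ℝ => besselPsi μ (γ * x) := fun μ γ =>
      (continuous_besselPsi μ).comp (by fun_prop)
    exact (h1.mul (h2 _ _).continuousOn).mul (h2 _ _).continuousOn
  obtain ⟨hint, hval⟩ := laplace_hasSum (fun i => by rw [hre]; positivity) hs hsum hcont hexp
  refine ⟨hint, ?_⟩
  -- The inner sum over `n` is Kummer's series. The exponent `ν + p`, rather than `ν`, makes `Γ(ν +
  -- p + 1 + m + n) / Γ(ν + p + 1 + m)` a rising factorial; it exceeds the order `ν - p` by the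
  -- integer `N = m + 2p`, so `hasSum_lag` applies.
  have hm : ∀ m : ℕ, HasSum (fun n : ℕ => c (m, n) * ((1 / (s : ℂ)) ^ e (m, n) *
      Complex.Gamma (e (m, n)))) ((1 / (s : ℂ)) ^ (ν + p + 1) * ((-(α / s)) ^ m / m.factorial *
        (Complex.exp (-(β / s)) * lag (m + 2 * p) (ν - p) (β / s)))) := by
    intro m
    have h1 := ((hasSum_lag (m + 2 * p) (ν - p) (β / s)).mul_left
      ((-(α / s)) ^ m / m.factorial)).mul_left ((1 / (s : ℂ)) ^ (ν + p + 1))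
    refine h1.congr_fun fun n => ?_
    have e1 : (m : ℂ) + 1 + (ν + p) = ν + p + 1 + m := by ring
    have e2 : ν - p + 1 + ((m + 2 * p : ℕ) : ℂ) = ν + p + 1 + m := by push_cast; ring
    have h0 : 0 < (ν + p + 1 + m).re := by
      simp only [Complex.add_re, hν, Complex.natCast_re, Complex.one_re]
      positivity
    have h2 := Gamma_add_natCast h0 n
    have h3 : Complex.Gamma (ν + p + 1 + m) ≠ 0 := Complex.Gamma_ne_zero_of_re_pos h0
    simp only [hc, he]
    rw [h2, e1, e2, Complex.cpow_add _ _ (one_div_ne_zero hs'),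
      Complex.cpow_add _ _ (one_div_ne_zero hs'), Complex.cpow_natCast, Complex.cpow_natCast,
      ← neg_div, ← neg_div, div_pow, div_pow, div_pow, div_pow, one_pow, one_pow]
    field_simp
  have hE : Complex.exp (-(α / s) - β / s) =
      Complex.exp (-(α / s)) * Complex.exp (-(β / s)) := by
    rw [sub_eq_add_neg, Complex.exp_add]
  have h5 := (hval.prod_fiberwise hm).tsum_eq
  rw [← h5, tsum_mul_left, weberV, hE]
  congr 1
  have e3 : Complex.exp (-(α / s)) * Complex.exp (-(β / s)) * (Complex.exp (α / s) *
      ∑' m : ℕ, (-(α / (s : ℂ))) ^ m / m.factorial * lag (m + 2 * p) (ν - p) (β / s)) =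
      Complex.exp (-(β / s)) *
      ∑' m : ℕ, (-(α / (s : ℂ))) ^ m / m.factorial * lag (m + 2 * p) (ν - p) (β / s) := by
    rw [Complex.exp_neg (α / s)]
    field_simp
  rw [e3, ← tsum_mul_left]
  refine tsum_congr fun m => ?_
  ring

/-- The Bessel function on the logarithmic Riemann surface in terms of `besselPsi`. -/
theorem besselJLog_eq (μ ℓ : ℂ) :
    besselJLog μ ℓ = Complex.exp (μ * (ℓ - Real.log 2)) *
      besselPsi μ (-Complex.exp (2 * (ℓ - Real.log 2))) := by
  rw [besselJLog, besselPsi, ← tsum_mul_left]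
  refine tsum_congr fun n => ?_
  have e1 : (n : ℂ) + 1 + μ = μ + n + 1 := by ring
  rw [neg_pow (Complex.exp _), ← Complex.exp_nat_mul, add_mul, Complex.exp_add, e1]
  ring_nf

/-! ### The angular integral: symmetry, decay, power series and Laplace transform -/

/-- The angular integral `∫_0^π cos (Re (e ^ (iω) w)) e ^ (2ipω) dω`, that is,
`(-1) ^ p π J_{2p}(|w|) (conj w / |w|) ^ (2p)`. -/
noncomputable def angInt (p : ℤ) (w : ℂ) : ℂ :=
  ∫ ω in (0 : ℝ)..Real.pi, (Real.cos (Complex.exp (Complex.I * ω) * w).re : ℂ) *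
    Complex.exp (2 * Complex.I * p * ω)

theorem norm_exp_two_I_mul (p : ℤ) (ω : ℝ) : ‖Complex.exp (2 * Complex.I * p * ω)‖ = 1 := by
  rw [Complex.norm_exp]
  simp

theorem norm_angInt_integrand_le (p : ℤ) (w : ℂ) (ω : ℝ) :
    ‖(Real.cos (Complex.exp (Complex.I * ω) * w).re : ℂ) *
      Complex.exp (2 * Complex.I * p * ω)‖ ≤ 1 := by
  rw [norm_mul, norm_exp_two_I_mul, mul_one, Complex.norm_real]
  exact Real.abs_cos_le_one _

theorem continuous_angInt (p : ℤ) : Continuous (angInt p) := by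
  unfold angInt
  exact intervalIntegral.continuous_parametric_intervalIntegral_of_continuous' (by fun_prop) _ _

theorem norm_angInt_le_pi (p : ℤ) (w : ℂ) : ‖angInt p w‖ ≤ Real.pi := by
  have h := intervalIntegral.norm_integral_le_of_norm_le_const (a := 0) (b := Real.pi)
    (fun ω _ => norm_angInt_integrand_le p w ω)
  rwa [one_mul, sub_zero, abs_of_pos Real.pi_pos] at h

theorem exp_two_I_periodic (p : ℤ) (ω : ℝ) :
    Complex.exp (2 * Complex.I * p * (ω + Real.pi : ℝ)) = Complex.exp (2 * Complex.I * p * ω) := by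
  have e : 2 * Complex.I * p * (ω + Real.pi : ℝ) =
      2 * Complex.I * p * ω + p * (2 * Real.pi * Complex.I) := by
    push_cast
    ring
  rw [e, Complex.exp_add, Complex.exp_int_mul_two_pi_mul_I, mul_one]

theorem angInt_integrand_periodic (p : ℤ) (w : ℂ) :
    Function.Periodic (fun ω : ℝ => (Real.cos (Complex.exp (Complex.I * ω) * w).re : ℂ) *
      Complex.exp (2 * Complex.I * p * ω)) Real.pi := by
  intro ω
  have e : Complex.exp (Complex.I * (ω + Real.pi : ℝ)) = -Complex.exp (Complex.I * ω) := by
    push_cast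
    rw [mul_add, Complex.exp_add, mul_comm Complex.I (Real.pi : ℂ), Complex.exp_pi_mul_I]
    ring
  simp only
  rw [exp_two_I_periodic, e, neg_mul, Complex.neg_re, Real.cos_neg]

/-- Reflection `ω ↦ -ω` conjugates `e^(iω) w` up to replacing `w` by `w̄`, and periodicity moves the
interval back to `[0, π]`. -/
theorem angInt_neg (p : ℤ) (w : ℂ) : angInt (-p) w = angInt p ((starRingEnd ℂ) w) := by
  have h1 := (angInt_integrand_periodic p ((starRingEnd ℂ) w)).intervalIntegral_add_eq
    (-Real.pi) 0
  have h2 := intervalIntegral.integral_comp_neg (a := (0 : ℝ)) (b := Real.pi)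
    (fun ω : ℝ => (Real.cos (Complex.exp (Complex.I * ω) * (starRingEnd ℂ) w).re : ℂ) *
      Complex.exp (2 * Complex.I * p * ω))
  rw [neg_add_cancel, zero_add] at h1
  rw [neg_zero] at h2
  rw [angInt, angInt, ← h1, ← h2]
  refine intervalIntegral.integral_congr fun ω _ => ?_
  have e : Complex.exp (Complex.I * (-ω : ℝ)) * (starRingEnd ℂ) w =
      (starRingEnd ℂ) (Complex.exp (Complex.I * ω) * w) := by
    rw [map_mul, ← Complex.exp_conj]
    simp
  rw [e, Complex.conj_re]
  congr 2
  push_cast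
  ring

/-- A rotation of `ω` by the argument of `w` costs only a unimodular factor, so decay need only be
studied for the phase `‖w‖ cos ω`. -/
theorem norm_angInt_eq (p : ℤ) (w : ℂ) : ‖angInt p w‖ = ‖∫ ω in (0 : ℝ)..Real.pi,
    (Real.cos (‖w‖ * Real.cos ω) : ℂ) * Complex.exp (2 * Complex.I * p * ω)‖ := by
  set g : ℝ → ℂ := fun ω => (Real.cos (‖w‖ * Real.cos ω) : ℂ) *
    Complex.exp (2 * Complex.I * p * ω) with hg
  have hper : Function.Periodic g Real.pi := by
    intro ω
    simp only [hg]
    rw [exp_two_I_periodic, Real.cos_add_pi, mul_neg, Real.cos_neg]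
  have h1 : angInt p w = Complex.exp (-(2 * Complex.I * p * w.arg)) *
      ∫ ω in (0 : ℝ)..Real.pi, g (ω + w.arg) := by
    rw [angInt, ← intervalIntegral.integral_const_mul]
    refine intervalIntegral.integral_congr fun ω _ => ?_
    have e : Complex.exp (Complex.I * ω) * w = ‖w‖ * Complex.exp ((ω + w.arg : ℝ) * Complex.I) := by
      conv_lhs => rw [← Complex.norm_mul_exp_arg_mul_I w]
      rw [mul_left_comm, ← Complex.exp_add]
      push_cast
      ring_nf
    simp only [hg]
    rw [e, Complex.re_ofReal_mul, Complex.exp_ofReal_mul_I_re, mul_left_comm, ← Complex.exp_add]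
    push_cast
    ring_nf
  rw [h1, intervalIntegral.integral_comp_add_right, zero_add, add_comm Real.pi,
    hper.intervalIntegral_add_eq w.arg 0, zero_add, norm_mul]
  have : ‖Complex.exp (-(2 * Complex.I * p * w.arg))‖ = 1 := by
    rw [Complex.norm_exp]
    simp
  rw [this, one_mul]

/-- The phase `ρ cos ω` is stationary only at `0` and `π`; away from them one integration by parts
gains `1/ρ`, at the price of two powers of `1 / sin δ`. -/
theorem norm_integral_cos_mul_cos_le (p : ℤ) {ρ δ : ℝ} (hρ : 0 < ρ) (hδ : 0 < δ)
    (hδ' : δ ≤ Real.pi / 2) :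
    ‖∫ ω in δ..(Real.pi - δ), (Real.cos (ρ * Real.cos ω) : ℂ) *
      Complex.exp (2 * Complex.I * p * ω)‖ ≤ (2 + Real.pi * (2 * |(p : ℝ)| + 1)) /
        (ρ * Real.sin δ ^ 2) := by
  have hπ := Real.pi_pos
  have hsδ : 0 < Real.sin δ := Real.sin_pos_of_pos_of_lt_pi hδ (by linarith)
  have hle : δ ≤ Real.pi - δ := by linarith
  have hsin : ∀ ω ∈ Icc δ (Real.pi - δ), Real.sin δ ≤ Real.sin ω := by
    intro ω hω
    rcases le_total ω (Real.pi / 2) with h | h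
    · exact Real.sin_le_sin_of_le_of_le_pi_div_two (by linarith) h hω.1
    · rw [← Real.sin_pi_sub ω]
      exact Real.sin_le_sin_of_le_of_le_pi_div_two (by linarith) (by linarith) (by linarith [hω.2])
  have hne : ∀ ω ∈ Icc δ (Real.pi - δ), (Real.sin ω : ℂ) ≠ 0 := fun ω hω => by
    exact_mod_cast (hsδ.trans_le (hsin ω hω)).ne'
  have hρ' : (ρ : ℂ) ≠ 0 := by exact_mod_cast hρ.ne'
  set u : ℝ → ℂ := fun ω => -(Complex.exp (2 * Complex.I * p * ω) / Real.sin ω) / ρ with hu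
  set u' : ℝ → ℂ := fun ω => -((2 * Complex.I * p * Complex.exp (2 * Complex.I * p * ω) *
    Real.sin ω - Complex.exp (2 * Complex.I * p * ω) * Real.cos ω) / Real.sin ω ^ 2) / ρ with hu'
  set v : ℝ → ℂ := fun ω => ((Real.sin (ρ * Real.cos ω) : ℝ) : ℂ) with hv
  set v' : ℝ → ℂ := fun ω => ((Real.cos (ρ * Real.cos ω) * (ρ * -Real.sin ω) : ℝ) : ℂ) with hv'
  have hdu : ∀ ω ∈ uIcc δ (Real.pi - δ), HasDerivAt u (u' ω) ω := by
    intro ω hω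
    rw [uIcc_of_le hle] at hω
    have h1 : HasDerivAt (fun ω : ℝ => Complex.exp (2 * Complex.I * p * ω))
        (2 * Complex.I * p * Complex.exp (2 * Complex.I * p * ω)) ω := by
      have ha : HasDerivAt (fun t : ℝ => (t : ℂ)) 1 ω := (hasDerivAt_id ω).ofReal_comp
      refine ((ha.const_mul (2 * Complex.I * p)).cexp).congr_deriv ?_
      ring
    exact ((h1.div (Real.hasDerivAt_sin ω).ofReal_comp (hne ω hω)).neg).div_const _
  have hdv : ∀ ω ∈ uIcc δ (Real.pi - δ), HasDerivAt v (v' ω) ω := fun ω _ =>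
    ((((Real.hasDerivAt_cos ω).const_mul ρ).sin)).ofReal_comp
  have hcu' : ContinuousOn u' (uIcc δ (Real.pi - δ)) := by
    rw [uIcc_of_le hle]
    have : ∀ ω ∈ Icc δ (Real.pi - δ), (Real.sin ω : ℂ) ^ 2 ≠ 0 := fun ω hω =>
      pow_ne_zero 2 (hne ω hω)
    simp only [hu']
    exact (((by fun_prop : Continuous fun ω : ℝ => 2 * Complex.I * p *
      Complex.exp (2 * Complex.I * p * ω) * Real.sin ω -
      Complex.exp (2 * Complex.I * p * ω) * Real.cos ω).continuousOn.div
      (by fun_prop) this).neg).div_const _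
  have hparts := intervalIntegral.integral_mul_deriv_eq_deriv_mul hdu hdv
    hcu'.intervalIntegrable (by simp only [hv']; exact Continuous.intervalIntegrable (by fun_prop) _ _)
  have hI : ∫ ω in δ..(Real.pi - δ), (Real.cos (ρ * Real.cos ω) : ℂ) *
      Complex.exp (2 * Complex.I * p * ω) = ∫ ω in δ..(Real.pi - δ), u ω * v' ω := by
    refine intervalIntegral.integral_congr fun ω hω => ?_
    rw [uIcc_of_le hle] at hω
    have := hne ω hω
    simp only [hu, hv']
    push_cast at this ⊢
    field_simp
  have hvb : ∀ ω, ‖v ω‖ ≤ 1 := fun ω => by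
    simp only [hv, Complex.norm_real]
    exact Real.abs_sin_le_one _
  have hub : ∀ ω ∈ Icc δ (Real.pi - δ), ‖u ω‖ ≤ 1 / (ρ * Real.sin δ) := by
    intro ω hω
    have h1 := hsin ω hω
    simp only [hu]
    rw [norm_div, norm_neg, norm_div, norm_exp_two_I_mul, Complex.norm_real, Complex.norm_real,
      Real.norm_of_nonneg hρ.le, Real.norm_of_nonneg (hsδ.le.trans h1), div_div, mul_comm ρ]
    gcongr
  have hub' : ∀ ω ∈ Icc δ (Real.pi - δ), ‖u' ω‖ ≤ (2 * |(p : ℝ)| + 1) / (ρ * Real.sin δ ^ 2) := by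
    intro ω hω
    have h1 := hsin ω hω
    simp only [hu']
    rw [norm_div, norm_neg, norm_div, norm_pow, Complex.norm_real, Complex.norm_real,
      Real.norm_of_nonneg hρ.le, Real.norm_of_nonneg (hsδ.le.trans h1), div_div,
      mul_comm ρ (Real.sin δ ^ 2)]
    have h2 : ‖2 * Complex.I * p * Complex.exp (2 * Complex.I * p * ω) * Real.sin ω -
        Complex.exp (2 * Complex.I * p * ω) * Real.cos ω‖ ≤ 2 * |(p : ℝ)| + 1 := by
      refine (norm_sub_le _ _).trans ?_
      simp only [norm_mul, norm_exp_two_I_mul, Complex.norm_real, Complex.norm_I, mul_one, one_mul,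
        Complex.norm_two, Complex.norm_intCast]
      have h3 : ‖Real.sin ω‖ ≤ 1 := Real.abs_sin_le_one _
      have h4 : ‖Real.cos ω‖ ≤ 1 := Real.abs_cos_le_one _
      have h5 : 2 * |(p : ℝ)| * ‖Real.sin ω‖ ≤ 2 * |(p : ℝ)| * 1 := by gcongr
      linarith
    gcongr
  have hint : ‖∫ ω in δ..(Real.pi - δ), u' ω * v ω‖ ≤
      (2 * |(p : ℝ)| + 1) / (ρ * Real.sin δ ^ 2) * |Real.pi - δ - δ| := by
    refine intervalIntegral.norm_integral_le_of_norm_le_const fun ω hω => ?_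
    rw [uIoc_of_le hle] at hω
    have h1 := hub' ω (Ioc_subset_Icc_self hω)
    rw [norm_mul]
    calc ‖u' ω‖ * ‖v ω‖ ≤ (2 * |(p : ℝ)| + 1) / (ρ * Real.sin δ ^ 2) * 1 := by
          gcongr
          exact hvb ω
      _ = _ := mul_one _
  have hend : ∀ ω ∈ Icc δ (Real.pi - δ), ‖u ω * v ω‖ ≤ 1 / (ρ * Real.sin δ ^ 2) := by
    intro ω hω
    rw [norm_mul]
    have h1 : ‖u ω‖ * ‖v ω‖ ≤ 1 / (ρ * Real.sin δ) * 1 := by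
      gcongr
      · exact hub ω hω
      · exact hvb ω
    refine h1.trans ?_
    rw [mul_one]
    have h2 : Real.sin δ ^ 2 ≤ Real.sin δ := by
      have := Real.sin_le_one δ
      nlinarith
    gcongr
  rw [hI, hparts]
  have hab : |Real.pi - δ - δ| ≤ Real.pi := by
    rw [abs_of_nonneg (by linarith)]
    linarith
  have h1 := hend _ (left_mem_Icc.mpr hle)
  have h2 := hend _ (right_mem_Icc.mpr hle)
  have h3 : (2 * |(p : ℝ)| + 1) / (ρ * Real.sin δ ^ 2) * |Real.pi - δ - δ| ≤
      (2 * |(p : ℝ)| + 1) / (ρ * Real.sin δ ^ 2) * Real.pi := by gcongr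
  have h4 := (norm_sub_le (u (Real.pi - δ) * v (Real.pi - δ) - u δ * v δ)
    (∫ ω in δ..(Real.pi - δ), u' ω * v ω))
  have h5 := norm_sub_le (u (Real.pi - δ) * v (Real.pi - δ)) (u δ * v δ)
  have h6 : (2 + Real.pi * (2 * |(p : ℝ)| + 1)) / (ρ * Real.sin δ ^ 2) =
      1 / (ρ * Real.sin δ ^ 2) + 1 / (ρ * Real.sin δ ^ 2) +
      (2 * |(p : ℝ)| + 1) / (ρ * Real.sin δ ^ 2) * Real.pi := by ring
  rw [h6]
  linarith

/-- A decay estimate for the angular integral. -/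
theorem norm_angInt_le (p : ℤ) {w : ℂ} (hw : w ≠ 0) :
    ‖angInt p w‖ ≤ 30 * (1 + |(p : ℝ)|) * ‖w‖ ^ (-(1 / 3) : ℝ) := by
  have hρ : 0 < ‖w‖ := norm_pos_iff.mpr hw
  have hπ := Real.pi_lt_d2
  have hπ3 := Real.pi_gt_three
  have hp := abs_nonneg (p : ℝ)
  set ρ := ‖w‖ with hρdef
  -- Balances the trivial bound `δ` near each stationary point against `1/(ρ δ²)` in the middle. Any
  -- negative power of `‖w‖` suffices for the later convergence in `r`; the constant 30 is `1 + 1 +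
  -- 28`.
  set δ : ℝ := ρ ^ (-(1 / 3) : ℝ) with hδdef
  have hδ : 0 < δ := Real.rpow_pos_of_pos hρ _
  rcases le_or_gt 1 ρ with h | h
  · have hδ1 : δ ≤ 1 := Real.rpow_le_one_of_one_le_of_nonpos h (by norm_num)
    have hδπ : δ ≤ Real.pi / 2 := by linarith
    have hcube : ρ * δ ^ 3 = 1 := by
      rw [hδdef, ← Real.rpow_natCast, ← Real.rpow_mul hρ.le]
      norm_num
      rw [Real.rpow_neg_one]
      field_simp
    have hb := norm_integral_cos_mul_cos_le p hρ hδ hδπ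
    set g : ℝ → ℂ := fun ω => (Real.cos (ρ * Real.cos ω) : ℂ) *
      Complex.exp (2 * Complex.I * p * ω) with hg
    have hgc : Continuous g := by fun_prop
    have hg1 : ∀ ω, ‖g ω‖ ≤ 1 := fun ω => by
      simp only [hg]
      rw [norm_mul, norm_exp_two_I_mul, mul_one, Complex.norm_real]
      exact Real.abs_cos_le_one _
    have hi : ∀ a b, IntervalIntegrable g volume a b := fun a b => hgc.intervalIntegrable a b
    have hsplit : ∫ ω in (0 : ℝ)..Real.pi, g ω = (∫ ω in (0 : ℝ)..δ, g ω) +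
        (∫ ω in δ..(Real.pi - δ), g ω) + ∫ ω in (Real.pi - δ)..Real.pi, g ω := by
      rw [intervalIntegral.integral_add_adjacent_intervals (hi _ _) (hi _ _),
        intervalIntegral.integral_add_adjacent_intervals (hi _ _) (hi _ _)]
    have h1 : ‖∫ ω in (0 : ℝ)..δ, g ω‖ ≤ 1 * |δ - 0| :=
      intervalIntegral.norm_integral_le_of_norm_le_const fun ω _ => hg1 ω
    have h2 : ‖∫ ω in (Real.pi - δ)..Real.pi, g ω‖ ≤ 1 * |Real.pi - (Real.pi - δ)| :=
      intervalIntegral.norm_integral_le_of_norm_le_const fun ω _ => hg1 ω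
    rw [sub_zero, one_mul, abs_of_pos hδ] at h1
    rw [sub_sub_cancel, one_mul, abs_of_pos hδ] at h2
    have hsin : 2 / Real.pi * δ ≤ Real.sin δ := Real.mul_le_sin hδ.le hδπ
    have hsin' : δ / 2 ≤ Real.sin δ := by
      refine le_trans ?_ hsin
      rw [div_mul_eq_mul_div, div_le_div_iff₀ (by norm_num) Real.pi_pos]
      nlinarith
    have h3 : (2 + Real.pi * (2 * |(p : ℝ)| + 1)) / (ρ * Real.sin δ ^ 2) ≤
        28 * (1 + |(p : ℝ)|) * δ := by
      have h4 : (2 + Real.pi * (2 * |(p : ℝ)| + 1)) / (ρ * Real.sin δ ^ 2) ≤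
          (7 * (1 + |(p : ℝ)|)) / (ρ * (δ / 2) ^ 2) := by
        have h5 : 2 + Real.pi * (2 * |(p : ℝ)| + 1) ≤ 7 * (1 + |(p : ℝ)|) := by nlinarith
        gcongr
      refine h4.trans ?_
      rw [div_le_iff₀ (by positivity)]
      have : 28 * (1 + |(p : ℝ)|) * δ * (ρ * (δ / 2) ^ 2) =
          7 * (1 + |(p : ℝ)|) * (ρ * δ ^ 3) := by ring
      rw [this, hcube, mul_one]
    rw [norm_angInt_eq, hsplit]
    have h5 := norm_add₃_le (a := ∫ ω in (0 : ℝ)..δ, g ω) (b := ∫ ω in δ..(Real.pi - δ), g ω)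
      (c := ∫ ω in (Real.pi - δ)..Real.pi, g ω)
    have h6 : 0 ≤ |(p : ℝ)| * δ := by positivity
    nlinarith
  · have hδ1 : 1 ≤ δ := Real.one_le_rpow_of_pos_of_le_one_of_nonpos hρ h.le (by norm_num)
    have := norm_angInt_le_pi p w
    nlinarith [mul_nonneg hp hδ.le]

theorem integral_exp_two_I (k : ℤ) :
    ∫ ω in (0 : ℝ)..Real.pi, Complex.exp (2 * Complex.I * k * ω) =
      if k = 0 then (Real.pi : ℂ) else 0 := by
  split_ifs with h
  · simp [h]
  · have hc : 2 * Complex.I * (k : ℂ) ≠ 0 := by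
      simp [h]
    rw [integral_exp_mul_complex hc]
    have h1 := exp_two_I_periodic k 0
    rw [zero_add] at h1
    rw [h1, sub_self, zero_div]

theorem hasSum_cos_re (ζ : ℂ) :
    HasSum (fun i : ℕ × ℕ => (1 + (-1) ^ (i.1 + i.2)) / 2 * (Complex.I / 2) ^ (i.1 + i.2) *
      (ζ ^ i.1 * (starRingEnd ℂ) ζ ^ i.2) / (i.1.factorial * i.2.factorial : ℂ))
      (Real.cos ζ.re : ℂ) := by
  have hexp : ∀ a b : ℂ, HasSum (fun i : ℕ × ℕ => a ^ i.1 / i.1.factorial *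
      (b ^ i.2 / i.2.factorial)) (Complex.exp (a + b)) := by
    intro a b
    have h1 : ∀ a : ℂ, Summable fun n : ℕ => ‖a ^ n / (n.factorial : ℂ)‖ := fun a =>
      NormedSpace.norm_expSeries_div_summable a
    have h2 : ∀ a : ℂ, ∑' n : ℕ, a ^ n / (n.factorial : ℂ) = Complex.exp a := fun a => by
      rw [Complex.exp_eq_exp_ℂ]
      exact (NormedSpace.expSeries_div_hasSum_exp a).tsum_eq
    rw [Complex.exp_add, ← h2 a, ← h2 b, tsum_mul_tsum_of_summable_norm (h1 a) (h1 b)]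
    exact (summable_mul_of_summable_norm (h1 a) (h1 b)).hasSum
  have h3 := ((hexp (Complex.I / 2 * ζ) (Complex.I / 2 * (starRingEnd ℂ) ζ)).add
    (hexp (-(Complex.I / 2 * ζ)) (-(Complex.I / 2 * (starRingEnd ℂ) ζ)))).div_const 2
  have h4 : (Complex.exp (Complex.I / 2 * ζ + Complex.I / 2 * (starRingEnd ℂ) ζ) +
      Complex.exp (-(Complex.I / 2 * ζ) + -(Complex.I / 2 * (starRingEnd ℂ) ζ))) / 2 =
      (Real.cos ζ.re : ℂ) := by
    have e : Complex.I / 2 * ζ + Complex.I / 2 * (starRingEnd ℂ) ζ = ζ.re * Complex.I := by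
      rw [← mul_add, Complex.add_conj]
      push_cast
      ring
    rw [← neg_add, e, Complex.ofReal_cos, Complex.cos, neg_mul]
  rw [h4] at h3
  refine h3.congr_fun fun i => ?_
  rw [neg_pow (Complex.I / 2 * ζ), neg_pow (Complex.I / 2 * (starRingEnd ℂ) ζ), mul_pow, mul_pow,
    pow_add, pow_add]
  field_simp

/-- Expand the cosine as a double power series in `e^(iω) w` and its conjugate and integrate
termwise: orthogonality keeps only the pairs with `i.2 = i.1 + 2p`. -/
theorem hasSum_angInt (p : ℕ) (w : ℂ) :
    HasSum (fun m : ℕ => Real.pi * (-1) ^ p * ((starRingEnd ℂ) w / 2) ^ (2 * p) *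
      ((-(w * (starRingEnd ℂ) w / 4)) ^ m / (m.factorial * (m + 2 * p).factorial : ℂ)))
      (angInt p w) := by
  set c : ℕ × ℕ → ℂ := fun i => (1 + (-1) ^ (i.1 + i.2)) / 2 * (Complex.I / 2) ^ (i.1 + i.2) *
      (w ^ i.1 * (starRingEnd ℂ) w ^ i.2) / (i.1.factorial * i.2.factorial : ℂ) with hc
  have hterm : ∀ (i : ℕ × ℕ) (ω : ℝ), (1 + (-1) ^ (i.1 + i.2)) / 2 *
      (Complex.I / 2) ^ (i.1 + i.2) * ((Complex.exp (Complex.I * ω) * w) ^ i.1 *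
      (starRingEnd ℂ) (Complex.exp (Complex.I * ω) * w) ^ i.2) /
      (i.1.factorial * i.2.factorial : ℂ) * Complex.exp (2 * Complex.I * p * ω) =
      c i * Complex.exp (Complex.I * ((i.1 : ℂ) - i.2 + 2 * p) * ω) := by
    intro i ω
    have e : Complex.exp (Complex.I * ((i.1 : ℂ) - i.2 + 2 * p) * ω) =
        Complex.exp (Complex.I * ω) ^ i.1 * Complex.exp (-(Complex.I * ω)) ^ i.2 *
          Complex.exp (2 * Complex.I * p * ω) := by
      rw [← Complex.exp_nat_mul, ← Complex.exp_nat_mul, ← Complex.exp_add, ← Complex.exp_add]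
      ring_nf
    have e2 : (starRingEnd ℂ) (Complex.exp (Complex.I * ω) * w) =
        Complex.exp (-(Complex.I * ω)) * (starRingEnd ℂ) w := by
      rw [map_mul, ← Complex.exp_conj]
      simp
    rw [e2, e, mul_pow, mul_pow]
    simp only [hc]
    ring
  have hI : HasSum (fun i : ℕ × ℕ => ∫ ω in (0 : ℝ)..Real.pi,
      c i * Complex.exp (Complex.I * ((i.1 : ℂ) - i.2 + 2 * p) * ω)) (angInt p w) := by
    have hb : Summable fun i : ℕ × ℕ => ‖w‖ ^ i.1 / i.1.factorial *
        (‖w‖ ^ i.2 / i.2.factorial) :=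
      (Real.summable_pow_div_factorial ‖w‖).mul_of_nonneg (Real.summable_pow_div_factorial ‖w‖)
        (fun n => by positivity) (fun n => by positivity)
    refine intervalIntegral.hasSum_integral_of_dominated_convergence
      (fun (i : ℕ × ℕ) _ => ‖w‖ ^ i.1 / i.1.factorial * (‖w‖ ^ i.2 / i.2.factorial))
      (fun i => Continuous.aestronglyMeasurable (by fun_prop)) (fun i => ae_of_all _ fun ω _ => ?_)
      (ae_of_all _ fun ω _ => hb) (by simp) (ae_of_all _ fun ω _ => ?_)
    · have h1 : ‖Complex.exp (Complex.I * ((i.1 : ℂ) - i.2 + 2 * p) * ω)‖ = 1 := by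
        rw [Complex.norm_exp]
        simp
      have h2 : ‖((1 : ℂ) + (-1) ^ (i.1 + i.2)) / 2‖ ≤ 1 := by
        rw [norm_div, Complex.norm_two, div_le_one two_pos]
        refine (norm_add_le _ _).trans ?_
        simp
        norm_num
      have h3 : ‖(Complex.I / 2) ^ (i.1 + i.2)‖ ≤ 1 := by
        rw [norm_pow]
        refine pow_le_one₀ (norm_nonneg _) ?_
        simp
        norm_num
      rw [norm_mul, h1, mul_one]
      simp only [hc]
      rw [norm_div, norm_mul, norm_mul, norm_mul, norm_mul, norm_pow w, norm_pow ((starRingEnd ℂ) w),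
        RCLike.norm_conj, Complex.norm_natCast, Complex.norm_natCast, div_mul_div_comm]
      have h4 : ‖((1 : ℂ) + (-1) ^ (i.1 + i.2)) / 2‖ * ‖(Complex.I / 2) ^ (i.1 + i.2)‖ ≤ 1 :=
        mul_le_one₀ h2 (norm_nonneg _) h3
      exact div_le_div_of_nonneg_right (mul_le_of_le_one_left (by positivity) h4) (by positivity)
    · refine ((hasSum_cos_re (Complex.exp (Complex.I * ω) * w)).mul_right
        (Complex.exp (2 * Complex.I * p * ω))).congr_fun fun i => ?_
      exact (hterm i ω).symm
  have hval : ∀ i : ℕ × ℕ, ∫ ω in (0 : ℝ)..Real.pi,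
      c i * Complex.exp (Complex.I * ((i.1 : ℂ) - i.2 + 2 * p) * ω) =
      if i.2 = i.1 + 2 * p then c i * Real.pi else 0 := by
    intro i
    rw [intervalIntegral.integral_const_mul]
    -- Exponentials of odd frequency need not integrate to zero over `[0, π]`, but the evenness of
    -- the cosine makes their coefficients vanish.
    rcases Nat.even_or_odd (i.1 + i.2) with h | h
    · obtain ⟨k, hk⟩ := h
      have e : ∀ ω : ℝ, Complex.exp (Complex.I * ((i.1 : ℂ) - i.2 + 2 * p) * ω) =
          Complex.exp (2 * Complex.I * ((i.1 + p - k : ℤ) : ℂ) * ω) := by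
        intro ω
        have : (i.1 : ℂ) + i.2 = k + k := by exact_mod_cast hk
        have h2 : (i.2 : ℂ) = k + k - i.1 := by rw [← this]; ring
        rw [h2]
        push_cast
        ring_nf
      simp only [e]
      rw [integral_exp_two_I]
      by_cases h3 : i.2 = i.1 + 2 * p
      · rw [if_pos h3, if_pos (by omega)]
      · rw [if_neg h3, if_neg (by omega), mul_zero]
    · have h0 : c i = 0 := by
        simp only [hc]
        rw [h.neg_one_pow]
        simp
      rw [h0]
      simp
  simp only [hval] at hI
  set g : ℕ → ℕ × ℕ := fun m => (m, m + 2 * p) with hg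
  have hinj : Function.Injective g := fun a b h => congrArg Prod.fst h
  have hsup : ∀ i ∉ range g, (if i.2 = i.1 + 2 * p then c i * (Real.pi : ℂ) else 0) = 0 := by
    intro i hi
    rw [if_neg]
    intro h
    exact hi ⟨i.1, Prod.ext rfl h.symm⟩
  have h5 := (hinj.hasSum_iff hsup).mpr hI
  refine h5.congr_fun fun m => ?_
  simp only [Function.comp, hg, hc, if_true]
  have e1 : (-1 : ℂ) ^ (m + (m + 2 * p)) = 1 := by
    rw [show m + (m + 2 * p) = 2 * (m + p) by ring, pow_mul]
    simp
  have e2 : (Complex.I / 2) ^ (m + (m + 2 * p)) = (-1 / 4) ^ m * ((-1) ^ p * (1 / 2) ^ (2 * p)) := by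
    rw [show m + (m + 2 * p) = 2 * m + 2 * p by ring, pow_add, pow_mul, pow_mul, pow_mul, div_pow,
      Complex.I_sq, ← mul_pow]
    norm_num
  rw [e1, e2, pow_add _ m, div_pow ((starRingEnd ℂ) w)]
  have e3 : (-(w * (starRingEnd ℂ) w / 4)) ^ m =
      (-1 / 4) ^ m * (w ^ m * (starRingEnd ℂ) w ^ m) := by
    rw [← mul_pow, ← mul_pow]
    ring
  rw [e3, one_div, inv_pow]
  ring

/-- The Laplace transform of the angular integral in the square of the radius. -/
theorem laplace_angInt (p : ℕ) (w : ℂ) {s : ℝ} (hs : 0 < s) :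
    ∫ x : ℝ in Ioi 0, (x : ℂ) ^ p * angInt p (Real.sqrt x * w) * Complex.exp (-(s * x)) =
      Real.pi * (-1) ^ p * ((starRingEnd ℂ) w / 2) ^ (2 * p) * (1 / s) ^ (2 * p + 1) *
        Complex.exp (-(w * (starRingEnd ℂ) w / 4) / s) := by
  set D : ℂ := Real.pi * (-1) ^ p * ((starRingEnd ℂ) w / 2) ^ (2 * p)
  set c : ℕ → ℂ := fun m => D *
    ((-(w * (starRingEnd ℂ) w / 4)) ^ m / (m.factorial * (m + 2 * p).factorial : ℂ)) with hc
  set e : ℕ → ℂ := fun m => ((m + 2 * p : ℕ) : ℂ) + 1 with he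
  have hre : ∀ m, (e m).re = ((m + 2 * p : ℕ) : ℝ) + 1 := fun m => by
    simp only [he, Complex.add_re, Complex.natCast_re, Complex.one_re]
  have hs' : (s : ℂ) ≠ 0 := by exact_mod_cast hs.ne'
  have hcpow : ∀ m, (1 / (s : ℂ)) ^ e m = (1 / (s : ℂ)) ^ (m + 2 * p + 1) := fun m => by
    rw [← Complex.cpow_natCast]
    simp only [he]
    push_cast
    rfl
  have hsum : Summable fun m => ‖c m‖ * ((1 / s) ^ (e m).re * Real.Gamma (e m).re) := by
    have h := ((Real.summable_pow_div_factorial (‖w * (starRingEnd ℂ) w / 4‖ / s)).mul_left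
      (‖D‖ * (1 / s) ^ (2 * p + 1)))
    refine h.congr fun m => ?_
    rw [hre, Real.Gamma_nat_eq_factorial]
    have e2 : (1 / s : ℝ) ^ (((m + 2 * p : ℕ) : ℝ) + 1) = (1 / s) ^ (m + 2 * p + 1) := by
      rw [← Real.rpow_natCast]; push_cast; rfl
    rw [e2]
    have e4 : ‖c m‖ = ‖D‖ * (‖w * (starRingEnd ℂ) w / 4‖ ^ m /
        (m.factorial * (m + 2 * p).factorial)) := by
      simp only [hc]
      rw [norm_mul D, norm_div (_ ^ m), norm_pow, norm_neg, norm_mul (m.factorial : ℂ),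
        Complex.norm_natCast, Complex.norm_natCast]
    rw [e4]
    have e3 : ((m + 2 * p).factorial : ℝ) ≠ 0 := by exact_mod_cast Nat.factorial_ne_zero _
    simp only [pow_add, div_pow, one_pow]
    field_simp
  have hexp : ∀ x : ℝ, 0 < x → HasSum (fun m => c m * (x : ℂ) ^ (e m - 1))
      ((x : ℂ) ^ p * angInt p (Real.sqrt x * w)) := by
    intro x hx
    have hsq : (Real.sqrt x : ℂ) ^ 2 = x := by
      rw [← Complex.ofReal_pow, Real.sq_sqrt hx.le]
    refine ((hasSum_angInt p (Real.sqrt x * w)).mul_left ((x : ℂ) ^ p)).congr_fun fun m => ?_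
    simp only [he, add_sub_cancel_right]
    rw [Complex.cpow_natCast, map_mul, Complex.conj_ofReal]
    have e1 : (Real.sqrt x : ℂ) * w * (Real.sqrt x * (starRingEnd ℂ) w) =
        x * (w * (starRingEnd ℂ) w) := by
      rw [← hsq]
      ring
    have e2 : ((Real.sqrt x : ℂ) * (starRingEnd ℂ) w / 2) ^ (2 * p) =
        x ^ p * ((starRingEnd ℂ) w / 2) ^ (2 * p) := by
      rw [pow_mul, pow_mul, ← mul_pow, mul_div_assoc, mul_pow, hsq]
    have e3 : (-((x : ℂ) * (w * (starRingEnd ℂ) w) / 4)) ^ m =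
        x ^ m * (-(w * (starRingEnd ℂ) w / 4)) ^ m := by
      rw [← mul_pow]
      ring
    have e4 : (x : ℂ) ^ (m + 2 * p) = x ^ m * (x ^ p * x ^ p) := by ring
    rw [e1, e2, e3, e4]
    simp only [hc, D]
    ring
  have hcont : ContinuousOn (fun x : ℝ => (x : ℂ) ^ p * angInt p (Real.sqrt x * w)) (Ioi 0) := by
    have := continuous_angInt p
    exact Continuous.continuousOn (by fun_prop)
  obtain ⟨-, hval⟩ := laplace_hasSum (fun m => by rw [hre]; positivity) hs hsum hcont hexp
  rw [← hval.tsum_eq]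
  have h := (NormedSpace.expSeries_div_hasSum_exp (-(w * (starRingEnd ℂ) w / 4) / s)).mul_left
    (D * (1 / s) ^ (2 * p + 1))
  rw [← Complex.exp_eq_exp_ℂ] at h
  rw [← h.tsum_eq]
  refine tsum_congr fun m => ?_
  rw [hcpow]
  simp only [hc, he]
  rw [Complex.Gamma_nat_eq_factorial]
  have e3 : ((m + 2 * p).factorial : ℂ) ≠ 0 := by exact_mod_cast Nat.factorial_ne_zero _
  simp only [pow_add, div_pow, one_pow]
  field_simp

/-! ### Injectivity of the Laplace transform -/

/-- Only integrability at the real abscissa `σ` is assumed; the factor `x` from differentiating is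
absorbed by `x e^(-εx) ≤ 1/ε`, with `ε` half the distance to the line. -/
theorem differentiableOn_laplace {f : ℝ → ℂ} {σ : ℝ}
    (hf : IntegrableOn (fun x : ℝ => f x * Complex.exp (-(σ * x))) (Ioi 0)) :
    DifferentiableOn ℂ (fun s : ℂ => ∫ x : ℝ in Ioi 0, f x * Complex.exp (-(s * x)))
      {s : ℂ | σ < s.re} := by
  have hmeas : ∀ s : ℂ, AEStronglyMeasurable (fun x : ℝ => f x * Complex.exp (-(s * x)))
      (volume.restrict (Ioi 0)) := by
    intro s
    have h1 : AEStronglyMeasurable (fun x : ℝ => Complex.exp ((σ - s) * x))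
        (volume.restrict (Ioi 0)) := Continuous.aestronglyMeasurable (by fun_prop)
    refine (hf.1.mul h1).congr (ae_of_all _ fun x => ?_)
    simp only [Pi.mul_apply]
    rw [mul_assoc, ← Complex.exp_add]
    ring_nf
  have hnorm : ∀ (s : ℂ) (x : ℝ), ‖f x * Complex.exp (-(s * x))‖ =
      ‖f x * Complex.exp (-(σ * x))‖ * Real.exp (-((s.re - σ) * x)) := by
    intro s x
    rw [norm_mul, norm_mul, Complex.norm_exp, Complex.norm_exp, mul_assoc, ← Real.exp_add]
    congr 2
    simp
    ring
  intro s hs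
  have hs' : σ < s.re := hs
  set ε : ℝ := (s.re - σ) / 2 with hε
  have hε0 : 0 < ε := by rw [hε]; linarith
  have hball : ∀ t ∈ {t : ℂ | σ + ε < t.re}, ε ≤ t.re - σ := by
    intro t ht
    have : σ + ε < t.re := ht
    linarith
  have h := hasDerivAt_integral_of_dominated_loc_of_deriv_le (𝕜 := ℂ)
    (μ := volume.restrict (Ioi (0 : ℝ)))
    (F := fun (s : ℂ) (x : ℝ) => f x * Complex.exp (-(s * x)))
    (F' := fun (s : ℂ) (x : ℝ) => -(x : ℂ) * (f x * Complex.exp (-(s * x))))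
    (bound := fun x => ‖f x * Complex.exp (-(σ * x))‖ * (1 / ε))
    (x₀ := s) (s := {t : ℂ | σ + ε < t.re})
    ((isOpen_lt continuous_const Complex.continuous_re).mem_nhds
      (show σ + ε < s.re by rw [hε]; linarith))
    (Eventually.of_forall hmeas) ?_ ?_ ?_ (hf.norm.mul_const _) ?_
  · exact h.2.differentiableAt.differentiableWithinAt
  · refine Integrable.mono' hf.norm (hmeas s) ?_
    refine (ae_restrict_iff' measurableSet_Ioi).mpr (ae_of_all _ fun x hx => ?_)
    rw [hnorm]
    refine mul_le_of_le_one_right (norm_nonneg _) (Real.exp_le_one_iff.mpr ?_)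
    have : 0 < (s.re - σ) * x := mul_pos (by linarith) hx
    linarith
  · exact (Continuous.aestronglyMeasurable (by fun_prop)).mul (hmeas s)
  · refine (ae_restrict_iff' measurableSet_Ioi).mpr (ae_of_all _ fun x hx t ht => ?_)
    have hx0 : (0 : ℝ) < x := hx
    rw [norm_mul, hnorm, norm_neg, Complex.norm_real, Real.norm_of_nonneg hx0.le, mul_left_comm]
    refine mul_le_mul_of_nonneg_left ?_ (norm_nonneg _)
    have h1 : Real.exp (-((t.re - σ) * x)) ≤ Real.exp (-(ε * x)) := by
      have := mul_le_mul_of_nonneg_right (hball t ht) hx0.le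
      exact Real.exp_le_exp.mpr (by linarith)
    have h2 : ε * x ≤ Real.exp (ε * x) := by
      have := Real.add_one_le_exp (ε * x)
      linarith
    calc x * Real.exp (-((t.re - σ) * x)) ≤ x * Real.exp (-(ε * x)) := by gcongr
      _ = (ε * x) * Real.exp (-(ε * x)) / ε := by field_simp
      _ ≤ Real.exp (ε * x) * Real.exp (-(ε * x)) / ε := by gcongr
      _ = 1 / ε := by rw [← Real.exp_add, add_neg_cancel, Real.exp_zero]
  · refine ae_of_all _ fun x t _ => ?_
    have h1 : HasDerivAt (fun s : ℂ => -(s * x)) (-(1 * (x : ℂ))) t :=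
      ((hasDerivAt_id t).mul_const (x : ℂ)).neg
    refine (h1.cexp.const_mul (f x)).congr_deriv ?_
    ring

/-- A function whose Laplace transform vanishes for large real arguments vanishes at its points of
continuity. -/
theorem eq_zero_of_laplace_eq_zero {f : ℝ → ℂ} {σ : ℝ}
    (hf : IntegrableOn (fun x : ℝ => f x * Complex.exp (-(σ * x))) (Ioi 0))
    (h : ∀ s : ℝ, σ < s → ∫ x : ℝ in Ioi 0, f x * Complex.exp (-(s * x)) = 0)
    {x₀ : ℝ} (hx₀ : 0 < x₀) (hc : ContinuousAt f x₀) : f x₀ = 0 := by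
  set L : ℂ → ℂ := fun s => ∫ x : ℝ in Ioi 0, f x * Complex.exp (-(s * x)) with hL
  have hopen : IsOpen {s : ℂ | σ < s.re} := isOpen_lt continuous_const Complex.continuous_re
  have hana := (differentiableOn_laplace hf).analyticOnNhd hopen
  -- The zeros on a real ray accumulate at `σ + 1`, so the identity theorem kills the transform on
  -- the whole half-plane.
  have hfreq : ∃ᶠ z : ℂ in 𝓝[≠] ((σ + 1 : ℝ) : ℂ), L z = 0 := by
    have h1 : Tendsto (fun s : ℝ => (s : ℂ)) (𝓝[>] (σ + 1)) (𝓝[≠] ((σ + 1 : ℝ) : ℂ)) := by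
      refine tendsto_nhdsWithin_iff.mpr ⟨(Complex.continuous_ofReal.tendsto _).mono_left
        nhdsWithin_le_nhds, ?_⟩
      filter_upwards [self_mem_nhdsWithin] with s hs
      have : s ≠ σ + 1 := ne_of_gt hs
      exact fun h => this (Complex.ofReal_injective h)
    refine h1.frequently (Eventually.frequently ?_)
    filter_upwards [self_mem_nhdsWithin] with s hs
    have : σ + 1 < s := hs
    exact h s (by linarith)
  have hzero := hana.eqOn_zero_of_preconnected_of_frequently_eq_zero
    (convex_halfSpace_re_gt σ).isPreconnected (z₀ := ((σ + 1 : ℝ) : ℂ)) (by simp) hfreq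
  -- On the vertical line through `σ + 1` the Laplace transform is the Fourier transform of `g`, so
  -- Fourier inversion gives the value of `g` at points of continuity.
  set g : ℝ → ℂ := (Ioi (0 : ℝ)).indicator
    (fun x => f x * Complex.exp (-(((σ + 1 : ℝ) : ℂ) * x))) with hg
  have hgi : Integrable g := by
    rw [hg, integrable_indicator_iff measurableSet_Ioi]
    refine Integrable.mono' hf.norm ?_ ?_
    · have h1 : AEStronglyMeasurable (fun x : ℝ => Complex.exp (-(x : ℂ)))
        (volume.restrict (Ioi 0)) := Continuous.aestronglyMeasurable (by fun_prop)
      refine (hf.1.mul h1).congr (ae_of_all _ fun x => ?_)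
      simp only [Pi.mul_apply]
      rw [mul_assoc, ← Complex.exp_add]
      push_cast
      ring_nf
    · refine (ae_restrict_iff' measurableSet_Ioi).mpr (ae_of_all _ fun x hx => ?_)
      have hx0 : (0 : ℝ) < x := hx
      rw [norm_mul, norm_mul, Complex.norm_exp, Complex.norm_exp]
      refine mul_le_mul_of_nonneg_left (Real.exp_le_exp.mpr ?_) (norm_nonneg _)
      simp
      linarith
  have hF : FourierTransform.fourier g = 0 := by
    funext w
    rw [Real.fourier_real_eq_integral_exp_smul]
    have h1 := hzero (show σ < (((σ + 1 : ℝ) : ℂ) + (2 * Real.pi * w : ℝ) * Complex.I).re by simp)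
    simp only [Pi.zero_apply] at h1
    rw [← integral_indicator measurableSet_Ioi] at h1
    rw [Pi.zero_apply, ← h1]
    refine integral_congr_ae (ae_of_all _ fun x => ?_)
    by_cases hx : x ∈ Ioi (0 : ℝ)
    · simp only [hg, indicator_of_mem hx, smul_eq_mul]
      rw [mul_left_comm, ← Complex.exp_add]
      push_cast
      ring_nf
    · simp only [hg, indicator_of_notMem hx, smul_zero]
  have hmem : Ioi (0 : ℝ) ∈ 𝓝 x₀ := Ioi_mem_nhds hx₀
  have hgc : ContinuousAt g x₀ := by
    have h1 : ContinuousAt (fun x => f x * Complex.exp (-(((σ + 1 : ℝ) : ℂ) * x))) x₀ :=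
      hc.mul (Continuous.continuousAt (by fun_prop))
    refine h1.congr ?_
    filter_upwards [hmem] with x hx
    rw [hg, indicator_of_mem hx]
  have hinv := hgi.fourierInv_fourier_eq (by rw [hF]; exact integrable_zero _ _ _) hgc
  rw [hF] at hinv
  have h2 : g x₀ = 0 := by
    rw [← hinv, Real.fourierInv_eq]
    simp
  rw [hg, indicator_of_mem (show x₀ ∈ Ioi (0 : ℝ) from hx₀)] at h2
  exact (mul_eq_zero.mp h2).resolve_right (Complex.exp_ne_zero _)

/-! ### The angular integral along the hyperbola -/

/-- The point `z e ^ r + conj z e ^ (-r)`. -/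
noncomputable def hypPt (z : ℂ) (r : ℝ) : ℂ :=
  z * Real.exp r + (starRingEnd ℂ) z * Real.exp (-r)

theorem continuous_hypPt (z : ℂ) : Continuous (hypPt z) := by
  unfold hypPt
  fun_prop

theorem norm_hypPt_ge (z : ℂ) {r : ℝ} (hr : 1 ≤ |r|) :
    ‖z‖ * Real.exp |r| / 2 ≤ ‖hypPt z r‖ := by
  have h2 : Real.exp (-|r|) ≤ Real.exp |r| / 2 := by
    have h3 : Real.exp (-|r|) * Real.exp |r| = 1 := by
      rw [← Real.exp_add, neg_add_cancel, Real.exp_zero]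
    have h4 := Real.add_one_le_exp |r|
    have h5 : Real.exp (-|r|) ≤ 1 := Real.exp_le_one_iff.mpr (by linarith)
    have h6 := Real.exp_pos (-|r|)
    nlinarith
  have h1 : ‖z‖ * Real.exp |r| - ‖z‖ * Real.exp (-|r|) ≤ ‖hypPt z r‖ := by
    rcases le_total 0 r with h | h
    · rw [abs_of_nonneg h]
      have := norm_sub_le_norm_add (z * Real.exp r) ((starRingEnd ℂ) z * Real.exp (-r))
      rwa [norm_mul, norm_mul, RCLike.norm_conj, Complex.norm_real, Complex.norm_real,
        Real.norm_of_nonneg (Real.exp_pos _).le, Real.norm_of_nonneg (Real.exp_pos _).le] at this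
    · rw [abs_of_nonpos h, neg_neg]
      have := norm_sub_le_norm_add ((starRingEnd ℂ) z * Real.exp (-r)) (z * Real.exp r)
      rw [norm_mul, norm_mul, RCLike.norm_conj, Complex.norm_real, Complex.norm_real,
        Real.norm_of_nonneg (Real.exp_pos _).le, Real.norm_of_nonneg (Real.exp_pos _).le] at this
      rwa [hypPt, add_comm]
  have h3 := mul_le_mul_of_nonneg_left h2 (norm_nonneg z)
  linarith

theorem integrable_exp_neg_abs_div_three : Integrable fun r : ℝ => Real.exp (-|r| / 3) := by
  refine Integrable.mono' (integrable_inv_one_add_sq.const_mul 18)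
    (Continuous.aestronglyMeasurable (by fun_prop)) (ae_of_all _ fun r => ?_)
  rw [Real.norm_of_nonneg (Real.exp_pos _).le]
  have h1 := Real.quadratic_le_exp_of_nonneg (x := |r| / 3) (by positivity)
  have h2 : (1 + r ^ 2) / 18 ≤ Real.exp (|r| / 3) := by
    refine le_trans ?_ h1
    rw [div_pow, sq_abs]
    have := abs_nonneg r
    linarith [sq_nonneg r]
  rw [neg_div, Real.exp_neg, ← div_eq_mul_inv, inv_eq_one_div, div_le_div_iff₀ (Real.exp_pos _)
    (by positivity)]
  linarith

/-- For `|r| < 1` the trivial bound `π` is enough; for `|r| ≥ 1` the point grows like `e^|r|` and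
the decay estimate for `angInt` applies. The bound is linear in `|p|` and its singularity in `t` is
mild. -/
theorem norm_angInt_hypPt_le (p : ℤ) {z : ℂ} (hz : z ≠ 0) {t : ℝ} (ht : 0 < t) (r : ℝ) :
    ‖angInt p (t * hypPt z r)‖ ≤
      60 * (1 + |(p : ℝ)|) * (1 + (t * ‖z‖) ^ (-(1 / 3) : ℝ)) * Real.exp (-|r| / 3) := by
  have hz' : 0 < ‖z‖ := norm_pos_iff.mpr hz
  have hT : 0 < (t * ‖z‖) ^ (-(1 / 3) : ℝ) := Real.rpow_pos_of_pos (by positivity) _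
  have hp := abs_nonneg (p : ℝ)
  rcases lt_or_ge |r| 1 with h | h
  · refine (norm_angInt_le_pi p _).trans ?_
    have h1 : (1 / 2 : ℝ) ≤ Real.exp (-|r| / 3) := by
      have := Real.add_one_le_exp (-|r| / 3)
      linarith
    have h2 : (1 : ℝ) ≤ (1 + |(p : ℝ)|) * (1 + (t * ‖z‖) ^ (-(1 / 3) : ℝ)) :=
      one_le_mul_of_one_le_of_one_le (by linarith) (by linarith)
    have h3 : (1 : ℝ) * (1 / 2) ≤ (1 + |(p : ℝ)|) * (1 + (t * ‖z‖) ^ (-(1 / 3) : ℝ)) *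
      Real.exp (-|r| / 3) := mul_le_mul h2 h1 (by norm_num) (by positivity)
    have := Real.pi_lt_d2
    linarith
  · have h1 := norm_hypPt_ge z h
    have hlow : 0 < t * (‖z‖ * Real.exp |r| / 2) := by positivity
    have hn : t * (‖z‖ * Real.exp |r| / 2) ≤ ‖(t : ℂ) * hypPt z r‖ := by
      rw [norm_mul, Complex.norm_real, Real.norm_of_nonneg ht.le]
      gcongr
    have hne : (t : ℂ) * hypPt z r ≠ 0 := norm_pos_iff.mp (hlow.trans_le hn)
    refine (norm_angInt_le p hne).trans ?_
    have h2 : ‖(t : ℂ) * hypPt z r‖ ^ (-(1 / 3) : ℝ) ≤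
        (t * (‖z‖ * Real.exp |r| / 2)) ^ (-(1 / 3) : ℝ) :=
      Real.rpow_le_rpow_of_nonpos hlow hn (by norm_num)
    have h3 : (t * (‖z‖ * Real.exp |r| / 2)) ^ (-(1 / 3) : ℝ) =
        (t * ‖z‖) ^ (-(1 / 3) : ℝ) * Real.exp (-|r| / 3) * (1 / 2) ^ (-(1 / 3) : ℝ) := by
      have e : t * (‖z‖ * Real.exp |r| / 2) = (t * ‖z‖) * Real.exp |r| * (1 / 2) := by ring
      rw [e, Real.mul_rpow (by positivity) (by norm_num), Real.mul_rpow (by positivity)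
        (Real.exp_pos _).le, ← Real.exp_mul]
      ring_nf
    have h4 : (1 / 2 : ℝ) ^ (-(1 / 3) : ℝ) ≤ 2 := by
      have : (1 / 2 : ℝ) ^ (-(1 / 3) : ℝ) ≤ (1 / 2 : ℝ) ^ (-1 : ℝ) :=
        Real.rpow_le_rpow_of_exponent_ge (by norm_num) (by norm_num) (by norm_num)
      refine this.trans ?_
      rw [Real.rpow_neg_one]
      norm_num
    calc 30 * (1 + |(p : ℝ)|) * ‖(t : ℂ) * hypPt z r‖ ^ (-(1 / 3) : ℝ)
        ≤ 30 * (1 + |(p : ℝ)|) * ((t * ‖z‖) ^ (-(1 / 3) : ℝ) * Real.exp (-|r| / 3) * 2) := by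
          gcongr
          rw [h3] at h2
          refine h2.trans ?_
          gcongr
      _ = 60 * (1 + |(p : ℝ)|) * (t * ‖z‖) ^ (-(1 / 3) : ℝ) * Real.exp (-|r| / 3) := by ring
      _ ≤ _ := by
          gcongr
          linarith

theorem kIntPow_exp (q : ℕ) (M A : ℂ) (c : ℝ) :
    kIntPow q M A (Real.exp (2 * c)) = 2 * ∫ r : ℝ,
      Complex.exp (M * (2 * r + c) - Complex.exp (2 * r + c) - Complex.exp (c - 2 * r)) *
        (1 + A * Complex.exp (-(2 * r + c))) ^ q := by
  set g : ℝ → ℂ := fun t => Complex.exp (M * t - Real.exp t - Real.exp (2 * c) * Real.exp (-t)) *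
    (1 + A * Real.exp (-t)) ^ q with hg
  have h1 : ∫ r : ℝ, g (2 * r + c) = (1 / 2 : ℝ) • ∫ t : ℝ, g t := by
    rw [Measure.integral_comp_mul_left (fun t => g (t + c)) 2, integral_add_right_eq_self g c]
    norm_num
  have h2 : ∀ r : ℝ, g (2 * r + c) = Complex.exp (M * (2 * r + c) - Complex.exp (2 * r + c) -
      Complex.exp (c - 2 * r)) * (1 + A * Complex.exp (-(2 * r + c))) ^ q := by
    intro r
    simp only [hg]
    push_cast
    rw [← Complex.exp_add]
    ring_nf
  simp only [h2] at h1
  have h3 : kIntPow q M A (Real.exp (2 * c)) = ∫ t : ℝ, g t := rfl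
  rw [h1, h3, Complex.real_smul]
  push_cast
  ring

/-- The integral `∫ e ^ (2νr) B_p(√x (z e ^ r + conj z e ^ (-r))) dr` of the angular integral. -/
noncomputable def hypInt (ν : ℂ) (p : ℤ) (z : ℂ) (x : ℝ) : ℂ :=
  ∫ r : ℝ, Complex.exp (2 * ν * r) * angInt p (Real.sqrt x * hypPt z r)

theorem norm_exp_two_mul {ν : ℂ} (hν : ν.re = 0) (r : ℝ) : ‖Complex.exp (2 * ν * r)‖ = 1 := by
  rw [Complex.norm_exp]
  simp [hν]

theorem norm_hypInt_integrand_le {ν : ℂ} (hν : ν.re = 0) (p : ℤ) {z : ℂ} (hz : z ≠ 0) {x : ℝ}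
    (hx : 0 < x) (r : ℝ) :
    ‖Complex.exp (2 * ν * r) * angInt p (Real.sqrt x * hypPt z r)‖ ≤
      60 * (1 + |(p : ℝ)|) * (1 + ‖z‖ ^ (-(1 / 3) : ℝ) * x ^ (-(1 / 6) : ℝ)) *
        Real.exp (-|r| / 3) := by
  rw [norm_mul, norm_exp_two_mul hν, one_mul]
  refine (norm_angInt_hypPt_le p hz (Real.sqrt_pos.mpr hx) r).trans (le_of_eq ?_)
  rw [Real.mul_rpow (Real.sqrt_nonneg x) (norm_nonneg z), Real.sqrt_eq_rpow, ← Real.rpow_mul hx.le,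
    mul_comm (‖z‖ ^ _)]
  norm_num

theorem continuous_hypInt_integrand (ν : ℂ) (p : ℤ) (z : ℂ) :
    Continuous fun q : ℝ × ℝ => Complex.exp (2 * ν * q.1) *
      angInt p (Real.sqrt q.2 * hypPt z q.1) := by
  have h1 := continuous_angInt p
  have h2 := continuous_hypPt z
  fun_prop

theorem continuousAt_hypInt {ν : ℂ} (hν : ν.re = 0) (p : ℤ) {z : ℂ} (hz : z ≠ 0) {x : ℝ}
    (hx : 0 < x) : ContinuousAt (hypInt ν p z) x := by
  have hc := continuous_hypInt_integrand ν p z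
  refine continuousAt_of_dominated (bound := fun r => 60 * (1 + |(p : ℝ)|) *
    (1 + ‖z‖ ^ (-(1 / 3) : ℝ) * (x / 2) ^ (-(1 / 6) : ℝ)) * Real.exp (-|r| / 3))
    (Eventually.of_forall fun y => ?_) ?_ (integrable_exp_neg_abs_div_three.const_mul _)
    (ae_of_all _ fun r => ?_)
  · exact (hc.comp (by fun_prop : Continuous fun r : ℝ => (r, y))).aestronglyMeasurable
  · filter_upwards [Ioi_mem_nhds (show x / 2 < x by linarith)] with y hy
    have hy' : x / 2 < y := hy
    refine ae_of_all _ fun r => (norm_hypInt_integrand_le hν p hz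
      (show 0 < y by linarith) r).trans ?_
    have : y ^ (-(1 / 6) : ℝ) ≤ (x / 2) ^ (-(1 / 6) : ℝ) :=
      Real.rpow_le_rpow_of_nonpos (by linarith) hy'.le (by norm_num)
    gcongr
  · exact (hc.comp (by fun_prop : Continuous fun y : ℝ => (r, y))).continuousAt

/-- Fubini in `(r, x)`, then `laplace_angInt` for each `r`. -/
theorem laplace_hypInt {ν : ℂ} (hν : ν.re = 0) (p : ℕ) {z : ℂ} (hz : z ≠ 0) {s : ℝ} (hs : 0 < s) :
    IntegrableOn (fun x : ℝ => (x : ℂ) ^ p * hypInt ν p z x * Complex.exp (-(s * x))) (Ioi 0) ∧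
    ∫ x : ℝ in Ioi 0, (x : ℂ) ^ p * hypInt ν p z x * Complex.exp (-(s * x)) =
      ∫ r : ℝ, Complex.exp (2 * ν * r) * (Real.pi * (-1) ^ p *
        ((starRingEnd ℂ) (hypPt z r) / 2) ^ (2 * p) * (1 / s) ^ (2 * p + 1) *
        Complex.exp (-(hypPt z r * (starRingEnd ℂ) (hypPt z r) / 4) / s)) := by
  set F : ℝ → ℝ → ℂ := fun r x => Complex.exp (2 * ν * r) * angInt p (Real.sqrt x * hypPt z r) *
    ((x : ℂ) ^ p * Complex.exp (-(s * x))) with hF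
  set E : ℝ := 60 * (1 + |((p : ℤ) : ℝ)|) with hE
  have hFi : Integrable (Function.uncurry F) (volume.prod (volume.restrict (Ioi 0))) := by
    have hx : ∀ a : ℝ, -1 < a → IntegrableOn (fun x : ℝ => x ^ a * Real.exp (-s * x)) (Ioi 0) := by
      intro a ha
      have := integrableOn_rpow_mul_exp_neg_mul_rpow (p := 1) ha one_pos hs
      simpa using this
    -- The scale `t = √x` turns `t^(-1/3)` into `x^(-1/6)`, which is integrable at the origin even
    -- when `p = 0`.
    have hb : IntegrableOn (fun x : ℝ => E * (x ^ (p : ℝ) * Real.exp (-s * x) +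
        ‖z‖ ^ (-(1 / 3) : ℝ) * (x ^ ((p : ℝ) - 1 / 6) * Real.exp (-s * x)))) (Ioi 0) := by
      have hp : (0 : ℝ) ≤ p := Nat.cast_nonneg p
      exact ((hx p (by linarith)).add ((hx (p - 1 / 6) (by linarith)).const_mul _)).const_mul _
    have hprod := Integrable.mul_prod integrable_exp_neg_abs_div_three hb
    have hc : Continuous (Function.uncurry F) := by
      have h1 := continuous_hypInt_integrand ν p z
      have h2 : Continuous fun q : ℝ × ℝ => (q.2 : ℂ) ^ p * Complex.exp (-(s * q.2)) := by
        fun_prop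
      exact h1.mul h2
    refine hprod.mono' hc.aestronglyMeasurable ?_
    have hmem : ∀ᵐ q : ℝ × ℝ ∂(volume.prod (volume.restrict (Ioi 0))), q.2 ∈ Ioi (0 : ℝ) :=
      Measure.quasiMeasurePreserving_snd.ae (ae_restrict_mem measurableSet_Ioi)
    filter_upwards [hmem] with q hq
    have hq' : 0 < q.2 := hq
    have h1 := norm_hypInt_integrand_le hν p hz hq' q.1
    have h2 : ‖(q.2 : ℂ) ^ p * Complex.exp (-(s * q.2))‖ = q.2 ^ (p : ℝ) * Real.exp (-s * q.2) := by
      rw [norm_mul, norm_pow, Complex.norm_real, Real.norm_of_nonneg hq'.le, Real.rpow_natCast,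
        Complex.norm_exp]
      simp
    simp only [Function.uncurry, hF]
    rw [norm_mul, h2]
    refine (mul_le_mul_of_nonneg_right h1 (by positivity)).trans (le_of_eq ?_)
    rw [show (p : ℝ) - 1 / 6 = p + -(1 / 6) by ring, Real.rpow_add hq']
    ring
  have hmul : ∀ x : ℝ, ∫ r : ℝ, F r x = (x : ℂ) ^ p * hypInt ν p z x * Complex.exp (-(s * x)) := by
    intro x
    simp only [hF]
    rw [integral_mul_const, hypInt]
    ring
  have hswap := integral_integral_swap hFi
  have hright := hFi.integral_prod_right
  simp only [Function.uncurry_apply_pair, hmul] at hswap hright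
  refine ⟨hright, ?_⟩
  rw [← hswap]
  refine integral_congr_ae (ae_of_all _ fun r => ?_)
  simp only [hF]
  rw [← laplace_angInt p (hypPt z r) hs, ← integral_const_mul]
  refine integral_congr_ae (ae_of_all _ fun x => ?_)
  simp only
  ring

/-! ### Matching the Laplace transforms, and the integral representation of `𝑱` -/

/-- The Laplace transform of `hypInt` as a modified Bessel integral. -/
theorem integral_hypPt_eq (ν : ℂ) (p : ℕ) (ξ : ℂ) (l c : ℝ) (hc : c = 2 * ξ.re - l) :
    ∫ r : ℝ, Complex.exp (2 * ν * r) * (Real.pi * (-1) ^ p *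
        ((starRingEnd ℂ) (hypPt (2 * Complex.exp ξ) r) / 2) ^ (2 * p) *
        (1 / Real.exp l) ^ (2 * p + 1) *
        Complex.exp (-(hypPt (2 * Complex.exp ξ) r *
          (starRingEnd ℂ) (hypPt (2 * Complex.exp ξ) r) / 4) / Real.exp l)) =
      Real.pi * (-1) ^ p * Complex.exp (-((2 * p + 1) * l) + 2 * p * (starRingEnd ℂ) ξ -
        (ν + p) * c - Complex.exp (2 * ξ - l) - Complex.exp (2 * (starRingEnd ℂ) ξ - l)) *
      (1 / 2) * kIntPow (2 * p) (ν + p) (Complex.exp (2 * ξ - l)) (Real.exp (2 * c)) := by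
  rw [kIntPow_exp, ← mul_assoc, mul_assoc _ (1 / 2 : ℂ) 2, ← integral_const_mul]
  refine integral_congr_ae (ae_of_all _ fun r => ?_)
  set η := (starRingEnd ℂ) ξ with hη
  have hc' : (c : ℂ) = ξ + η - l := by
    rw [hc, Complex.add_conj]
    push_cast
    ring
  have hw : hypPt (2 * Complex.exp ξ) r = 2 * (Complex.exp (ξ + r) + Complex.exp (η - r)) := by
    have hE : (starRingEnd ℂ) (Complex.exp ξ) = Complex.exp η := by rw [hη, Complex.exp_conj]
    rw [hypPt, map_mul, map_ofNat, hE, Complex.exp_add, sub_eq_add_neg η, Complex.exp_add]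
    push_cast
    ring
  have hw' : (starRingEnd ℂ) (hypPt (2 * Complex.exp ξ) r) =
      2 * (Complex.exp (η + r) + Complex.exp (ξ - r)) := by
    rw [hw, map_mul, map_add, map_ofNat, ← Complex.exp_conj, ← Complex.exp_conj]
    simp [hη]
  -- With `t = 2r + c`, the power of the conjugate point in `laplace_angInt` yields the polynomial
  -- factor of `kIntPow` with `A = e^(2ξ - l)`.
  have h1 : (starRingEnd ℂ) (hypPt (2 * Complex.exp ξ) r) / 2 = Complex.exp (η + r) *
      (1 + Complex.exp (2 * ξ - l) * Complex.exp (-(2 * r + c))) := by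
    rw [hw', hc', mul_add (Complex.exp (η + r)), mul_one, ← Complex.exp_add, ← Complex.exp_add]
    ring_nf
  have h2 : hypPt (2 * Complex.exp ξ) r * (starRingEnd ℂ) (hypPt (2 * Complex.exp ξ) r) / 4 /
      Real.exp l = Complex.exp (2 * ξ - l) + Complex.exp (2 * η - l) + Complex.exp (2 * r + c) +
        Complex.exp (c - 2 * r) := by
    rw [hw', hw, hc', div_eq_mul_inv _ (Real.exp l : ℂ), Complex.ofReal_exp, ← Complex.exp_neg]
    have e : 2 * (Complex.exp (ξ + r) + Complex.exp (η - r)) *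
        (2 * (Complex.exp (η + r) + Complex.exp (ξ - r))) / 4 * Complex.exp (-l) =
        Complex.exp (ξ + r) * Complex.exp (ξ - r) * Complex.exp (-l) +
        Complex.exp (η - r) * Complex.exp (η + r) * Complex.exp (-l) +
        Complex.exp (ξ + r) * Complex.exp (η + r) * Complex.exp (-l) +
        Complex.exp (η - r) * Complex.exp (ξ - r) * Complex.exp (-l) := by ring
    rw [e]
    simp only [← Complex.exp_add]
    ring_nf
  have h3 : (1 / (Real.exp l : ℂ)) ^ (2 * p + 1) = Complex.exp (-((2 * p + 1) * l)) := by
    rw [Complex.ofReal_exp, one_div, ← Complex.exp_neg, ← Complex.exp_nat_mul]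
    push_cast
    ring_nf
  simp only
  rw [neg_div, h2, h1, h3, mul_pow, ← Complex.exp_nat_mul]
  have e : Complex.exp (2 * ν * r) * Complex.exp ((2 * p : ℕ) * (η + r)) *
      Complex.exp (-((2 * p + 1) * l)) *
      Complex.exp (-(Complex.exp (2 * ξ - l) + Complex.exp (2 * η - l) + Complex.exp (2 * r + c) +
        Complex.exp (c - 2 * r))) =
      Complex.exp (-((2 * p + 1) * l) + 2 * p * η - (ν + p) * c - Complex.exp (2 * ξ - l) -
        Complex.exp (2 * η - l)) * Complex.exp ((ν + p) * (2 * r + c) - Complex.exp (2 * r + c) -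
        Complex.exp (c - 2 * r)) := by
    simp only [← Complex.exp_add]
    push_cast
    ring_nf
  linear_combination (Real.pi * (-1) ^ p *
    (1 + Complex.exp (2 * ξ - l) * Complex.exp (-(2 * r + c))) ^ (2 * p) : ℂ) * e

theorem one_div_exp_cpow (l : ℝ) (a : ℂ) :
    (1 / (Real.exp l : ℂ)) ^ a = Complex.exp (-(l * a)) := by
  have h : (1 / (Real.exp l : ℂ)) = ((Real.exp (-l) : ℝ) : ℂ) := by
    rw [Real.exp_neg]
    push_cast
    rw [one_div]
  have hne : ((Real.exp (-l) : ℝ) : ℂ) ≠ 0 := by exact_mod_cast (Real.exp_pos _).ne'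
  rw [h, Complex.cpow_def_of_ne_zero hne, ← Complex.ofReal_log (Real.exp_pos _).le, Real.log_exp]
  push_cast
  ring_nf

theorem exp_ofReal_cpow (c : ℝ) (a : ℂ) :
    ((Real.exp c : ℝ) : ℂ) ^ a = Complex.exp (c * a) := by
  have h := one_div_exp_cpow (-c) a
  rw [Real.exp_neg] at h
  push_cast at h
  rw [one_div, inv_inv] at h
  push_cast
  rw [h]
  ring_nf

/-- The Laplace transforms of the two sides of the integral representation of the complex Bessel
function agree. -/
theorem laplace_side_eq {ν : ℂ} (hν : ν.re = 0) (hν0 : ν ≠ 0) (p : ℕ) (ξ : ℂ) (l c : ℝ)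
    (hc : c = 2 * ξ.re - l) :
    2 * (Real.pi : ℂ) ^ 2 / Complex.sin (Real.pi * ν) *
      (Complex.exp ((-ν - p) * ξ + (-ν + p) * (starRingEnd ℂ) ξ) *
        ((1 / (Real.exp l : ℂ)) ^ (-ν + p + 1) *
          (Complex.exp (-(Complex.exp (2 * (starRingEnd ℂ) ξ - l)) - Complex.exp (2 * ξ - l)) *
        weberV (-ν - p) (2 * p) (Complex.exp (2 * (starRingEnd ℂ) ξ - l))
          (Complex.exp (2 * ξ - l)))) -
      Complex.exp ((ν + p) * ξ + (ν - p) * (starRingEnd ℂ) ξ) *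
        ((1 / (Real.exp l : ℂ)) ^ (ν + p + 1) *
          (Complex.exp (-(Complex.exp (2 * ξ - l)) - Complex.exp (2 * (starRingEnd ℂ) ξ - l)) *
        weberV (ν - p) (2 * p) (Complex.exp (2 * ξ - l))
          (Complex.exp (2 * (starRingEnd ℂ) ξ - l))))) =
    4 * (Real.pi * (-1) ^ p * Complex.exp (-((2 * p + 1) * l) + 2 * p * (starRingEnd ℂ) ξ -
        (ν + p) * c - Complex.exp (2 * ξ - l) - Complex.exp (2 * (starRingEnd ℂ) ξ - l)) *
      (1 / 2) * kIntPow (2 * p) (ν + p) (Complex.exp (2 * ξ - l)) (Real.exp (2 * c))) := by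
  set η := (starRingEnd ℂ) ξ with hη
  have hc' : (c : ℂ) = ξ + η - l := by
    rw [hc, Complex.add_conj]
    push_cast
    ring
  set A := Complex.exp (2 * ξ - l) with hA
  set B := Complex.exp (2 * η - l) with hB
  have hAB : A * B = (Real.exp (2 * c) : ℝ) := by
    rw [hA, hB, ← Complex.exp_add]
    push_cast
    rw [hc']
    ring_nf
  have hk := kIntPow_eq hν hν0 (2 * p) (p : ℤ) (Real.exp_pos (2 * c)) hAB
  have hsin : Complex.sin (Real.pi * (ν + p)) = (-1) ^ p * Complex.sin (Real.pi * ν) := by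
    rw [mul_add, mul_comm (Real.pi : ℂ) (p : ℂ), Complex.sin_antiperiodic.add_nat_mul_eq]
  have e1 : ν + p - ((2 * p : ℕ) : ℂ) = ν - p := by push_cast; ring
  have e2 : -(ν + p) = -ν - p := by ring
  have e3 : (B ^ (2 * p))⁻¹ = Complex.exp (-(2 * p * (2 * η - l))) := by
    rw [hB, ← Complex.exp_nat_mul, ← Complex.exp_neg]
    push_cast
    rfl
  rw [Int.cast_natCast, hsin, e1, e2, e3, exp_ofReal_cpow, pow_mul, neg_one_sq, one_pow,
    one_mul] at hk
  have hs0 : Complex.sin (Real.pi * ν) ≠ 0 := by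
    simpa using sin_pi_mul_add_int_ne_zero hν hν0 0
  have hm : ((-1 : ℂ) ^ p) ≠ 0 := pow_ne_zero _ (by norm_num)
  have x1 : Complex.exp (-((2 * p + 1) * l) + 2 * p * η - (ν + p) * c - A - B) =
      Complex.exp ((-ν - p) * ξ + (-ν + p) * η) * Complex.exp (-(l * (-ν + p + 1))) *
        Complex.exp (-B - A) := by
    rw [← Complex.exp_add, ← Complex.exp_add, hc']
    ring_nf
  -- The coefficient `y^(ν+p) B^(-2p)` of the second series in `kIntPow_eq` converts the prefactor
  -- of the product with index `(-ν, -p)` into that with index `(ν, p)`.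
  have x2 : Complex.exp ((-ν - p) * ξ + (-ν + p) * η) * Complex.exp (-(l * (-ν + p + 1))) *
      (Complex.exp ((2 * c : ℝ) * (ν + p)) * Complex.exp (-(2 * p * (2 * η - l)))) =
      Complex.exp ((ν + p) * ξ + (ν - p) * η) * Complex.exp (-(l * (ν + p + 1))) := by
    rw [← Complex.exp_add, ← Complex.exp_add, ← Complex.exp_add, ← Complex.exp_add]
    push_cast
    rw [hc']
    ring_nf
  have x3 : -A - B = -B - A := by ring
  rw [hk, one_div_exp_cpow, one_div_exp_cpow, x1, x3]
  set V₁ := weberV (-ν - p) (2 * p) B A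
  set V₂ := weberV (ν - p) (2 * p) A B
  have x4 : ∀ X Y Z U W : ℂ, 2 * (Real.pi : ℂ) ^ 2 / Complex.sin (Real.pi * ν) *
      (X * (Y * (Z * V₁)) - (X * Y * (U * W)) * (Z * V₂)) =
      4 * (Real.pi * (-1) ^ p * (X * Y * Z) * (1 / 2) *
        (Real.pi / ((-1) ^ p * Complex.sin (Real.pi * ν)) * (V₁ - U * W * V₂))) := by
    intro X Y Z U W
    field_simp
    ring
  rw [← x4 _ _ _ _ _, x2]
  ring

/-- The integral representation of the complex Bessel function, for a nonnegative second index. -/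
theorem besselJLog_mul_sub_eq_hypInt {ν : ℂ} (hν : ν.re = 0) (hν0 : ν ≠ 0) (p : ℕ) (ℓ : ℂ) :
    2 * (Real.pi : ℂ) ^ 2 / Complex.sin (Real.pi * ν) *
      (besselJLog (-ν - p) ℓ * besselJLog (-ν + p) ((starRingEnd ℂ) ℓ) -
        besselJLog (ν + p) ℓ * besselJLog (ν - p) ((starRingEnd ℂ) ℓ)) =
      4 * hypInt ν p (Complex.exp ℓ) 1 := by
  set ξ := ℓ - Real.log 2 with hξ
  set η := (starRingEnd ℂ) ξ with hη
  have hηℓ : (starRingEnd ℂ) ℓ - Real.log 2 = η := by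
    rw [hη, hξ, map_sub, Complex.conj_ofReal]
  have hz : Complex.exp ℓ = 2 * Complex.exp ξ := by
    have h2 : (2 : ℂ) = Complex.exp (Real.log 2 : ℝ) := by
      rw [← Complex.ofReal_exp, Real.exp_log two_pos]
      norm_num
    rw [h2, ← Complex.exp_add, hξ]
    ring_nf
  have hz0 : 2 * Complex.exp ξ ≠ 0 := by rw [← hz]; exact Complex.exp_ne_zero _
  set α := Complex.exp (2 * ξ) with hα
  set β := Complex.exp (2 * η) with hβ
  have hαβ : ‖β‖ = ‖α‖ := by
    rw [hβ, hα, Complex.norm_exp, Complex.norm_exp, hη]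
    simp
  set S := 2 * (Real.pi : ℂ) ^ 2 / Complex.sin (Real.pi * ν) with hS
  set E₁ := Complex.exp ((-ν - p) * ξ + (-ν + p) * η) with hE₁
  set E₂ := Complex.exp ((ν + p) * ξ + (ν - p) * η) with hE₂
  set P : ℝ → ℂ := fun x => (x : ℂ) ^ (-ν + p) * besselPsi (-ν + p) (-β * x) *
    besselPsi (-ν - p) (-α * x) with hP
  set Q : ℝ → ℂ := fun x => (x : ℂ) ^ (ν + p) * besselPsi (ν + p) (-α * x) *
    besselPsi (ν - p) (-β * x) with hQ
  set R : ℝ → ℂ := fun x => (x : ℂ) ^ p * hypInt ν p (2 * Complex.exp ξ) x with hR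
  -- The difference of the two sides at `√x z`, times `x^p`. This factor turns every Gamma quotient
  -- on both sides into one that can be summed.
  set f : ℝ → ℂ := fun x => S * (E₁ * P x - E₂ * Q x) - 4 * R x with hf
  have hν' : (-ν).re = 0 := by simp [hν]
  -- Past the threshold `2 ‖β‖ < s` of Weber's integral, in which `α` and `β` exchange roles between
  -- the two products; they have equal norm.
  set σ : ℝ := 2 * ‖α‖ + 1 with hσ
  have hpos : ∀ s : ℝ, σ ≤ s → 0 < s := fun s hs => by
    have := norm_nonneg α
    linarith
  have hlP := fun (s : ℝ) (hs : σ ≤ s) =>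
    laplace_besselPsi_mul hν' p β α (hpos s hs) (by linarith)
  have hlQ := fun (s : ℝ) (hs : σ ≤ s) =>
    laplace_besselPsi_mul hν p α β (hpos s hs) (by rw [hαβ]; linarith)
  have hlR := fun (s : ℝ) (hs : σ ≤ s) => laplace_hypInt hν p hz0 (hpos s hs)
  have hfe : ∀ s x : ℝ, f x * Complex.exp (-(s * x)) =
      S * (E₁ * (P x * Complex.exp (-(s * x))) - E₂ * (Q x * Complex.exp (-(s * x)))) -
        4 * (R x * Complex.exp (-(s * x))) := fun s x => by
    simp only [hf]
    ring
  have hiPQ : ∀ s : ℝ, σ ≤ s → IntegrableOn (fun x : ℝ => S * (E₁ * (P x *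
      Complex.exp (-(s * x))) - E₂ * (Q x * Complex.exp (-(s * x))))) (Ioi 0) := fun s hs =>
    (((hlP s hs).1.const_mul E₁).sub ((hlQ s hs).1.const_mul E₂)).const_mul S
  have hint : IntegrableOn (fun x : ℝ => f x * Complex.exp (-(σ * x))) (Ioi 0) := by
    simp only [hfe]
    exact (hiPQ σ le_rfl).sub ((hlR σ le_rfl).1.const_mul 4)
  have hzero : ∀ s : ℝ, σ < s → ∫ x : ℝ in Ioi 0, f x * Complex.exp (-(s * x)) = 0 := by
    intro s hs
    simp only [hfe]
    rw [integral_sub (hiPQ s hs.le) ((hlR s hs.le).1.const_mul 4), integral_const_mul,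
      integral_sub ((hlP s hs.le).1.const_mul E₁) ((hlQ s hs.le).1.const_mul E₂),
      integral_const_mul, integral_const_mul, integral_const_mul, (hlP s hs.le).2,
      (hlQ s hs.le).2, (hlR s hs.le).2]
    have hsl : s = Real.exp (Real.log s) := (Real.exp_log (hpos s hs.le)).symm
    set l := Real.log s
    have hAl : α / (s : ℂ) = Complex.exp (2 * ξ - l) := by
      rw [hsl, Complex.ofReal_exp, Complex.exp_sub]
    have hBl : β / (s : ℂ) = Complex.exp (2 * η - l) := by
      rw [hsl, Complex.ofReal_exp, Complex.exp_sub]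
    rw [hAl, hBl, hsl, integral_hypPt_eq ν p ξ l _ rfl, ← laplace_side_eq hν hν0 p ξ l _ rfl,
      sub_self]
  have hcont : ContinuousAt f 1 := by
    have h1 : ∀ a : ℂ, ContinuousAt (fun x : ℝ => (x : ℂ) ^ a) 1 := fun a =>
      Complex.continuousAt_ofReal_cpow_const _ _ (Or.inr one_ne_zero)
    have h2 : ∀ μ γ : ℂ, ContinuousAt (fun x : ℝ => besselPsi μ (γ * x)) 1 := fun μ γ =>
      ((continuous_besselPsi μ).comp (by fun_prop)).continuousAt
    have h3 : ContinuousAt R 1 :=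
      (Continuous.continuousAt (by fun_prop)).mul (continuousAt_hypInt hν p hz0 one_pos)
    exact (continuousAt_const.mul ((continuousAt_const.mul (((h1 _).mul (h2 _ _)).mul (h2 _ _))).sub
      (continuousAt_const.mul (((h1 _).mul (h2 _ _)).mul (h2 _ _))))).sub
      (continuousAt_const.mul h3)
  have h0 := eq_zero_of_laplace_eq_zero hint hzero one_pos hcont
  simp only [hf, hP, hQ, hR, Complex.ofReal_one, Complex.one_cpow, one_pow, one_mul,
    mul_one] at h0
  rw [besselJLog_eq, besselJLog_eq, besselJLog_eq, besselJLog_eq, hηℓ, hz, ← sub_eq_zero, ← h0,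
    hE₁, hE₂, Complex.exp_add, Complex.exp_add]
  ring

theorem hypInt_neg (ν : ℂ) (p : ℤ) (z : ℂ) (x : ℝ) :
    hypInt ν (-p) z x = hypInt ν p ((starRingEnd ℂ) z) x := by
  unfold hypInt
  refine integral_congr_ae (ae_of_all _ fun r => ?_)
  simp only
  rw [angInt_neg, hypPt, hypPt, map_mul, map_add, map_mul, map_mul, Complex.conj_ofReal,
    Complex.conj_ofReal, Complex.conj_ofReal]

/-- The integral representation of the complex Bessel function. -/
theorem boldJ_eq_hypInt {κ : ℝ} (hκ : κ ≠ 0) (p : ℤ) {z : ℂ} (hz : z ≠ 0) :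
    boldJ (Complex.I * κ) p z = 4 * hypInt (Complex.I * κ) p z 1 := by
  have hν : (Complex.I * κ).re = 0 := by simp
  have hν0 : Complex.I * κ ≠ 0 := by simpa using hκ
  have hs0 : Complex.sin (Real.pi * (Complex.I * κ)) ≠ 0 := by
    simpa using sin_pi_mul_add_int_ne_zero hν hν0 0
  rw [boldJ, if_neg hs0, boldJQuot, besselJ₂, besselJ₂]
  obtain ⟨n, rfl | rfl⟩ := p.eq_nat_or_neg
  · have h := besselJLog_mul_sub_eq_hypInt hν hν0 n (Complex.log z)
    rw [Complex.exp_log hz] at h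
    rw [← h]
    push_cast
    ring_nf
  -- Negating `p` exchanges the two factors, that is, the conjugate logarithms of `z` and `z̄`; on
  -- the other side `hypInt_neg` does the same.
  · have h := besselJLog_mul_sub_eq_hypInt hν hν0 n ((starRingEnd ℂ) (Complex.log z))
    rw [Complex.conj_conj, Complex.exp_conj, Complex.exp_log hz] at h
    rw [hypInt_neg, ← h]
    push_cast
    ring_nf

/-! ### Fourier integrals and their derivatives -/

section FourierIntegral

variable {X : Type*} [MeasurableSpace X]

/-- The Fourier integral `∫ g(a) e ^ (2 i φ(a) t) dμ(a)`. -/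
noncomputable def fourierInt (μ : Measure X) (φ : X → ℝ) (g : X → ℂ) (t : ℝ) : ℂ :=
  ∫ a, g a * Complex.exp (2 * Complex.I * φ a * t) ∂μ

variable {μ : Measure X} {φ : X → ℝ} {g : X → ℂ}

theorem norm_exp_two_I_mul_ofReal (x t : ℝ) : ‖Complex.exp (2 * Complex.I * x * t)‖ = 1 := by
  rw [Complex.norm_exp]
  simp

theorem aestronglyMeasurable_fourierInt (hφ : Measurable φ) (hg : Integrable g μ) (t : ℝ) :
    AEStronglyMeasurable (fun a => g a * Complex.exp (2 * Complex.I * φ a * t)) μ :=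
  hg.1.mul (Measurable.aestronglyMeasurable (by fun_prop))

theorem integrable_fourierInt (hφ : Measurable φ) (hg : Integrable g μ) (t : ℝ) :
    Integrable (fun a => g a * Complex.exp (2 * Complex.I * φ a * t)) μ :=
  hg.norm.mono' (aestronglyMeasurable_fourierInt hφ hg t) (ae_of_all _ fun a => by
    rw [norm_mul, norm_exp_two_I_mul_ofReal, mul_one])

theorem norm_fourierInt_le (t : ℝ) : ‖fourierInt μ φ g t‖ ≤ ∫ a, ‖g a‖ ∂μ := by
  refine (norm_integral_le_integral_norm _).trans (le_of_eq ?_)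
  simp only [norm_mul, norm_exp_two_I_mul_ofReal, mul_one]

theorem continuous_fourierInt (hφ : Measurable φ) (hg : Integrable g μ) :
    Continuous (fourierInt μ φ g) := by
  refine continuous_of_dominated (bound := fun a => ‖g a‖)
    (fun t => aestronglyMeasurable_fourierInt hφ hg t) (fun t => ae_of_all _ fun a => ?_) hg.norm
    (ae_of_all _ fun a => by fun_prop)
  rw [norm_mul, norm_exp_two_I_mul_ofReal, mul_one]

theorem hasDerivAt_fourierInt (hφ : Measurable φ) (hg : Integrable g μ)
    (hg' : Integrable (fun a => 2 * Complex.I * φ a * g a) μ) (t : ℝ) :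
    HasDerivAt (fourierInt μ φ g) (fourierInt μ φ (fun a => 2 * Complex.I * φ a * g a) t) t := by
  refine (hasDerivAt_integral_of_dominated_loc_of_deriv_le (𝕜 := ℝ) (μ := μ)
    (F := fun t a => g a * Complex.exp (2 * Complex.I * φ a * t))
    (F' := fun t a => 2 * Complex.I * φ a * g a * Complex.exp (2 * Complex.I * φ a * t))
    (bound := fun a => ‖2 * Complex.I * φ a * g a‖) (s := univ) univ_mem
    (Eventually.of_forall fun t => aestronglyMeasurable_fourierInt hφ hg t)
    (integrable_fourierInt hφ hg t) (aestronglyMeasurable_fourierInt hφ hg' t)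
    (ae_of_all _ fun a x _ => ?_) hg'.norm (ae_of_all _ fun a x _ => ?_)).2
  · rw [norm_mul, norm_exp_two_I_mul_ofReal, mul_one]
  · have ha : HasDerivAt (fun t : ℝ => (t : ℂ)) 1 x := (hasDerivAt_id x).ofReal_comp
    refine ((ha.const_mul (2 * Complex.I * φ a)).cexp.const_mul (g a)).congr_deriv ?_
    ring

end FourierIntegral

theorem ofReal_deriv_eq {f : ℝ → ℝ} {F F' : ℝ → ℂ} (h : ∀ t, (f t : ℂ) = F t)
    (hF : ∀ t, HasDerivAt F (F' t) t) (t : ℝ) :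
    DifferentiableAt ℝ f t ∧ ((deriv f t : ℝ) : ℂ) = F' t := by
  have h0 : (fun t => (f t : ℂ)) = F := funext h
  have h1 : HasDerivAt f (F' t).re t := by
    have h2 := Complex.reCLM.hasFDerivAt.comp_hasDerivAt t (hF t)
    have h3 : (Complex.reCLM ∘ F) = f := by
      funext x
      simp [← h x]
    rwa [h3] at h2
  refine ⟨h1.differentiableAt, ?_⟩
  have h4 := h1.differentiableAt.hasDerivAt.ofReal_comp
  rw [h0] at h4
  exact h4.unique (hF t)

theorem contDiff_two_and_deriv_deriv_eq {f : ℝ → ℝ} {F F' F'' : ℝ → ℂ} (h : ∀ t, (f t : ℂ) = F t)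
    (hF : ∀ t, HasDerivAt F (F' t) t) (hF' : ∀ t, HasDerivAt F' (F'' t) t) (hc : Continuous F'') :
    ContDiff ℝ 2 f ∧ ∀ t, ((deriv (deriv f) t : ℝ) : ℂ) = F'' t := by
  have h1 := ofReal_deriv_eq h hF
  have h2 := ofReal_deriv_eq (fun t => (h1 t).2) hF'
  refine ⟨?_, fun t => (h2 t).2⟩
  have h3 : ContDiff ℝ 1 (deriv f) := by
    refine contDiff_one_iff_deriv.mpr ⟨fun t => (h2 t).1, ?_⟩
    have h4 : deriv (deriv f) = fun t => (F'' t).re := by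
      funext t
      rw [← (h2 t).2, Complex.ofReal_re]
    rw [h4]
    exact Complex.continuous_re.comp hc
  have h5 : (2 : WithTop ℕ∞) = 1 + 1 := by norm_num
  rw [h5, contDiff_succ_iff_deriv]
  exact ⟨fun t => (h1 t).1, by simp, h3⟩

/-! ### Gaussian weights -/

theorem integrable_pow_mul_gauss {K : ℝ} (hK : 0 < K) (j : ℕ) :
    Integrable fun κ : ℝ => κ ^ j * Real.exp (-(κ / K) ^ 2) := by
  have h := integrable_rpow_mul_exp_neg_mul_sq (b := 1 / K ^ 2) (by positivity) (s := j)
    (by have : (0 : ℝ) ≤ j := Nat.cast_nonneg j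
        linarith)
  refine h.congr (ae_of_all _ fun κ => ?_)
  simp only [Real.rpow_natCast]
  congr 2
  field_simp

theorem summable_abs_pow_mul_gauss {P : ℝ} (hP : 0 < P) (j : ℕ) :
    Summable fun p : ℤ => |(p : ℝ)| ^ j * Real.exp (-((p : ℝ) / P) ^ 2) := by
  have h := summable_pow_mul_jacobiTheta₂_term_bound 0 (T := 1 / (Real.pi * P ^ 2))
    (by have := Real.pi_pos
        positivity) j
  refine h.congr fun p => ?_
  push_cast
  congr 2
  have := Real.pi_ne_zero
  field_simp
  ring

theorem integrable_pow_mul_gauss_int {P : ℝ} (hP : 0 < P) (j : ℕ) :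
    Integrable (fun p : ℤ => (p : ℝ) ^ j * Real.exp (-((p : ℝ) / P) ^ 2)) Measure.count := by
  rw [integrable_count_iff]
  refine (summable_abs_pow_mul_gauss hP j).congr fun p => ?_
  rw [norm_mul, norm_pow, Real.norm_eq_abs, Real.norm_of_nonneg (Real.exp_pos _).le]

/-- The Gaussian `exp (-(x / L) ^ 2)` as a complex-valued function. -/
noncomputable def cGauss (L x : ℝ) : ℂ := (Real.exp (-(x / L) ^ 2) : ℝ)

theorem integrable_cGauss {K : ℝ} (hK : 0 < K) (j : ℕ) :
    Integrable fun κ : ℝ => (κ : ℂ) ^ j * cGauss K κ := by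
  refine (integrable_pow_mul_gauss hK j).ofReal.congr (ae_of_all _ fun κ => ?_)
  simp [cGauss]

theorem integrable_cGauss_int {P : ℝ} (hP : 0 < P) (j : ℕ) :
    Integrable (fun p : ℤ => (p : ℂ) ^ j * cGauss P p) Measure.count := by
  refine (integrable_pow_mul_gauss_int hP j).ofReal.congr (ae_of_all _ fun p => ?_)
  simp [cGauss]

section Moments

variable {X : Type*} [MeasurableSpace X] {μ : Measure X} {φ : X → ℝ} {L : ℝ}

/-- Each differentiation under the integral brings down `2iφ`, and all moments are integrable; two
of them give the factor `-4`. Stated for a general measure so as to cover the Gaussian on the line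
and on the integers together. -/
theorem contDiff_two_of_eq_fourierInt {f : ℝ → ℝ} (hφ : Measurable φ)
    (hg : ∀ j : ℕ, Integrable (fun a => (φ a : ℂ) ^ j * cGauss L (φ a)) μ)
    (hf : ∀ t, (f t : ℂ) = fourierInt μ φ (fun a => cGauss L (φ a)) t) :
    ContDiff ℝ 2 f ∧ ∀ t, ((deriv (deriv f) t : ℝ) : ℂ) =
      -4 * fourierInt μ φ (fun a => (φ a : ℂ) ^ 2 * cGauss L (φ a)) t := by
  have i0 : Integrable (fun a => cGauss L (φ a)) μ := by simpa using hg 0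
  have i1 : Integrable (fun a => 2 * Complex.I * φ a * cGauss L (φ a)) μ := by
    refine ((hg 1).const_mul (2 * Complex.I)).congr (ae_of_all _ fun a => ?_)
    simp only
    ring
  have i2 : Integrable (fun a => 2 * Complex.I * φ a * (2 * Complex.I * φ a * cGauss L (φ a)))
      μ := by
    refine ((hg 2).const_mul ((2 * Complex.I) ^ 2)).congr (ae_of_all _ fun a => ?_)
    simp only
    ring
  obtain ⟨h1, h2⟩ := contDiff_two_and_deriv_deriv_eq hf (hasDerivAt_fourierInt hφ i0 i1)
    (hasDerivAt_fourierInt hφ i1 i2) (continuous_fourierInt hφ i2)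
  refine ⟨h1, fun t => ?_⟩
  rw [h2, fourierInt, fourierInt, ← integral_const_mul]
  refine integral_congr_ae (ae_of_all _ fun a => ?_)
  simp only
  linear_combination (4 * φ a ^ 2 * cGauss L (φ a) * Complex.exp (2 * Complex.I * φ a * t)) *
    Complex.I_sq

end Moments

theorem gaussK_eq_fourierInt {K : ℝ} (hK : 0 < K) (r : ℝ) :
    (gaussK K r : ℂ) = fourierInt volume id (fun κ => cGauss K (id κ)) r := by
  have h := fourierIntegral_gaussian (b := ((1 / K ^ 2 : ℝ) : ℂ))
    (by rw [Complex.ofReal_re]; positivity) (2 * r)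
  have h1 : fourierInt volume id (fun κ => cGauss K (id κ)) r =
      ∫ x : ℝ, Complex.exp (Complex.I * (2 * r) * x) *
        Complex.exp (-((1 / K ^ 2 : ℝ) : ℂ) * x ^ 2) := by
    refine integral_congr_ae (ae_of_all _ fun κ => ?_)
    simp only [cGauss, id]
    push_cast
    rw [mul_comm]
    ring_nf
  have hK' : (K : ℂ) ≠ 0 := by exact_mod_cast hK.ne'
  have h2 : ((Real.pi : ℂ) / ((1 / K ^ 2 : ℝ) : ℂ)) ^ (1 / 2 : ℂ) = ((√Real.pi * K : ℝ) : ℂ) := by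
    have e : (Real.pi : ℂ) / ((1 / K ^ 2 : ℝ) : ℂ) = ((Real.pi * K ^ 2 : ℝ) : ℂ) := by
      push_cast
      field_simp
    rw [e, show (1 / 2 : ℂ) = ((1 / 2 : ℝ) : ℂ) by push_cast; rfl,
      ← Complex.ofReal_cpow (by have := Real.pi_pos; positivity), ← Real.sqrt_eq_rpow,
      Real.sqrt_mul Real.pi_pos.le, Real.sqrt_sq hK.le]
  rw [h1, h, h2, gaussK]
  push_cast
  congr 2
  field_simp
  ring

theorem summable_thetaP {P : ℝ} (hP : 0 < P) (ω : ℝ) :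
    Summable fun q : ℤ => Real.exp (-(P * (ω + Real.pi * q)) ^ 2) := by
  have h := summable_pow_mul_jacobiTheta₂_term_bound (P ^ 2 * |ω|)
    (T := Real.pi * P ^ 2) (by have := Real.pi_pos; positivity) 0
  refine Summable.of_nonneg_of_le (fun q => (Real.exp_pos _).le) (fun q => ?_) h
  rw [pow_zero, one_mul]
  refine Real.exp_le_exp.mpr ?_
  push_cast
  have h1 : -(ω * q) ≤ |ω| * |(q : ℝ)| := by
    rw [← abs_mul]
    exact neg_le_abs _
  have h2 : 0 ≤ (P * ω) ^ 2 := sq_nonneg _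
  have h3 : 0 ≤ 2 * Real.pi * P ^ 2 := by
    have := Real.pi_pos
    positivity
  have h4 := mul_le_mul_of_nonneg_left h1 h3
  nlinarith

/-- Poisson summation, in the form of the functional equation of the Jacobi theta function; the sum
is reindexed by `q ↦ -q`. -/
theorem thetaP_eq_fourierInt {P : ℝ} (hP : 0 < P) (ω : ℝ) :
    (thetaP P ω : ℂ) = fourierInt Measure.count (fun p : ℤ => (p : ℝ))
      (fun p => cGauss P ((p : ℤ) : ℝ)) ω := by
  have hpi := Real.pi_pos
  have hpi' : (Real.pi : ℂ) ≠ 0 := by exact_mod_cast hpi.ne'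
  have hP' : (P : ℂ) ≠ 0 := by exact_mod_cast hP.ne'
  have hi : Integrable (fun p : ℤ => cGauss P ((p : ℤ) : ℝ)) Measure.count := by
    simpa using integrable_cGauss_int hP 0
  have hi' := integrable_fourierInt (φ := fun p : ℤ => (p : ℝ)) (by fun_prop) hi ω
  have h := Complex.tsum_exp_neg_quadratic (a := ((1 / (Real.pi * P ^ 2) : ℝ) : ℂ))
    (by rw [Complex.ofReal_re]; positivity) (Complex.I * ω / Real.pi)
  rw [fourierInt, integral_countable hi', thetaP]
  have h1 : ∀ p : ℤ, (Measure.count : Measure ℤ).real {p} • (cGauss P ((p : ℤ) : ℝ) *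
      Complex.exp (2 * Complex.I * ((p : ℝ) : ℂ) * ω)) =
      Complex.exp (-Real.pi * ((1 / (Real.pi * P ^ 2) : ℝ) : ℂ) * (p : ℂ) ^ 2 +
        2 * Real.pi * (Complex.I * ω / Real.pi) * p) := by
    intro p
    rw [Measure.real, Measure.count_singleton, ENNReal.toReal_one, one_smul, cGauss,
      Complex.ofReal_exp, ← Complex.exp_add]
    congr 1
    push_cast
    field_simp
  simp only [h1]
  rw [h]
  have h2 : 1 / ((1 / (Real.pi * P ^ 2) : ℝ) : ℂ) ^ (1 / 2 : ℂ) = ((√Real.pi * P : ℝ) : ℂ) := by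
    rw [show (1 / 2 : ℂ) = ((1 / 2 : ℝ) : ℂ) by push_cast; rfl,
      ← Complex.ofReal_cpow (by positivity), ← Real.sqrt_eq_rpow, Real.sqrt_div zero_le_one,
      Real.sqrt_one, Real.sqrt_mul Real.pi_pos.le, Real.sqrt_sq hP.le]
    push_cast
    rw [one_div_one_div]
  rw [h2, Complex.ofReal_mul, Complex.ofReal_tsum, ← (Equiv.neg ℤ).tsum_eq]
  congr 1
  refine tsum_congr fun q => ?_
  rw [Equiv.neg_apply, Complex.ofReal_exp]
  congr 1
  push_cast
  field_simp
  have hI := Complex.I_sq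
  linear_combination (2 * ω * Real.pi * q + ω ^ 2 * (Complex.I ^ 2 - 1)) * hI

theorem weight_eq (K P κ : ℝ) (p : ℤ) :
    (weight K P κ p : ℂ) = cGauss K κ * cGauss P (p : ℝ) := by
  rw [weight, cGauss, cGauss, ← Complex.ofReal_mul, ← Real.exp_add, ← sub_eq_add_neg]

theorem thetaP_contDiff {P : ℝ} (hP : 0 < P) : ContDiff ℝ 2 (thetaP P) ∧
    ∀ ω, ((deriv (deriv (thetaP P)) ω : ℝ) : ℂ) = -4 * fourierInt Measure.count
      (fun p : ℤ => (p : ℝ)) (fun p => (((p : ℤ) : ℝ) : ℂ) ^ 2 * cGauss P ((p : ℤ) : ℝ)) ω :=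
  contDiff_two_of_eq_fourierInt (by fun_prop)
    (fun j => by simpa using integrable_cGauss_int hP j) (thetaP_eq_fourierInt hP)

theorem gaussK_contDiff {K : ℝ} (hK : 0 < K) : ContDiff ℝ 2 (gaussK K) ∧
    ∀ r, ((deriv (deriv (gaussK K)) r : ℝ) : ℂ) = -4 * fourierInt volume
      id (fun κ => (id κ : ℂ) ^ 2 * cGauss K (id κ)) r :=
  contDiff_two_of_eq_fourierInt measurable_id
    (fun j => by simpa using integrable_cGauss hK j) (gaussK_eq_fourierInt hK)

/-! ### Integration over the spectral parameters -/

/-- The density `h(κ, p) (κ² + p²)`. -/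
noncomputable def density (K P : ℝ) (x : ℝ × ℤ) : ℂ :=
  (weight K P x.1 x.2 : ℂ) * ((x.1 : ℂ) ^ 2 + (x.2 : ℂ) ^ 2)

theorem density_eq (K P : ℝ) (x : ℝ × ℤ) :
    density K P x = ((x.1 : ℂ) ^ 2 * cGauss K x.1) * cGauss P (x.2 : ℝ) +
      cGauss K x.1 * ((x.2 : ℂ) ^ 2 * cGauss P (x.2 : ℝ)) := by
  rw [density, weight_eq]
  ring

theorem continuous_density (K P : ℝ) : Continuous (density K P) := by
  have h : Continuous fun x : ℝ × ℤ => (x.2 : ℝ) :=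
    continuous_of_discreteTopology.comp continuous_snd
  have h' : Continuous fun x : ℝ × ℤ => (x.2 : ℂ) :=
    continuous_of_discreteTopology.comp continuous_snd
  unfold density weight
  fun_prop

/-- The weight `1 + |p|` absorbs the growth in `p` of the bound for `angInt`. -/
theorem integrable_density_mul {K P : ℝ} (hK : 0 < K) (hP : 0 < P) :
    Integrable (fun x : ℝ × ℤ => ‖density K P x‖ * (1 + |(x.2 : ℝ)|)) measA := by
  have hb : ∀ j : ℕ, Integrable (fun κ : ℝ => ‖(κ : ℂ) ^ j * cGauss K κ‖) := fun j =>
    (integrable_cGauss hK j).norm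
  have hc : ∀ j : ℕ, Integrable (fun p : ℤ => ‖(p : ℂ) ^ j * cGauss P p‖) Measure.count := fun j =>
    (integrable_cGauss_int hP j).norm
  have h1 := (hb 2).mul_prod ((hc 0).add (hc 1))
  have h2 := (hb 0).mul_prod ((hc 2).add (hc 3))
  refine (h1.add h2).mono' ?_ (ae_of_all _ fun x => ?_)
  · have h : Continuous fun x : ℝ × ℤ => (x.2 : ℝ) :=
      continuous_of_discreteTopology.comp continuous_snd
    have := continuous_density K P
    exact Continuous.aestronglyMeasurable (by fun_prop)
  · rw [Real.norm_of_nonneg (by positivity), density_eq]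
    have h3 := norm_add_le (((x.1 : ℂ) ^ 2 * cGauss K x.1) * cGauss P (x.2 : ℝ))
      (cGauss K x.1 * ((x.2 : ℂ) ^ 2 * cGauss P (x.2 : ℝ)))
    have h4 : ‖(x.2 : ℂ)‖ = |(x.2 : ℝ)| := Complex.norm_intCast _
    refine (mul_le_mul_of_nonneg_right h3 (by positivity)).trans (le_of_eq ?_)
    simp only [Pi.add_apply, norm_mul, norm_pow, h4]
    ring

theorem integrable_density {K P : ℝ} (hK : 0 < K) (hP : 0 < P) :
    Integrable (density K P) measA := by
  refine (integrable_density_mul hK hP).mono' (continuous_density K P).aestronglyMeasurable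
    (ae_of_all _ fun x => ?_)
  exact le_mul_of_one_le_right (norm_nonneg _) (by linarith [abs_nonneg (x.2 : ℝ)])

instance : SFinite measA := by
  unfold measA
  infer_instance

/-- The density is a sum of two products of functions of `κ` and of `p`, giving `k'' θ` and `k θ''`;
the factor `4` of the integral representation meets the `-1/4` from the second derivatives. -/
theorem integral_density_mul_exp {K P : ℝ} (hK : 0 < K) (hP : 0 < P) (r ω : ℝ) :
    4 * ∫ x : ℝ × ℤ, density K P x * (Complex.exp (2 * Complex.I * x.1 * r) *
      Complex.exp (2 * Complex.I * x.2 * ω)) ∂measA =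
      -((deriv (deriv (gaussK K)) r * thetaP P ω + gaussK K r * deriv (deriv (thetaP P)) ω : ℝ) :
        ℂ) := by
  push_cast
  rw [(gaussK_contDiff hK).2 r, (thetaP_contDiff hP).2 ω, gaussK_eq_fourierInt hK,
    thetaP_eq_fourierInt hP]
  have hb : ∀ j : ℕ, Integrable (fun κ : ℝ => ((κ : ℂ) ^ j * cGauss K κ) *
      Complex.exp (2 * Complex.I * (id κ : ℝ) * r)) := fun j =>
    integrable_fourierInt (φ := id) measurable_id (integrable_cGauss hK j) r
  have hc : ∀ j : ℕ, Integrable (fun p : ℤ => ((p : ℂ) ^ j * cGauss P p) *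
      Complex.exp (2 * Complex.I * (p : ℝ) * ω)) Measure.count := fun j =>
    integrable_fourierInt (φ := fun p : ℤ => (p : ℝ)) (by fun_prop) (integrable_cGauss_int hP j) ω
  have h1 : ∀ x : ℝ × ℤ, density K P x * (Complex.exp (2 * Complex.I * x.1 * r) *
      Complex.exp (2 * Complex.I * x.2 * ω)) =
      (((x.1 : ℂ) ^ 2 * cGauss K x.1) * Complex.exp (2 * Complex.I * (id x.1 : ℝ) * r)) *
      (((x.2 : ℂ) ^ 0 * cGauss P x.2) * Complex.exp (2 * Complex.I * (x.2 : ℝ) * ω)) +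
      (((x.1 : ℂ) ^ 0 * cGauss K x.1) * Complex.exp (2 * Complex.I * (id x.1 : ℝ) * r)) *
      (((x.2 : ℂ) ^ 2 * cGauss P x.2) * Complex.exp (2 * Complex.I * (x.2 : ℝ) * ω)) := by
    intro x
    rw [density_eq]
    simp only [id, Complex.ofReal_intCast]
    ring
  simp only [h1]
  rw [measA, integral_add ((hb 2).mul_prod (hc 0)) ((hb 0).mul_prod (hc 2)),
    integral_prod_mul (fun κ : ℝ => ((κ : ℂ) ^ 2 * cGauss K κ) *
      Complex.exp (2 * Complex.I * (id κ : ℝ) * r)) (fun p : ℤ => ((p : ℂ) ^ 0 * cGauss P p) *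
      Complex.exp (2 * Complex.I * (p : ℝ) * ω)),
    integral_prod_mul (fun κ : ℝ => ((κ : ℂ) ^ 0 * cGauss K κ) *
      Complex.exp (2 * Complex.I * (id κ : ℝ) * r)) (fun p : ℤ => ((p : ℂ) ^ 2 * cGauss P p) *
      Complex.exp (2 * Complex.I * (p : ℝ) * ω))]
  simp only [fourierInt, pow_zero, one_mul, id, Complex.ofReal_intCast]
  ring

theorem continuous_angInt_uncurry : Continuous fun q : ℤ × ℂ => angInt q.1 q.2 := by
  unfold angInt
  have h : Continuous fun x : (ℤ × ℂ) × ℝ => (x.1.1 : ℂ) :=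
    continuous_of_discreteTopology.comp (continuous_fst.comp continuous_fst)
  exact intervalIntegral.continuous_parametric_intervalIntegral_of_continuous'
    (by simp only [Function.uncurry_def]; fun_prop) _ _

/-- The integrand of the double integral over spectral parameters and the hyperbola. -/
noncomputable def tripleFun (K P : ℝ) (z : ℂ) (x : ℝ × ℤ) (r : ℝ) : ℂ :=
  density K P x * (Complex.exp (2 * (Complex.I * x.1) * r) * angInt x.2 (hypPt z r))

/-- Licenses the exchange of `r` with `(κ, p)`. It depends on the `ω`-integral being already done,
since only that produces decay in `r`. -/
theorem integrable_tripleFun {K P : ℝ} (hK : 0 < K) (hP : 0 < P) {z : ℂ} (hz : z ≠ 0) :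
    Integrable (Function.uncurry (tripleFun K P z)) (measA.prod volume) := by
  have h1 := (integrable_density_mul hK hP).mul_prod
    (integrable_exp_neg_abs_div_three.const_mul (60 * (1 + ‖z‖ ^ (-(1 / 3) : ℝ))))
  refine h1.mono' ?_ (ae_of_all _ fun q => ?_)
  · have ha : Continuous fun q : (ℝ × ℤ) × ℝ => angInt q.1.2 (hypPt z q.2) :=
      Continuous.comp (g := fun q : ℤ × ℂ => angInt q.1 q.2)
        (f := fun q : (ℝ × ℤ) × ℝ => (q.1.2, hypPt z q.2)) continuous_angInt_uncurry
        ((continuous_snd.comp continuous_fst).prodMk ((continuous_hypPt z).comp continuous_snd))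
    have he : Continuous fun q : (ℝ × ℤ) × ℝ =>
        Complex.exp (2 * (Complex.I * (q.1.1 : ℂ)) * (q.2 : ℂ)) := by
      fun_prop
    have hd : Continuous fun q : (ℝ × ℤ) × ℝ => density K P q.1 :=
      (continuous_density K P).comp continuous_fst
    exact (hd.mul (he.mul ha)).aestronglyMeasurable
  · simp only [Function.uncurry, tripleFun]
    have h2 := norm_angInt_hypPt_le q.1.2 hz one_pos q.2
    rw [Complex.ofReal_one, one_mul, one_mul] at h2
    rw [norm_mul, norm_mul, norm_exp_two_mul (by simp), one_mul]
    refine (mul_le_mul_of_nonneg_left h2 (norm_nonneg _)).trans (le_of_eq ?_)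
    ring

theorem besselIntegrand_ae_eq (K P : ℝ) {z : ℂ} (hz : z ≠ 0) :
    (fun x => 4 * ∫ r, tripleFun K P z x r) =ᵐ[measA] besselIntegrand K P z := by
  -- On the line `ν = iκ` the sine vanishes only at `κ = 0`, a null set, so the limit in the
  -- definition of `boldJ` never matters.
  have h0 : ∀ᵐ κ : ℝ, κ ≠ 0 := by
    simp [ae_iff, measure_singleton]
  have h1 : ∀ᵐ x : ℝ × ℤ ∂measA, x.1 ≠ 0 := Measure.quasiMeasurePreserving_fst.ae h0
  filter_upwards [h1] with x hx
  rw [besselIntegrand, boldJ_eq_hypInt hx _ hz, hypInt]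
  simp only [tripleFun]
  rw [integral_const_mul, density, Real.sqrt_one, Complex.ofReal_one]
  simp only [one_mul]
  ring

theorem integrable_besselIntegrand {K P : ℝ} (hK : 0 < K) (hP : 0 < P) {z : ℂ} (hz : z ≠ 0) :
    Integrable (besselIntegrand K P z) measA :=
  ((integrable_tripleFun hK hP hz).integral_prod_left.const_mul 4).congr
    (besselIntegrand_ae_eq K P hz)

theorem re_exp_mul_hypPt (z : ℂ) (r ω : ℝ) :
    (Complex.exp (Complex.I * ω) * hypPt z r).re = 2 * (z * trh r ω).re := by
  have h1 : Complex.exp (Complex.I * ω) = Real.cos ω + Real.sin ω * Complex.I := by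
    rw [mul_comm, Complex.exp_mul_I, Complex.ofReal_cos, Complex.ofReal_sin]
  rw [h1, hypPt, trh, Real.cosh_eq, Real.sinh_eq]
  simp [-Complex.ofReal_exp, -Complex.ofReal_cos, -Complex.ofReal_sin]
  ring

/-- The second exchange, at fixed `r`: `ω` runs over a bounded interval and the trigonometric
factors are at most one, so integrability of the density alone suffices. -/
theorem integral_tripleFun {K P : ℝ} (hK : 0 < K) (hP : 0 < P) (z : ℂ) (r : ℝ) :
    4 * ∫ x, tripleFun K P z x r ∂measA =
      -((∫ ω in (0 : ℝ)..Real.pi, dualFun K P z r ω : ℝ) : ℂ) := by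
  set G : ℝ × ℤ → ℝ → ℂ := fun x ω => density K P x *
    (Complex.exp (2 * Complex.I * x.1 * r) * Complex.exp (2 * Complex.I * x.2 * ω)) *
      (Real.cos (2 * (z * trh r ω).re) : ℂ) with hG
  have h1 : ∀ x, tripleFun K P z x r = ∫ ω in Ioc 0 Real.pi, G x ω := by
    intro x
    rw [tripleFun, angInt, intervalIntegral.integral_of_le Real.pi_pos.le, ← integral_const_mul,
      ← integral_const_mul]
    refine integral_congr_ae (ae_of_all _ fun ω => ?_)
    simp only [hG]
    rw [re_exp_mul_hypPt]
    ring_nf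
  have hi : Integrable (Function.uncurry G) (measA.prod (volume.restrict (Ioc 0 Real.pi))) := by
    have h2 := (integrable_density hK hP).norm.mul_prod
      (integrable_const (1 : ℝ) : Integrable (fun _ : ℝ => (1 : ℝ))
        (volume.restrict (Ioc 0 Real.pi)))
    refine h2.mono' (Continuous.aestronglyMeasurable ?_) (ae_of_all _ fun q => ?_)
    · have hd := continuous_density K P
      have h : Continuous fun q : (ℝ × ℤ) × ℝ => (q.1.2 : ℂ) :=
        continuous_of_discreteTopology.comp (continuous_snd.comp continuous_fst)
      simp only [Function.uncurry_def, hG, trh]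
      fun_prop
    · simp only [Function.uncurry, hG]
      rw [norm_mul, norm_mul, norm_mul, norm_exp_two_I_mul_ofReal, norm_exp_two_I_mul, one_mul,
        mul_one, Complex.norm_real]
      exact mul_le_of_le_one_right (norm_nonneg (density K P q.1)) (Real.abs_cos_le_one _)
  simp only [h1]
  rw [integral_integral_swap hi, ← integral_const_mul, intervalIntegral.integral_of_le
    Real.pi_pos.le, ← integral_complex_ofReal, ← integral_neg]
  refine integral_congr_ae (ae_of_all _ fun ω => ?_)
  simp only [hG]
  rw [integral_mul_const, ← mul_assoc, integral_density_mul_exp hK hP, dualFun]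
  push_cast
  ring

theorem deriv_deriv_gaussK (K r : ℝ) :
    deriv (deriv (gaussK K)) r = (4 * K ^ 4 * r ^ 2 - 2 * K ^ 2) * gaussK K r := by
  have h1 : ∀ r, HasDerivAt (gaussK K) (-(2 * K ^ 2 * r) * gaussK K r) r := by
    intro r
    have h2 : HasDerivAt (fun r : ℝ => -(K * r) ^ 2) (-(2 * (K * r) * K)) r := by
      have h := (((hasDerivAt_id r).const_mul K).pow 2).neg
      exact HasDerivAt.congr_deriv (f := fun r : ℝ => -(K * r) ^ 2) h (by simp)
    refine (h2.exp.const_mul (√Real.pi * K)).congr_deriv ?_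
    rw [gaussK]
    ring
  have h2 : deriv (gaussK K) = fun r => -(2 * K ^ 2 * r) * gaussK K r :=
    funext fun r => (h1 r).deriv
  rw [h2]
  have h3 : HasDerivAt (fun r : ℝ => -(2 * K ^ 2 * r)) (-(2 * K ^ 2)) r := by
    exact HasDerivAt.congr_deriv (f := fun r : ℝ => -(2 * K ^ 2 * r))
      ((hasDerivAt_id r).const_mul (2 * K ^ 2)).neg (by simp)
  exact HasDerivAt.deriv (f := fun r => -(2 * K ^ 2 * r) * gaussK K r)
    ((h3.mul (h1 r)).congr_deriv (by ring))

theorem continuous_dualFun {K P : ℝ} (hK : 0 < K) (hP : 0 < P) (z : ℂ) :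
    Continuous (Function.uncurry (dualFun K P z)) := by
  have h1 := (gaussK_contDiff hK).1.continuous
  have h2 := (thetaP_contDiff hP).1.continuous
  have h3 : Continuous (deriv (deriv (gaussK K))) := by
    rw [funext (deriv_deriv_gaussK K)]
    fun_prop
  have h4 : Continuous (deriv (deriv (thetaP P))) :=
    (thetaP_contDiff hP).1.iterate_deriv' 0 2 |>.continuous
  simp only [Function.uncurry_def, dualFun, trh]
  fun_prop

/-- Here the Gaussian decay of `k` and `k''` controls `r`, while `θ` and `θ''` are bounded by the
total masses of their Fourier coefficients. -/
theorem integrable_dualIntegrand {K P : ℝ} (hK : 0 < K) (hP : 0 < P) (z : ℂ) :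
    Integrable (dualIntegrand K P z) (volume : Measure (ℝ × AddCircle Real.pi)) := by
  have hcont : Continuous (dualIntegrand K P z) := by
    -- Openness makes the product with the identity of the line a quotient map again, so joint
    -- continuity can be checked upstairs on the plane.
    have hq : IsOpenQuotientMap (Prod.map (id : ℝ → ℝ)
        ((↑) : ℝ → AddCircle Real.pi)) :=
      IsOpenQuotientMap.id.prodMap QuotientAddGroup.isOpenQuotientMap_mk
    rw [hq.isQuotientMap.continuous_iff]
    refine (continuous_dualFun hK hP z).congr fun q => ?_
    exact ((dualFun_periodic K P z q.1).lift_coe q.2).symm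
  obtain ⟨C₁, hC₁⟩ : ∃ C, ∀ ω, |thetaP P ω| ≤ C := by
    refine ⟨∫ p : ℤ, ‖cGauss P ((p : ℤ) : ℝ)‖ ∂Measure.count, fun ω => ?_⟩
    rw [← Real.norm_eq_abs, ← Complex.norm_real, thetaP_eq_fourierInt hP]
    exact norm_fourierInt_le ω
  obtain ⟨C₂, hC₂⟩ : ∃ C, ∀ ω, |deriv (deriv (thetaP P)) ω| ≤ C := by
    refine ⟨‖(-4 : ℂ)‖ * ∫ p : ℤ, ‖(((p : ℤ) : ℝ) : ℂ) ^ 2 * cGauss P ((p : ℤ) : ℝ)‖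
      ∂Measure.count, fun ω => ?_⟩
    rw [← Real.norm_eq_abs, ← Complex.norm_real, (thetaP_contDiff hP).2, norm_mul]
    exact mul_le_mul_of_nonneg_left (norm_fourierInt_le ω) (norm_nonneg _)
  have hg : ∀ j : ℕ, Integrable fun r : ℝ => r ^ j * Real.exp (-(K * r) ^ 2) := by
    intro j
    refine (integrable_pow_mul_gauss (inv_pos.mpr hK) j).congr (ae_of_all _ fun r => ?_)
    simp only [div_inv_eq_mul, mul_comm r K]
  have hg0 : Integrable (gaussK K) := by
    refine ((hg 0).const_mul (√Real.pi * K)).congr (ae_of_all _ fun r => ?_)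
    simp [gaussK]
  have hg2 : Integrable (deriv (deriv (gaussK K))) := by
    refine (((hg 2).const_mul (4 * K ^ 4 * (√Real.pi * K))).sub
      (hg0.const_mul (2 * K ^ 2))).congr (ae_of_all _ fun r => ?_)
    rw [deriv_deriv_gaussK]
    simp only [Pi.sub_apply, gaussK]
    ring
  have hb := (((hg2.norm.mul_const C₁).add (hg0.norm.mul_const C₂)).mul_prod
    (integrable_const (1 : ℝ) : Integrable (fun _ : AddCircle Real.pi => (1 : ℝ)) volume))
  refine hb.mono' hcont.aestronglyMeasurable (ae_of_all _ fun x => ?_)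
  obtain ⟨r, y⟩ := x
  induction y using QuotientAddGroup.induction_on with
  | H ω =>
    have h1 : dualIntegrand K P z (r, (ω : AddCircle Real.pi)) = dualFun K P z r ω :=
      (dualFun_periodic K P z r).lift_coe ω
    rw [h1, dualFun, norm_mul, mul_one]
    refine (mul_le_of_le_one_left (norm_nonneg _) (Real.abs_cos_le_one _)).trans ?_
    refine (norm_add_le _ _).trans ?_
    rw [norm_mul, norm_mul]
    exact add_le_add (mul_le_mul_of_nonneg_left (hC₁ ω) (norm_nonneg _))
      (mul_le_mul_of_nonneg_left (hC₂ ω) (norm_nonneg _))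

theorem integral_dualIntegrand {K P : ℝ} (hK : 0 < K) (hP : 0 < P) (z : ℂ) :
    ∫ x : ℝ × AddCircle Real.pi, dualIntegrand K P z x =
      ∫ r : ℝ, ∫ ω in (0 : ℝ)..Real.pi, dualFun K P z r ω := by
  rw [Measure.volume_eq_prod, integral_prod _ (integrable_dualIntegrand hK hP z)]
  refine integral_congr_ae (ae_of_all _ fun r => ?_)
  have h := AddCircle.intervalIntegral_preimage Real.pi 0
    (fun y : AddCircle Real.pi => dualIntegrand K P z (r, y))
  rw [zero_add] at h
  simp only
  rw [← h]
  refine intervalIntegral.integral_congr fun ω _ => ?_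
  exact (dualFun_periodic K P z r).lift_coe ω

theorem besselIntegral_eq {K P : ℝ} (hK : 0 < K) (hP : 0 < P) {z : ℂ} (hz : z ≠ 0) :
    besselIntegral K P z = ((-∫ x : ℝ × AddCircle Real.pi, dualIntegrand K P z x : ℝ) : ℂ) := by
  rw [besselIntegral, ← integral_congr_ae (besselIntegrand_ae_eq K P hz), integral_const_mul,
    integral_integral_swap (integrable_tripleFun hK hP hz), ← integral_const_mul,
    integral_dualIntegrand hK hP, Complex.ofReal_neg, ← integral_complex_ofReal, ← integral_neg]
  exact integral_congr_ae (ae_of_all _ fun r => integral_tripleFun hK hP z r)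

end BesselRepn

theorem mainTheorem4 (K P : ℝ) (hK : 0 < K) (hP : 0 < P) (z : ℂ) (hz : z ≠ 0) :
    (∀ ω : ℝ, Summable (fun q : ℤ => Real.exp (-(P * (ω + Real.pi * q)) ^ 2))) ∧
    ContDiff ℝ 2 (BesselRepn.thetaP P) ∧
    MeasureTheory.Integrable (BesselRepn.besselIntegrand K P z) BesselRepn.measA ∧
    MeasureTheory.Integrable (BesselRepn.dualIntegrand K P z)
      (MeasureTheory.volume : MeasureTheory.Measure (ℝ × AddCircle Real.pi)) ∧
    BesselRepn.besselIntegral K P z =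
      ((-∫ x : ℝ × AddCircle Real.pi, BesselRepn.dualIntegrand K P z x : ℝ) : ℂ) :=
  ⟨BesselRepn.summable_thetaP hP, (BesselRepn.thetaP_contDiff hP).1,
    BesselRepn.integrable_besselIntegrand hK hP hz, BesselRepn.integrable_dualIntegrand hK hP z,
    BesselRepn.besselIntegral_eq hK hP hz⟩
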